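/- Let $\chi:\mathbb R\to[0,\infty)$ be a smooth function with $\chi=1$ on $\{|u|<\tfrac12\}$ and $\chi=0$ on $\{|u|\ge 1\}$. For a real symmetric matrix $\alpha=(\alpha_{ij})_{1\le i,j\le 2}$, real numbers $N\ge 1$ and $t$, and $x\in\mathbb T^2=(\mathbb R/\mathbb Z)^2$, put $$K_N(t,x)=\sum_{n\in\mathbb Z^2}\chi\Big(\frac{n_1}{N}\Big)\chi\Big(\frac{n_2}{N}\Big)\,e^{2\pi i\left[x\cdot n+t\sum_{i,j}\alpha_{ij}n_in_j\right]},\qquad \langle t\rangle=\sqrt{1+t^2}.$$ There is a set $F$ of symmetric matrices which is null for Lebesgue measure in the coordinates $(\alpha_{11},\alpha_{12},\alpha_{22})\in\mathbb R^3$ such that the following holds for every positive definite symmetric $\alpha\notin F$ with $|\alpha_{ij}|\le 2$ for all $i,j$ and with smallest eigenvalue $\lambda_1>1$. For every $\varepsilon>0$ there is a constant $C=C(\varepsilon,\alpha,\chi)>0$ such that, for all real $N\ge 1$: (i) for every $t>\frac1N$, $$\sup_{x\in\mathbb T^2}|K_N(t,x)|\le C\,N^{\varepsilon}\,N^{4/3}\langle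 t\rangle^{1/6};$$ (ii) for every $T\ge 1$, $$\int_1^T\sup_{x\in\mathbb T^2}|K_N(t,x)|^4\,dt\le C\,N^{\varepsilon}\,N^4\,T.$$ -/

import Mathlib

open MeasureTheory
open scoped ContDiff

noncomputable section

/-- A smooth nonnegative cutoff on the line, equal to `1` on the ball `B(0, 1/2)` and to `0`
off the ball `B(0, 1)`. -/
structure IsCutoff (χ : ℝ → ℝ) : Prop where
  smooth : ContDiff ℝ ∞ χ
  nonneg : ∀ u, 0 ≤ χ u
  eq_one : ∀ u, |u| < 1 / 2 → χ u = 1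
  eq_zero : ∀ u, 1 ≤ |u| → χ u = 0

/-- The symmetric matrix with entries `α₁₁ = a.1`, `α₁₂ = α₂₁ = a.2.1`, `α₂₂ = a.2.2`. These
coordinates identify the symmetric `2 × 2` matrices with `ℝ³` and carry its Lebesgue measure. -/
def symMatrix (a : ℝ × ℝ × ℝ) : Matrix (Fin 2) (Fin 2) ℝ :=
  !![a.1, a.2.1; a.2.1, a.2.2]

/-- Positive definite matrices with entries in `[-2, 2]` and smallest eigenvalue larger
than `1`. -/
structure IsAdmissible (α : Matrix (Fin 2) (Fin 2) ℝ) : Prop where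
  posDef : α.PosDef
  entries_le : ∀ i j, |α i j| ≤ 2
  one_lt_eigenvalue : ∀ μ : ℝ, Module.End.HasEigenvalue (Matrix.toLin' α) μ → 1 < μ

/-- The quadratic form `∑ α_ij n_i n_j` at an integer vector. -/
def quadForm (α : Matrix (Fin 2) (Fin 2) ℝ) (n : Fin 2 → ℤ) : ℝ :=
  ∑ i, ∑ j, α i j * (n i : ℝ) * (n j : ℝ)

/-- The regularized kernel
`K_N(t,x) = ∑_{n ∈ ℤ²} χ(n₁/N) χ(n₂/N) exp(2πi (x·n + t ∑ α_ij n_i n_j))`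
on the torus `𝕋² = (ℝ/ℤ)²`; here `UnitAddTorus.mFourier n x = exp(2πi x·n)`.
For a cutoff `χ` and `N > 0` only finitely many terms are nonzero. -/
def kernelK (χ : ℝ → ℝ) (α : Matrix (Fin 2) (Fin 2) ℝ) (N t : ℝ)
    (x : UnitAddTorus (Fin 2)) : ℂ :=
  ∑' n : Fin 2 → ℤ,
    ((χ ((n 0 : ℝ) / N) * χ ((n 1 : ℝ) / N) : ℝ) : ℂ) *
      (UnitAddTorus.mFourier n x *
        Complex.exp (2 * Real.pi * Complex.I * ((t * quadForm α n : ℝ) : ℂ)))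

/-- `sup_{x ∈ 𝕋²} |K_N(t,x)|`. -/
def supK (χ : ℝ → ℝ) (α : Matrix (Fin 2) (Fin 2) ℝ) (N t : ℝ) : ℝ :=
  ⨆ x : UnitAddTorus (Fin 2), ‖kernelK χ α N t x‖

/-- The bracket `⟨t⟩ = √(1 + t²)`. -/
def bracket (t : ℝ) : ℝ := Real.sqrt (1 + t ^ 2)

end

/-! Weyl differencing removes `x`. Writing `|K_N|²` as a sum over differences `h` turns the
quadratic phase into one that is linear in the remaining variable, so the inner sum factors into two
one-dimensional smooth exponential sums. Each is dominated by a nonnegative trigonometric polynomial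
`gridKernel L` of degree below `L`, with `L` a power of two in `[N, 2N]`. It is a truncated Poisson
kernel of height `L`, concentrated within `1/L` of the integers. Hence `sup_x |K_N(t,x)|²` is at
most a constant times `weylSum L (tα)`, a sum over `|h_i| ≤ 2L` of kernels evaluated at the two
coordinates of `2tαh`. Both claims are statements about this majorant.

Pointwise bound. `weylSum L (tα)` is at most a constant times `L² M`, where `M` bounds the number of
lattice points `(h, m)` in a set with `|h| ≤ L/4` and `|2tαh - m| ≤ 1/(4L)`
(`weylSum_le_of_card_le`). Since `α` is symmetric, `m·h' - m'·h` is a small integer for two such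
points, hence zero: the points span an isotropic subspace, of rank at most two. Pigeonholing then
gives one of two outcomes (`short_vector_or_rational_approx`): a lattice vector of rescaled length
`O(1/M)`, or a denominator `D = O(L²/M)` for which every entry of `2tDα` is within `O(1/M)` of an
integer. The first makes an integer linear form in the entries of `α` small. The second makes the
ratios `α₁₂/α₁₁` and `α₂₂/α₁₁` simultaneously well approximable. For almost every `α` the
corresponding Diophantine exponents are `2+η` and `1/2+η`, and both outcomes yield `M ≲
(tL²)^(1/3+η)`, apart from a small-`t` case that costs `L^(2/3)`. So `weylSum` is about `L^(8/3)
⟨t⟩^(1/3)`, and the square root is (i).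

Fourth moment. The frequencies of `weylSum` are coefficient vectors of products of two integer
linear forms. By the divisor bound only `L^(4+ε)` pairs of index vectors share a frequency
(`exists_card_formMul_eq_le`), so the mean square of `weylSum` over `α` is `O(L^(4+ε))` for each
fixed `t ≥ 1`. Tonelli in `t`, with a weight `t^(-1-δ)` and summation over dyadic `L`, converts this
into a bound for almost every `α` that loses `T^δ`. The loss is harmless when `T ≤ L^10`. For larger
`T` the Diophantine condition separates distinct frequencies and direct integration in `t` suffices
(`ae_hasMomentBound`). -/

/-- The additive character `x ↦ exp(2πix)`. -/
noncomputable def expi (x : ℝ) : ℂ := Complex.exp (2 * Real.pi * Complex.I * (x : ℂ))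

theorem expi_zero : expi 0 = 1 := by simp [expi]

theorem expi_add (x y : ℝ) : expi (x + y) = expi x * expi y := by
  simp only [expi, ← Complex.exp_add]
  congr 1
  push_cast
  ring

theorem norm_expi (x : ℝ) : ‖expi x‖ = 1 := by
  have : 2 * Real.pi * Complex.I * (x : ℂ) = ((2 * Real.pi * x : ℝ) : ℂ) * Complex.I := by
    push_cast; ring
  rw [expi, this, Complex.norm_exp_ofReal_mul_I]

theorem expi_neg (x : ℝ) : expi (-x) = (starRingEnd ℂ) (expi x) := by
  simp only [expi, ← Complex.exp_conj]
  congr 1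
  simp [Complex.conj_ofNat]

theorem expi_natCast_mul (n : ℕ) (x : ℝ) : expi (n * x) = expi x ^ n := by
  simp only [expi, ← Complex.exp_nat_mul]
  congr 1
  push_cast
  ring

theorem expi_intCast_mul (n : ℤ) (x : ℝ) : expi (n * x) = expi x ^ n := by
  simp only [expi, ← Complex.exp_int_mul]
  congr 1
  push_cast
  ring

theorem expi_intCast (n : ℤ) : expi n = 1 := by
  rw [expi, Complex.exp_eq_one_iff]
  exact ⟨n, by push_cast; ring⟩

theorem expi_sub_intCast (x : ℝ) (n : ℤ) : expi (x - n) = expi x := by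
  have h := expi_add (x - n) n
  rw [sub_add_cancel, expi_intCast, mul_one] at h
  exact h.symm

@[fun_prop]
theorem continuous_expi : Continuous expi := by
  unfold expi
  fun_prop

/-! ### The truncated Poisson kernel used as a majorant -/

/-- The ratio `r` with `r ^ L = 1 / 2`. -/
noncomputable def geomRatio (L : ℕ) : ℝ := (1 / 2 : ℝ) ^ (1 / (L : ℝ))

theorem geomRatio_pos (L : ℕ) : 0 < geomRatio L := Real.rpow_pos_of_pos (by norm_num) _

theorem geomRatio_pow {L : ℕ} (hL : L ≠ 0) : geomRatio L ^ L = 1 / 2 := by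
  rw [geomRatio, ← Real.rpow_natCast, ← Real.rpow_mul (by norm_num)]
  have : (L : ℝ) ≠ 0 := by exact_mod_cast hL
  rw [one_div_mul_cancel this, Real.rpow_one]

theorem geomRatio_le_one (L : ℕ) : geomRatio L ≤ 1 :=
  Real.rpow_le_one (by norm_num) (by norm_num) (by positivity)

theorem half_le_geomRatio {L : ℕ} (hL : L ≠ 0) : 1 / 2 ≤ geomRatio L := by
  rw [← geomRatio_pow hL]
  exact pow_le_of_le_one (geomRatio_pos L).le (geomRatio_le_one L) hL

/-- In `(1 - r) ∑ r^j = 1 - r^L = 1/2`, each of the `L` terms is at least `r^L = 1/2`. -/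
theorem one_sub_geomRatio_le {L : ℕ} (hL : L ≠ 0) : 1 - geomRatio L ≤ 1 / L := by
  have h1 : (∑ j ∈ Finset.range L, geomRatio L ^ j) * (geomRatio L - 1) = 1 / 2 - 1 := by
    rw [geom_sum_mul, geomRatio_pow hL]
  have h2 : (L : ℝ) * (1 / 2) ≤ ∑ j ∈ Finset.range L, geomRatio L ^ j := by
    calc (L : ℝ) * (1 / 2) = ∑ j ∈ Finset.range L, (1 / 2 : ℝ) := by simp
      _ ≤ _ := by
        refine Finset.sum_le_sum fun j hj => ?_
        rw [← geomRatio_pow hL]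
        exact pow_le_pow_of_le_one (geomRatio_pos L).le (geomRatio_le_one L)
          (Finset.mem_range.mp hj).le
  have h3 := geomRatio_le_one L
  have hL0 : (0 : ℝ) < L := by exact_mod_cast Nat.pos_of_ne_zero hL
  rw [le_div_iff₀ hL0]
  nlinarith

/-- A nonnegative trigonometric polynomial of degree `< L` comparable to the Poisson kernel
with parameter `geomRatio L`. -/
noncomputable def gridKernel (L : ℕ) (x : ℝ) : ℝ :=
  ‖∑ j ∈ Finset.range L, (geomRatio L : ℂ) ^ j * expi (j * x)‖ ^ 2 / L

theorem gridKernel_nonneg (L : ℕ) (x : ℝ) : 0 ≤ gridKernel L x := by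
  unfold gridKernel; positivity

@[fun_prop]
theorem continuous_gridKernel (L : ℕ) : Continuous (gridKernel L) := by
  unfold gridKernel
  fun_prop

/-- With `|(r e(x))^L| = 1/2` the right side lies between `1/2` and `3/2`. Unlike the Fejér kernel,
`gridKernel` therefore never vanishes and is comparable to `1 / (L |1 - r e(x)|²)` from both sides,
while remaining a trigonometric polynomial. -/
theorem geom_sum_norm_mul (L : ℕ) (x : ℝ) :
    ‖∑ j ∈ Finset.range L, (geomRatio L : ℂ) ^ j * expi (j * x)‖ *
      ‖1 - geomRatio L * expi x‖ = ‖1 - (geomRatio L * expi x) ^ L‖ := by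
  simp_rw [expi_natCast_mul, ← mul_pow]
  rw [← norm_mul, ← norm_neg, ← mul_neg, neg_sub, geom_sum_mul, ← norm_neg]
  congr 1
  ring

theorem norm_geomRatio_mul_expi_pow {L : ℕ} (hL : L ≠ 0) (x : ℝ) :
    ‖((geomRatio L : ℂ) * expi x) ^ L‖ = 1 / 2 := by
  rw [norm_pow, norm_mul, norm_expi, Complex.norm_real, Real.norm_eq_abs,
    abs_of_pos (geomRatio_pos L), mul_one, geomRatio_pow hL]

theorem one_le_gridKernel_mul {L : ℕ} (hL : L ≠ 0) (x : ℝ) :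
    1 ≤ 4 * L * gridKernel L x * ‖1 - geomRatio L * expi x‖ ^ 2 := by
  have h1 := geom_sum_norm_mul L x
  have h2 : 1 / 2 ≤ ‖1 - (geomRatio L * expi x) ^ L‖ := by
    have := norm_sub_norm_le (1 : ℂ) ((geomRatio L * expi x) ^ L)
    rw [norm_geomRatio_mul_expi_pow hL, norm_one] at this
    linarith
  have hL0 : (0 : ℝ) < L := by exact_mod_cast Nat.pos_of_ne_zero hL
  rw [← h1] at h2
  unfold gridKernel
  have h3 : 4 * (L : ℝ) * (‖∑ j ∈ Finset.range L, (geomRatio L : ℂ) ^ j * expi (j * x)‖ ^ 2 / L) *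
      ‖1 - geomRatio L * expi x‖ ^ 2 = 4 * (‖∑ j ∈ Finset.range L, (geomRatio L : ℂ) ^ j *
        expi (j * x)‖ * ‖1 - geomRatio L * expi x‖) ^ 2 := by
    rw [mul_pow, mul_assoc 4, mul_div_cancel₀ _ hL0.ne', mul_assoc]
  rw [h3]
  nlinarith

theorem gridKernel_mul_le {L : ℕ} (hL : L ≠ 0) (x : ℝ) :
    gridKernel L x * (L * ‖1 - geomRatio L * expi x‖ ^ 2) ≤ 9 / 4 := by
  have h1 := geom_sum_norm_mul L x
  have h2 : ‖1 - (geomRatio L * expi x) ^ L‖ ≤ 3 / 2 := by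
    have := norm_sub_le (1 : ℂ) ((geomRatio L * expi x) ^ L)
    rw [norm_geomRatio_mul_expi_pow hL, norm_one] at this
    linarith
  have hL0 : (0 : ℝ) < L := by exact_mod_cast Nat.pos_of_ne_zero hL
  rw [← h1] at h2
  have h3 : gridKernel L x * (L * ‖1 - geomRatio L * expi x‖ ^ 2) =
      (‖∑ j ∈ Finset.range L, (geomRatio L : ℂ) ^ j *
        expi (j * x)‖ * ‖1 - geomRatio L * expi x‖) ^ 2 := by
    rw [gridKernel, ← mul_assoc, div_mul_cancel₀ _ hL0.ne', mul_pow]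
  rw [h3]
  have : 0 ≤ ‖∑ j ∈ Finset.range L, (geomRatio L : ℂ) ^ j *
        expi (j * x)‖ * ‖1 - geomRatio L * expi x‖ := by positivity
  nlinarith

/-- The majorant of `|K_N|²` furnished by Weyl differencing, as a function of the matrix
`[[θ.1, θ.2.1], [θ.2.1, θ.2.2]]`. -/
noncomputable def weylSum (L : ℕ) (θ : ℝ × ℝ × ℝ) : ℝ :=
  ∑ h ∈ Finset.Icc (-(2 * L : ℤ)) (2 * L) ×ˢ Finset.Icc (-(2 * L : ℤ)) (2 * L),
    gridKernel L (2 * (h.1 * θ.1 + h.2 * θ.2.1)) * gridKernel L (2 * (h.1 * θ.2.1 + h.2 * θ.2.2))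

theorem weylSum_nonneg (L : ℕ) (θ : ℝ × ℝ × ℝ) : 0 ≤ weylSum L θ :=
  Finset.sum_nonneg fun _ _ => mul_nonneg (gridKernel_nonneg _ _) (gridKernel_nonneg _ _)

@[fun_prop]
theorem continuous_weylSum (L : ℕ) : Continuous (weylSum L) := by
  unfold weylSum
  fun_prop

/-! ### Second differences -/

theorem sum_Icc_shift {M : ℕ} {f : ℤ → ℂ} (hf : ∀ n, (M : ℤ) < |n| → f n = 0) {k : ℤ}
    (hk : 0 ≤ k) (hk2 : k ≤ 2) :
    ∑ n ∈ Finset.Icc (-M : ℤ) (M + 2), f (n - k) = ∑ n ∈ Finset.Icc (-M : ℤ) M, f n := by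
  have h1 : ∑ n ∈ Finset.Icc (-M : ℤ) (M + 2), f (n - k) =
      ∑ n ∈ (Finset.Icc (-M : ℤ) (M + 2)).map (Equiv.subRight k).toEmbedding, f n := by
    rw [Finset.sum_map]
    rfl
  rw [h1]
  symm
  apply Finset.sum_subset
  · intro n hn
    rw [Finset.mem_Icc] at hn
    rw [Finset.mem_map]
    exact ⟨n + k, by rw [Finset.mem_Icc]; omega, by simp⟩
  · intro n _ hn
    apply hf
    rw [Finset.mem_Icc] at hn
    by_contra h
    rw [not_lt, abs_le] at h
    exact hn h

/-- Two summations by parts, twisted by `r`: multiplying by `(1 - rz)²` replaces the coefficients by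
twisted second differences. The range grows by 2 to hold the shifted support. -/
theorem norm_sum_mul_zpow_le {M : ℕ} {g : ℤ → ℂ} (hg : ∀ n, (M : ℤ) < |n| → g n = 0) (r : ℂ)
    {z : ℂ} (hz : ‖z‖ = 1) :
    ‖1 - r * z‖ ^ 2 * ‖∑ n ∈ Finset.Icc (-M : ℤ) M, g n * z ^ n‖ ≤
      ∑ n ∈ Finset.Icc (-M : ℤ) (M + 2), ‖g n - 2 * r * g (n - 1) + r ^ 2 * g (n - 2)‖ := by
  have hz0 : z ≠ 0 := by
    rintro rfl
    simp at hz
  have hf : ∀ n, (M : ℤ) < |n| → g n * z ^ n = 0 := fun n hn => by rw [hg n hn, zero_mul]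
  have key : (1 - r * z) ^ 2 * ∑ n ∈ Finset.Icc (-M : ℤ) M, g n * z ^ n =
      ∑ n ∈ Finset.Icc (-M : ℤ) (M + 2),
        (g n - 2 * r * g (n - 1) + r ^ 2 * g (n - 2)) * z ^ n := by
    have e0 := sum_Icc_shift hf (k := 0) le_rfl (by norm_num)
    have e1 := sum_Icc_shift hf (k := 1) (by norm_num) (by norm_num)
    have e2 := sum_Icc_shift hf (k := 2) (by norm_num) (by norm_num)
    calc _ = (∑ n ∈ Finset.Icc (-M : ℤ) M, g n * z ^ n)
          - 2 * r * z * (∑ n ∈ Finset.Icc (-M : ℤ) M, g n * z ^ n)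
          + r ^ 2 * z ^ 2 * (∑ n ∈ Finset.Icc (-M : ℤ) M, g n * z ^ n) := by ring
      _ = _ := by
        nth_rw 1 [← e0]
        nth_rw 1 [← e1]
        rw [← e2, Finset.mul_sum, Finset.mul_sum, ← Finset.sum_sub_distrib,
          ← Finset.sum_add_distrib]
        refine Finset.sum_congr rfl fun n _ => ?_
        rw [sub_zero, zpow_sub₀ hz0, zpow_sub₀ hz0, zpow_one, zpow_ofNat]
        field_simp
  calc _ = ‖(1 - r * z) ^ 2 * ∑ n ∈ Finset.Icc (-M : ℤ) M, g n * z ^ n‖ := by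
        rw [norm_mul, norm_pow]
    _ ≤ _ := by
      rw [key]
      refine (norm_sum_le _ _).trans (Finset.sum_le_sum fun n _ => ?_)
      rw [norm_mul, norm_zpow, hz, one_zpow, mul_one]

theorem IsCutoff.exists_bounds {χ : ℝ → ℝ} (hχ : IsCutoff χ) :
    ∃ C : ℝ, 1 ≤ C ∧ (∀ u, |χ u| ≤ C) ∧ (∀ u v, |χ u - χ v| ≤ C * |u - v|) ∧
      ∀ u δ, |χ (u + δ) - 2 * χ u + χ (u - δ)| ≤ C * δ ^ 2 := by
  have hsupp : HasCompactSupport χ := by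
    refine HasCompactSupport.of_support_subset_isCompact (isCompact_Icc (a := (-1 : ℝ)) (b := 1)) ?_
    intro u hu
    by_contra h
    apply hu
    apply hχ.eq_zero
    rw [Set.mem_Icc, ← abs_le] at h
    exact (not_le.mp h).le
  have hd : Differentiable ℝ χ := hχ.smooth.differentiable (by simp)
  have hc1 : ContDiff ℝ ∞ (deriv χ) := by
    have := hχ.smooth
    rw [show (∞ : WithTop ℕ∞) = ∞ + 1 from rfl, contDiff_succ_iff_deriv] at this
    exact this.2.2
  have hd1 : Differentiable ℝ (deriv χ) := hc1.differentiable (by simp)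
  have hc2 : Continuous (deriv (deriv χ)) := hc1.continuous_deriv (by simp)
  obtain ⟨C0, h0⟩ := hsupp.exists_bound_of_continuous hχ.smooth.continuous
  obtain ⟨C1, h1⟩ := hsupp.deriv.exists_bound_of_continuous hc1.continuous
  obtain ⟨C2, h2⟩ := hsupp.deriv.deriv.exists_bound_of_continuous hc2
  have lip1 : ∀ u v, |χ u - χ v| ≤ C1 * |u - v| := fun u v =>
    Convex.norm_image_sub_le_of_norm_deriv_le (s := Set.univ) (fun x _ => hd x)
      (fun x _ => h1 x) convex_univ (Set.mem_univ v) (Set.mem_univ u)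
  have lip2 : ∀ u v, |deriv χ u - deriv χ v| ≤ C2 * |u - v| := fun u v =>
    Convex.norm_image_sub_le_of_norm_deriv_le (s := Set.univ) (fun x _ => hd1 x)
      (fun x _ => h2 x) convex_univ (Set.mem_univ v) (Set.mem_univ u)
  have lip3 : ∀ u δ, |χ (u + δ) - 2 * χ u + χ (u - δ)| ≤ C2 * δ ^ 2 := by
    intro u δ
    have hder : ∀ x, HasDerivAt (fun x => χ (x + δ) - χ x) (deriv χ (x + δ) - deriv χ x) x :=
      fun x => ((hd _).hasDerivAt.comp_add_const x δ).sub (hd x).hasDerivAt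
    have := Convex.norm_image_sub_le_of_norm_hasDerivWithin_le (s := Set.univ)
      (C := C2 * |δ|) (fun x _ => (hder x).hasDerivWithinAt)
      (fun x _ => by simpa using lip2 (x + δ) x) convex_univ (Set.mem_univ (u - δ))
      (Set.mem_univ u)
    rw [Real.norm_eq_abs, Real.norm_eq_abs] at this
    calc _ = |χ (u + δ) - χ u - (χ (u - δ + δ) - χ (u - δ))| := by
          congr 1; rw [sub_add_cancel]; ring
      _ ≤ C2 * |δ| * |u - (u - δ)| := this
      _ = C2 * δ ^ 2 := by rw [sub_sub_cancel, mul_assoc, abs_mul_abs_self]; ring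
  have hmax : 0 ≤ |C0| ∧ 0 ≤ |C1| ∧ 0 ≤ |C2| := ⟨abs_nonneg _, abs_nonneg _, abs_nonneg _⟩
  refine ⟨1 + |C0| + |C1| + |C2|, by linarith, fun u => ?_, fun u v => ?_, fun u δ => ?_⟩
  · have := h0 u
    rw [Real.norm_eq_abs] at this
    linarith [le_abs_self C0]
  · refine (lip1 u v).trans (mul_le_mul_of_nonneg_right ?_ (abs_nonneg _))
    linarith [le_abs_self C1]
  · refine (lip3 u δ).trans (mul_le_mul_of_nonneg_right ?_ (sq_nonneg _))
    linarith [le_abs_self C2]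

/-- Discrete Leibniz rule for a second difference of a product. The constant is `1 + 2 + 1`. -/
theorem abs_secondDiff_mul_le {C δ : ℝ} (hC : 1 ≤ C) (hδ : 0 ≤ δ) {f0 f1 f2 g0 g1 g2 : ℝ}
    (hf0 : |f0| ≤ C) (hg1 : |g1| ≤ C) (hf : |f2 - 2 * f1 + f0| ≤ C * δ ^ 2)
    (hg : |g2 - 2 * g1 + g0| ≤ C * δ ^ 2) (hff : |f2 - f0| ≤ 2 * C * δ)
    (hgg : |g2 - g1| ≤ C * δ) :
    |f2 * g2 - 2 * (f1 * g1) + f0 * g0| ≤ 4 * C ^ 2 * δ ^ 2 := by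
  have h1 : f2 * g2 - 2 * (f1 * g1) + f0 * g0 =
      (f2 - 2 * f1 + f0) * g1 + (f2 - f0) * (g2 - g1) + f0 * (g2 - 2 * g1 + g0) := by ring
  rw [h1]
  have h2 : |(f2 - 2 * f1 + f0) * g1| ≤ C * δ ^ 2 * C := by
    rw [abs_mul]; gcongr
  have h3 : |(f2 - f0) * (g2 - g1)| ≤ 2 * C * δ * (C * δ) := by
    rw [abs_mul]; gcongr
  have h4 : |f0 * (g2 - 2 * g1 + g0)| ≤ C * (C * δ ^ 2) := by
    rw [abs_mul]; gcongr
  calc _ ≤ _ := abs_add_three _ _ _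
    _ ≤ C * δ ^ 2 * C + 2 * C * δ * (C * δ) + C * (C * δ ^ 2) := by gcongr
    _ = _ := by ring

/-- Since `χ` is smooth at scale `N` and `1 - r = O(1/L)`, the twisted second differences are
`O(N⁻²)`. There are `O(L)` of them, so the sum is `O(1 / (L |1 - r e(x)|²))`, which is the size of
the kernel. -/
theorem IsCutoff.exists_sum_bound {χ : ℝ → ℝ} (hχ : IsCutoff χ) :
    ∃ C : ℝ, 0 < C ∧ ∀ (N : ℝ) (L : ℕ), 1 ≤ N → N ≤ L → L ≤ 2 * N → ∀ (h : ℤ) (x : ℝ),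
      ‖∑ n ∈ Finset.Icc (-L : ℤ) L, ((χ ((n + h : ℤ) / N) * χ (n / N) : ℝ) : ℂ) * expi (n * x)‖
        ≤ C * gridKernel L x := by
  obtain ⟨C, hC1, hb, hlip, hsec⟩ := hχ.exists_bounds
  -- The factor 36 is `9 · 2²` from `δ ≤ 2/L`, the 5 comes from `2L + 3 ≤ 5L`, and the 4 from
  -- `one_le_gridKernel_mul`.
  refine ⟨36 * C ^ 2 * 4 * 5, by positivity, fun N L hN hNL hLN h x => ?_⟩
  have hL1 : (1 : ℝ) ≤ L := hN.trans hNL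
  have hL : L ≠ 0 := by
    rintro rfl
    norm_num at hL1
  set δ : ℝ := 1 / N with hδ
  have hδ0 : 0 < δ := by positivity
  have hδL : δ ≤ 2 / L := by
    rw [hδ, div_le_div_iff₀ (by linarith) (by linarith)]
    linarith
  have hr1 := one_sub_geomRatio_le hL
  have hr0 : 0 ≤ 1 - geomRatio L := by linarith [geomRatio_le_one L]
  have hrδ : 1 - geomRatio L ≤ δ := hr1.trans (by
    rw [hδ]; exact one_div_le_one_div_of_le (by linarith) hNL)
  set r := geomRatio L with hr
  set G : ℤ → ℝ := fun n => χ ((n + h : ℤ) / N) * χ (n / N) with hG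
  have hGsupp : ∀ n : ℤ, (L : ℤ) < |n| → ((G n : ℝ) : ℂ) = 0 := by
    intro n hn
    have h1 : (L : ℝ) < |(n : ℝ)| := by exact_mod_cast hn
    have : χ (n / N) = 0 := by
      apply hχ.eq_zero
      rw [abs_div, abs_of_pos (by linarith : (0 : ℝ) < N), le_div_iff₀ (by linarith)]
      linarith
    simp [hG, this]
  have hshift : ∀ (m : ℤ) (k : ℤ), ((m - k : ℤ) : ℝ) / N = m / N - k * δ := by
    intro m k
    rw [hδ]; push_cast; ring
  have hcoef : ∀ n : ℤ, |G n - 2 * r * G (n - 1) + r ^ 2 * G (n - 2)| ≤ 9 * C ^ 2 * δ ^ 2 := by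
    intro n
    -- Expand around `r = 1`: a true second difference, a first difference weighted by `1 - r`, and
    -- a value weighted by `(1 - r)²`, each of order `δ²`.
    have e : G n - 2 * r * G (n - 1) + r ^ 2 * G (n - 2) =
        (G n - 2 * G (n - 1) + G (n - 2)) + 2 * (1 - r) * (G (n - 1) - G (n - 2))
          + (1 - r) ^ 2 * G (n - 2) := by ring
    have s1 : ∀ m : ℤ, |χ ((m : ℤ) / N) - 2 * χ ((m - 1 : ℤ) / N) + χ ((m - 2 : ℤ) / N)|
        ≤ C * δ ^ 2 := by
      intro m
      have := hsec ((m - 1 : ℤ) / N) δ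
      convert this using 4
      · rw [hshift]; push_cast; ring_nf
      · rw [hshift, hshift]; push_cast; ring_nf
    have l1 : ∀ m : ℤ, |χ ((m : ℤ) / N) - χ ((m - 1 : ℤ) / N)| ≤ C * δ := by
      intro m
      refine (hlip _ _).trans (le_of_eq ?_)
      rw [hshift, sub_sub_cancel, Int.cast_one, one_mul, abs_of_pos hδ0]
    have l2 : ∀ m : ℤ, |χ ((m : ℤ) / N) - χ ((m - 2 : ℤ) / N)| ≤ 2 * C * δ := by
      intro m
      refine (hlip _ _).trans (le_of_eq ?_)
      rw [hshift, sub_sub_cancel, abs_of_pos (by push_cast; linarith)]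
      push_cast; ring
    have l3 : ∀ m : ℤ, |χ ((m - 1 : ℤ) / N) - χ ((m - 2 : ℤ) / N)| ≤ C * δ := by
      intro m
      have := l1 (m - 1)
      rwa [sub_sub] at this
    have a1 : |G n - 2 * G (n - 1) + G (n - 2)| ≤ 4 * C ^ 2 * δ ^ 2 := by
      have t1 := s1 (n + h)
      have t2 := l2 (n + h)
      rw [add_sub_right_comm, add_sub_right_comm] at t1
      rw [add_sub_right_comm] at t2
      exact abs_secondDiff_mul_le hC1 hδ0.le (hb _) (hb _) t1 (s1 n) t2 (l1 n)
    have a2 : |G (n - 1) - G (n - 2)| ≤ 2 * C ^ 2 * δ := by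
      have t1 := l3 (n + h)
      rw [add_sub_right_comm, add_sub_right_comm] at t1
      have e2 : G (n - 1) - G (n - 2) =
          (χ ((n - 1 + h : ℤ) / N) - χ ((n - 2 + h : ℤ) / N)) * χ ((n - 1 : ℤ) / N) +
          χ ((n - 2 + h : ℤ) / N) * (χ ((n - 1 : ℤ) / N) - χ ((n - 2 : ℤ) / N)) := by
        simp only [hG]; ring
      rw [e2]
      calc _ ≤ _ := abs_add_le _ _
        _ ≤ C * δ * C + C * (C * δ) := by
          rw [abs_mul, abs_mul]
          gcongr
          · exact hb _
          · exact hb _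
          · exact l3 n
        _ = _ := by ring
    have a3 : |G (n - 2)| ≤ C ^ 2 := by
      simp only [hG]
      rw [abs_mul, sq]
      gcongr
      · exact hb _
      · exact hb _
    rw [e]
    calc _ ≤ _ := abs_add_three _ _ _
      _ ≤ 4 * C ^ 2 * δ ^ 2 + 2 * δ * (2 * C ^ 2 * δ) + δ ^ 2 * C ^ 2 := by
        rw [abs_mul, abs_mul, abs_mul, abs_of_nonneg hr0, abs_of_pos (by norm_num : (0 : ℝ) < 2),
          abs_of_nonneg (sq_nonneg (1 - r))]
        gcongr
      _ = _ := by ring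
  have main := norm_sum_mul_zpow_le hGsupp (r : ℂ) (norm_expi x)
  have hsum : ∑ n ∈ Finset.Icc (-L : ℤ) (L + 2),
      ‖(G n : ℂ) - 2 * r * G (n - 1) + r ^ 2 * G (n - 2)‖ ≤ 36 * C ^ 2 * 5 / L := by
    calc _ ≤ ∑ n ∈ Finset.Icc (-L : ℤ) (L + 2), 9 * C ^ 2 * δ ^ 2 := by
          refine Finset.sum_le_sum fun n _ => ?_
          refine le_trans (le_of_eq ?_) (hcoef n)
          rw [← Real.norm_eq_abs, ← Complex.norm_real]
          push_cast
          rfl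
      _ = (2 * L + 3) * (9 * C ^ 2 * δ ^ 2) := by
          rw [Finset.sum_const, Int.card_Icc, nsmul_eq_mul]
          congr 1
          have : ((L : ℤ) + 2 + 1 - (-L)).toNat = 2 * L + 3 := by omega
          rw [this]; push_cast; ring
      _ ≤ (5 * L) * (9 * C ^ 2 * (2 / L) ^ 2) := by
          gcongr
          linarith
      _ = _ := by field_simp; norm_num
  have h4 := one_le_gridKernel_mul hL x
  rw [← hr] at h4
  simp_rw [expi_intCast_mul]
  set A := ‖∑ n ∈ Finset.Icc (-L : ℤ) L, (G n : ℂ) * expi x ^ n‖ with hA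
  have hA0 : 0 ≤ A := norm_nonneg _
  calc A ≤ A * (4 * L * gridKernel L x * ‖1 - r * expi x‖ ^ 2) := le_mul_of_one_le_right hA0 h4
    _ = 4 * L * gridKernel L x * (‖1 - r * expi x‖ ^ 2 * A) := by ring
    _ ≤ 4 * L * gridKernel L x * (36 * C ^ 2 * 5 / L) := by
      refine mul_le_mul_of_nonneg_left (main.trans hsum) ?_
      have := gridKernel_nonneg L x
      positivity
    _ = _ := by field_simp

/-! ### Weyl differencing of the kernel -/

/-- The unimodular factor of the `n`-th term of the kernel. -/
noncomputable def kernelPhase (α : Matrix (Fin 2) (Fin 2) ℝ) (t : ℝ) (x : UnitAddTorus (Fin 2))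
    (n : ℤ × ℤ) : ℂ :=
  UnitAddTorus.mFourier ![n.1, n.2] x * expi (t * quadForm α ![n.1, n.2])

theorem norm_mFourier_apply (n : Fin 2 → ℤ) (x : UnitAddTorus (Fin 2)) :
    ‖UnitAddTorus.mFourier n x‖ = 1 := by
  simp only [UnitAddTorus.mFourier, fourier_apply, ContinuousMap.coe_mk, norm_prod,
    Circle.norm_coe, Finset.prod_const_one]

theorem norm_kernelPhase (α : Matrix (Fin 2) (Fin 2) ℝ) (t : ℝ) (x : UnitAddTorus (Fin 2))
    (n : ℤ × ℤ) : ‖kernelPhase α t x n‖ = 1 := by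
  rw [kernelPhase, norm_mul, norm_mFourier_apply, norm_expi, mul_one]

theorem kernelK_eq_sum {χ : ℝ → ℝ} (hχ : IsCutoff χ) (α : Matrix (Fin 2) (Fin 2) ℝ) {N : ℝ}
    (hN : 0 < N) {L : ℕ} (hNL : N ≤ L) (t : ℝ) (x : UnitAddTorus (Fin 2)) :
    kernelK χ α N t x = ∑ n ∈ Finset.Icc (-L : ℤ) L ×ˢ Finset.Icc (-L : ℤ) L,
      ((χ (n.1 / N) * χ (n.2 / N) : ℝ) : ℂ) * kernelPhase α t x n := by
  rw [kernelK, ← (finTwoArrowEquiv ℤ).symm.tsum_eq]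
  rw [tsum_eq_sum]
  · rfl
  · intro n hn
    have hz : ∀ m : ℤ, m ∉ Finset.Icc (-L : ℤ) L → χ (m / N) = 0 := by
      intro m hm
      rw [Finset.mem_Icc, ← abs_le, not_le] at hm
      have h1 : (L : ℝ) < |(m : ℝ)| := by exact_mod_cast hm
      apply hχ.eq_zero
      rw [abs_div, abs_of_pos hN, le_div_iff₀ hN]
      linarith
    rw [Finset.mem_product, not_and_or] at hn
    rcases hn with hn | hn
    · simp [finTwoArrowEquiv, hz _ hn]
    · simp [finTwoArrowEquiv, hz _ hn]

theorem quadForm_symMatrix (a : ℝ × ℝ × ℝ) (m n : ℤ) :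
    quadForm (symMatrix a) ![m, n] = a.1 * m ^ 2 + 2 * a.2.1 * m * n + a.2.2 * n ^ 2 := by
  simp [quadForm, symMatrix, Fin.sum_univ_two]
  ring

/-- The quadratic terms in `n` cancel, so the phase is linear in `n` and splits over the two
coordinates. The dependence on `x` is confined to a unimodular factor in `h`. -/
theorem kernelPhase_add_mul_conj (a : ℝ × ℝ × ℝ) (t : ℝ) (x : UnitAddTorus (Fin 2))
    (n h : ℤ × ℤ) :
    kernelPhase (symMatrix a) t x (n + h) * (starRingEnd ℂ) (kernelPhase (symMatrix a) t x n) =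
      kernelPhase (symMatrix a) t x h *
        (expi (n.1 * (2 * (h.1 * (t * a.1) + h.2 * (t * a.2.1)))) *
          expi (n.2 * (2 * (h.1 * (t * a.2.1) + h.2 * (t * a.2.2))))) := by
  have e1 : (![(n + h).1, (n + h).2] : Fin 2 → ℤ) = ![n.1, n.2] + ![h.1, h.2] := by
    simp
  have hm := Complex.mul_conj (UnitAddTorus.mFourier ![n.1, n.2] x)
  rw [Complex.normSq_eq_norm_sq, norm_mFourier_apply] at hm
  rw [kernelPhase, kernelPhase, kernelPhase, e1, UnitAddTorus.mFourier_add, map_mul, ← expi_neg]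
  have e2 : expi (t * quadForm (symMatrix a) (![n.1, n.2] + ![h.1, h.2])) *
      expi (-(t * quadForm (symMatrix a) ![n.1, n.2])) =
      expi (t * quadForm (symMatrix a) ![h.1, h.2]) *
        (expi (n.1 * (2 * (h.1 * (t * a.1) + h.2 * (t * a.2.1)))) *
          expi (n.2 * (2 * (h.1 * (t * a.2.1) + h.2 * (t * a.2.2))))) := by
    rw [← expi_add, ← expi_add, ← expi_add, ← e1, quadForm_symMatrix, quadForm_symMatrix,
      quadForm_symMatrix]
    congr 1
    simp only [Prod.fst_add, Prod.snd_add]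
    push_cast
    ring
  calc _ = (UnitAddTorus.mFourier ![n.1, n.2] x *
          (starRingEnd ℂ) (UnitAddTorus.mFourier ![n.1, n.2] x)) *
        UnitAddTorus.mFourier ![h.1, h.2] x *
        (expi (t * quadForm (symMatrix a) (![n.1, n.2] + ![h.1, h.2])) *
      expi (-(t * quadForm (symMatrix a) ![n.1, n.2]))) := by ring
    _ = _ := by
      rw [hm, e2]
      push_cast
      ring

/-- Open the square and substitute `m = n + h`. Vanishing of `f` off `B` allows the full sum over `n
∈ B` for every `h`. -/
theorem norm_sq_sum_le_sum_norm {ι : Type*} [AddCommGroup ι] (B D : Finset ι) (f : ι → ℂ)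
    (hf : ∀ n, n ∉ B → f n = 0) (hD : ∀ m ∈ B, ∀ n ∈ B, m - n ∈ D) :
    ‖∑ n ∈ B, f n‖ ^ 2 ≤ ∑ h ∈ D, ‖∑ n ∈ B, f (n + h) * (starRingEnd ℂ) (f n)‖ := by
  have h1 : ((‖∑ n ∈ B, f n‖ ^ 2 : ℝ) : ℂ) = ∑ h ∈ D, ∑ n ∈ B, f (n + h) * (starRingEnd ℂ) (f n) := by
    rw [← Complex.normSq_eq_norm_sq, ← Complex.mul_conj, map_sum, Finset.sum_comm, Finset.mul_sum]
    refine Finset.sum_congr rfl fun n hn => ?_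
    rw [← Finset.sum_mul]
    congr 1
    refine Eq.trans ?_ (Finset.sum_map D (addLeftEmbedding n) f)
    apply Finset.sum_subset
    · intro m hm
      rw [Finset.mem_map]
      exact ⟨m - n, hD m hm n hn, by simp⟩
    · intro m _ hm
      exact hf m hm
  calc ‖∑ n ∈ B, f n‖ ^ 2 = ‖((‖∑ n ∈ B, f n‖ ^ 2 : ℝ) : ℂ)‖ := by
        rw [Complex.norm_real, Real.norm_eq_abs, abs_of_nonneg (sq_nonneg _)]
    _ ≤ _ := by
      rw [h1]
      exact norm_sum_le _ _

theorem IsCutoff.exists_norm_kernelK_sq_le {χ : ℝ → ℝ} (hχ : IsCutoff χ) :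
    ∃ C : ℝ, 0 < C ∧ ∀ (a : ℝ × ℝ × ℝ) (N : ℝ) (L : ℕ), 1 ≤ N → N ≤ L → L ≤ 2 * N →
      ∀ (t : ℝ) (x : UnitAddTorus (Fin 2)),
      ‖kernelK χ (symMatrix a) N t x‖ ^ 2 ≤ C * weylSum L (t • a) := by
  obtain ⟨C, hC, hsum⟩ := hχ.exists_sum_bound
  refine ⟨C ^ 2, by positivity, fun a N L hN hNL hLN t x => ?_⟩
  rw [kernelK_eq_sum hχ _ (by linarith) hNL]
  have hz : ∀ m : ℤ, m ∉ Finset.Icc (-L : ℤ) L → χ (m / N) = 0 := by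
    intro m hm
    rw [Finset.mem_Icc, ← abs_le, not_le] at hm
    have h1 : (L : ℝ) < |(m : ℝ)| := by exact_mod_cast hm
    apply hχ.eq_zero
    rw [abs_div, abs_of_pos (by linarith : 0 < N), le_div_iff₀ (by linarith)]
    linarith
  refine (norm_sq_sum_le_sum_norm _ (Finset.Icc (-(2 * L : ℤ)) (2 * L) ×ˢ
    Finset.Icc (-(2 * L : ℤ)) (2 * L)) _ ?_ ?_).trans ?_
  · intro n hn
    rw [Finset.mem_product, not_and_or] at hn
    rcases hn with hn | hn <;> simp [hz _ hn]
  · intro m hm n hn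
    simp only [Finset.mem_product, Finset.mem_Icc, Prod.fst_sub, Prod.snd_sub] at hm hn ⊢
    omega
  · rw [weylSum, Finset.mul_sum]
    refine Finset.sum_le_sum fun h _ => ?_
    have e : ∑ n ∈ Finset.Icc (-L : ℤ) L ×ˢ Finset.Icc (-L : ℤ) L,
        ((χ ((n + h).1 / N) * χ ((n + h).2 / N) : ℝ) : ℂ) * kernelPhase (symMatrix a) t x (n + h) *
        (starRingEnd ℂ) (((χ (n.1 / N) * χ (n.2 / N) : ℝ) : ℂ) * kernelPhase (symMatrix a) t x n) =
        kernelPhase (symMatrix a) t x h *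
        ((∑ n ∈ Finset.Icc (-L : ℤ) L, ((χ ((n + h.1 : ℤ) / N) * χ (n / N) : ℝ) : ℂ) *
          expi (n * (2 * (h.1 * (t * a.1) + h.2 * (t * a.2.1))))) *
        ∑ n ∈ Finset.Icc (-L : ℤ) L, ((χ ((n + h.2 : ℤ) / N) * χ (n / N) : ℝ) : ℂ) *
          expi (n * (2 * (h.1 * (t * a.2.1) + h.2 * (t * a.2.2))))) := by
      rw [Finset.sum_mul_sum, ← Finset.sum_product', Finset.mul_sum]
      refine Finset.sum_congr rfl fun n _ => ?_
      have := kernelPhase_add_mul_conj a t x n h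
      rw [map_mul, Complex.conj_ofReal]
      calc _ = ((χ ((n + h).1 / N) * χ ((n + h).2 / N) : ℝ) : ℂ) *
          ((χ (n.1 / N) * χ (n.2 / N) : ℝ) : ℂ) * (kernelPhase (symMatrix a) t x (n + h) *
            (starRingEnd ℂ) (kernelPhase (symMatrix a) t x n)) := by ring
        _ = _ := by
          rw [this]
          simp only [Prod.fst_add, Prod.snd_add]
          push_cast
          ring
    rw [e, norm_mul, norm_kernelPhase, one_mul, norm_mul]
    have b1 := hsum N L hN hNL hLN h.1 (2 * (h.1 * (t * a.1) + h.2 * (t * a.2.1)))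
    have b2 := hsum N L hN hNL hLN h.2 (2 * (h.1 * (t * a.2.1) + h.2 * (t * a.2.2)))
    calc _ ≤ _ := mul_le_mul b1 b2 (norm_nonneg _)
          (mul_nonneg hC.le (gridKernel_nonneg _ _))
      _ = _ := by
        simp only [Prod.smul_fst, Prod.smul_snd, smul_eq_mul]
        ring

/-! ### The divisor bound and products of linear forms -/

/-- The divisor count is multiplicative. A prime `p ≥ P`, where `P > 2^(1/ε)`, satisfies `v + 1 ≤
2^v ≤ p^(εv)`; each of the fewer than `P` smaller primes costs at most a factor `K`. -/
theorem exists_card_divisors_le {ε : ℝ} (hε : 0 < ε) :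
    ∃ C : ℝ, 1 ≤ C ∧ ∀ n : ℕ, n ≠ 0 → (n.divisors.card : ℝ) ≤ C * (n : ℝ) ^ ε := by
  have hl2 : 0 < Real.log 2 := Real.log_pos (by norm_num)
  -- Chosen so that `v + 1 ≤ K (1 + v ε log 2) ≤ K 2^(εv)`.
  set K : ℝ := max 1 (1 / (ε * Real.log 2)) with hK
  have hK1 : 1 ≤ K := le_max_left _ _
  have hK2 : 1 ≤ K * (ε * Real.log 2) := by
    have := le_max_right 1 (1 / (ε * Real.log 2))
    rw [← hK, div_le_iff₀ (by positivity)] at this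
    exact this
  obtain ⟨P, hP⟩ := exists_nat_gt ((2 : ℝ) ^ (1 / ε))
  have hP0 : (0 : ℝ) < P := lt_trans (Real.rpow_pos_of_pos (by norm_num) _) hP
  refine ⟨K ^ P, one_le_pow₀ hK1, fun n hn => ?_⟩
  have hfac : ∀ p ∈ n.primeFactors, ((n.factorization p + 1 : ℕ) : ℝ) ≤
      (if p < P then K else 1) * ((p : ℝ) ^ ε) ^ n.factorization p := by
    intro p hp
    have hp2 : (2 : ℝ) ≤ p := by exact_mod_cast (Nat.prime_of_mem_primeFactors hp).two_le
    set v := n.factorization p with hv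
    split_ifs with hpP
    · have h1 : 1 + (v : ℝ) * (ε * Real.log 2) ≤ ((p : ℝ) ^ ε) ^ v := by
        have h2 : ((2 : ℝ) ^ ε) ^ v ≤ ((p : ℝ) ^ ε) ^ v := by gcongr
        refine le_trans ?_ h2
        rw [Real.rpow_def_of_pos (by norm_num), ← Real.exp_nat_mul]
        have := Real.add_one_le_exp ((v : ℝ) * (Real.log 2 * ε))
        linarith
      calc ((v + 1 : ℕ) : ℝ) = 1 + v * 1 := by push_cast; ring
        _ ≤ K * 1 + v * (K * (ε * Real.log 2)) := by gcongr; linarith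
        _ = K * (1 + (v : ℝ) * (ε * Real.log 2)) := by ring
        _ ≤ _ := by gcongr
    · have h1 : (2 : ℝ) ≤ (p : ℝ) ^ ε := by
        have h2 : (2 : ℝ) ^ (1 / ε) ≤ p := hP.le.trans (by exact_mod_cast not_lt.mp hpP)
        calc (2 : ℝ) = ((2 : ℝ) ^ (1 / ε)) ^ ε := by
              rw [← Real.rpow_mul (by norm_num), one_div_mul_cancel hε.ne', Real.rpow_one]
          _ ≤ _ := by gcongr
      rw [one_mul]
      calc ((v + 1 : ℕ) : ℝ) ≤ (2 : ℝ) ^ v := by exact_mod_cast Nat.lt_two_pow_self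
        _ ≤ _ := by gcongr
  have hprod : (n : ℝ) ^ ε = ∏ p ∈ n.primeFactors, ((p : ℝ) ^ ε) ^ n.factorization p := by
    conv_lhs => rw [← Nat.prod_factorization_pow_eq_self hn]
    rw [Finsupp.prod, Nat.support_factorization, Nat.cast_prod,
      ← Real.finsetProd_rpow _ _ (fun i _ => by positivity)]
    refine Finset.prod_congr rfl fun p _ => ?_
    rw [Nat.cast_pow, ← Real.rpow_natCast, ← Real.rpow_natCast, ← Real.rpow_mul (by positivity),
      ← Real.rpow_mul (by positivity), mul_comm]
  have hKP : ∏ p ∈ n.primeFactors, (if p < P then K else 1) ≤ K ^ P := by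
    rw [Finset.prod_ite, Finset.prod_const_one, mul_one, Finset.prod_const]
    apply pow_le_pow_right₀ hK1
    calc _ ≤ (Finset.range P).card := Finset.card_le_card fun p hp => by
          rw [Finset.mem_filter] at hp
          exact Finset.mem_range.mpr hp.2
      _ = P := Finset.card_range P
  rw [Nat.card_divisors hn, Nat.cast_prod]
  calc _ ≤ ∏ p ∈ n.primeFactors, (if p < P then K else 1) * ((p : ℝ) ^ ε) ^ n.factorization p :=
        Finset.prod_le_prod (fun _ _ => by positivity) hfac
    _ ≤ _ := by
      rw [Finset.prod_mul_distrib, ← hprod]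
      gcongr

/-- The integer divisors of `A ≠ 0`. -/
def intDivs (A : ℤ) : Finset ℤ :=
  A.natAbs.divisors.image (fun d : ℕ => (d : ℤ)) ∪ A.natAbs.divisors.image (fun d : ℕ => -(d : ℤ))

theorem mem_intDivs {A d : ℤ} (hA : A ≠ 0) (hd : d ∣ A) : d ∈ intDivs A := by
  rw [intDivs, Finset.mem_union, Finset.mem_image, Finset.mem_image]
  have h : d.natAbs ∈ A.natAbs.divisors := by
    rw [Nat.mem_divisors]
    exact ⟨Int.natAbs_dvd_natAbs.mpr hd, Int.natAbs_ne_zero.mpr hA⟩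
  rcases Int.natAbs_eq d with h1 | h1
  · exact Or.inl ⟨_, h, h1.symm⟩
  · exact Or.inr ⟨_, h, h1.symm⟩

theorem card_intDivs_le (A : ℤ) : (intDivs A).card ≤ 2 * A.natAbs.divisors.card := by
  refine (Finset.card_union_le _ _).trans ?_
  have h1 := Finset.card_image_le (s := A.natAbs.divisors) (f := fun d : ℕ => (d : ℤ))
  have h2 := Finset.card_image_le (s := A.natAbs.divisors) (f := fun d : ℕ => -(d : ℤ))
  omega

/-- The coefficients of the product of the linear forms `h.1 X + h.2 Y` and `k.1 X + k.2 Y`. -/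
def formMul (p : (ℤ × ℤ) × (ℤ × ℤ)) : ℤ × ℤ × ℤ :=
  (p.1.1 * p.2.1, p.1.1 * p.2.2 + p.1.2 * p.2.1, p.1.2 * p.2.2)

theorem formMul_eq_zero_iff {p : (ℤ × ℤ) × (ℤ × ℤ)} : formMul p = 0 ↔ p.1 = 0 ∨ p.2 = 0 := by
  obtain ⟨⟨a, b⟩, ⟨c, d⟩⟩ := p
  simp only [formMul, Prod.mk_eq_zero]
  constructor
  · rintro ⟨h1, h2, h3⟩
    rcases mul_eq_zero.mp h1 with h | h <;> rcases mul_eq_zero.mp h3 with h' | h' <;> subst h <;>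
      subst h' <;> simp_all
  · rintro (⟨rfl, rfl⟩ | ⟨rfl, rfl⟩) <;> simp

/-- Evaluating a factorization at an integer point factors the value there. When the values at two
independent points are nonzero, the second form takes divisors of them as values. Those two divisors
determine the second form, and cancelling them determines the first. -/
theorem card_fiber_le_of_eval (S : Finset ((ℤ × ℤ) × (ℤ × ℤ))) (v : ℤ × ℤ × ℤ) (x y x' y' : ℤ)
    (hdet : x * y' - x' * y ≠ 0) (h1 : v.1 * x ^ 2 + v.2.1 * x * y + v.2.2 * y ^ 2 ≠ 0)
    (h2 : v.1 * x' ^ 2 + v.2.1 * x' * y' + v.2.2 * y' ^ 2 ≠ 0) :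
    (S.filter (fun p => formMul p = v)).card ≤
      (intDivs (v.1 * x ^ 2 + v.2.1 * x * y + v.2.2 * y ^ 2)).card *
        (intDivs (v.1 * x' ^ 2 + v.2.1 * x' * y' + v.2.2 * y' ^ 2)).card := by
  have hev : ∀ p : (ℤ × ℤ) × (ℤ × ℤ), formMul p = v → ∀ x y : ℤ,
      v.1 * x ^ 2 + v.2.1 * x * y + v.2.2 * y ^ 2 =
        (p.2.1 * x + p.2.2 * y) * (p.1.1 * x + p.1.2 * y) := by
    rintro p rfl x y
    simp only [formMul]
    ring
  have hsolve : ∀ a b a' b' : ℤ, a * x + b * y = a' * x + b' * y →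
      a * x' + b * y' = a' * x' + b' * y' → a = a' ∧ b = b' := by
    intro a b a' b' e1 e2
    constructor
    · have : (a - a') * (x * y' - x' * y) = 0 := by linear_combination y' * e1 - y * e2
      exact sub_eq_zero.mp ((mul_eq_zero.mp this).resolve_right hdet)
    · have : (b - b') * (x * y' - x' * y) = 0 := by linear_combination x * e2 - x' * e1
      exact sub_eq_zero.mp ((mul_eq_zero.mp this).resolve_right hdet)
  rw [← Finset.card_product]
  refine Finset.card_le_card_of_injOn
    (fun p => (p.2.1 * x + p.2.2 * y, p.2.1 * x' + p.2.2 * y')) ?_ ?_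
  · intro p hp
    rw [Finset.mem_coe, Finset.mem_filter] at hp
    rw [Finset.mem_coe, Finset.mem_product]
    exact ⟨mem_intDivs h1 ⟨_, hev p hp.2 x y⟩, mem_intDivs h2 ⟨_, hev p hp.2 x' y'⟩⟩
  · intro p hp p' hp' he
    rw [Finset.mem_coe, Finset.mem_filter] at hp hp'
    rw [Prod.mk.injEq] at he
    have hk := hsolve _ _ _ _ he.1 he.2
    have e1 := (hev p hp.2 x y).symm.trans (hev p' hp'.2 x y)
    have e2 := (hev p hp.2 x' y').symm.trans (hev p' hp'.2 x' y')
    have n1 := h1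
    rw [hev p hp.2 x y] at n1
    have n2 := h2
    rw [hev p hp.2 x' y'] at n2
    rw [← he.1] at e1
    rw [← he.2] at e2
    have hh := hsolve _ _ _ _ (mul_left_cancel₀ (left_ne_zero_of_mul n1) e1)
      (mul_left_cancel₀ (left_ne_zero_of_mul n2) e2)
    exact Prod.ext (Prod.ext hh.1 hh.2) (Prod.ext hk.1 hk.2)

/-- The index set of the Fourier expansion of `weylSum L`. -/
noncomputable def weylIndex (L : ℕ) : Finset ((ℤ × ℤ) × (ℤ × ℤ)) :=
  (Finset.Icc (-(2 * L : ℤ)) (2 * L) ×ˢ Finset.Icc (-(2 * L : ℤ)) (2 * L)) ×ˢ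
    (Finset.Icc (-L : ℤ) L ×ˢ Finset.Icc (-L : ℤ) L)

theorem card_weylIndex_le {L : ℕ} (hL : L ≠ 0) : (weylIndex L).card ≤ 225 * L ^ 4 := by
  have h1 : (2 * (L : ℤ) + 1 - (-(2 * L : ℤ))).toNat = 4 * L + 1 := by omega
  have h2 : ((L : ℤ) + 1 - (-(L : ℤ))).toNat = 2 * L + 1 := by omega
  simp only [weylIndex, Finset.card_product, Int.card_Icc, h1, h2]
  have h3 : 4 * L + 1 ≤ 5 * L := by omega
  have h4 : 2 * L + 1 ≤ 3 * L := by omega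
  calc _ ≤ (5 * L) * (5 * L) * ((3 * L) * (3 * L)) := by gcongr
    _ = _ := by ring

theorem abs_mul_le_of_abs_le {a b A B : ℤ} (ha : |a| ≤ A) (hb : |b| ≤ B) : |a * b| ≤ A * B := by
  rw [abs_mul]
  exact mul_le_mul ha hb (abs_nonneg _) ((abs_nonneg _).trans ha)

theorem formMul_bound {L : ℕ} {p : (ℤ × ℤ) × (ℤ × ℤ)} (hp : p ∈ weylIndex L) :
    |(formMul p).1| ≤ 2 * L ^ 2 ∧ |(formMul p).2.1| ≤ 4 * L ^ 2 ∧ |(formMul p).2.2| ≤ 2 * L ^ 2 := by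
  simp only [weylIndex, Finset.mem_product, Finset.mem_Icc, ← abs_le] at hp
  obtain ⟨⟨h1, h2⟩, h3, h4⟩ := hp
  refine ⟨?_, ?_, ?_⟩
  · exact (abs_mul_le_of_abs_le h1 h3).trans (le_of_eq (by ring))
  · exact (abs_add_le _ _).trans ((add_le_add (abs_mul_le_of_abs_le h1 h4)
      (abs_mul_le_of_abs_le h2 h3)).trans (le_of_eq (by ring)))
  · exact (abs_mul_le_of_abs_le h2 h4).trans (le_of_eq (by ring))

/-- Applies `card_fiber_le_of_eval` at two points with coordinates in `{-1, 0, 1}`. The values there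
are at most `8L²`, so the divisor bound with exponent `ε/4` contributes `L^(ε/2)` twice. -/
theorem exists_card_fiber_le {ε : ℝ} (hε : 0 < ε) :
    ∃ C : ℝ, 1 ≤ C ∧ ∀ L : ℕ, L ≠ 0 → ∀ v : ℤ × ℤ × ℤ, v ≠ 0 →
      (((weylIndex L).filter (fun p => formMul p = v)).card : ℝ) ≤ C * (L : ℝ) ^ ε := by
  obtain ⟨C, hC, hdiv⟩ := exists_card_divisors_le (ε := ε / 4) (by positivity)
  refine ⟨4 * C ^ 2 * (8 : ℝ) ^ (ε / 2), ?_, fun L hL v hv => ?_⟩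
  · have : 1 ≤ (8 : ℝ) ^ (ε / 2) := Real.one_le_rpow (by norm_num) (by positivity)
    nlinarith [one_le_pow₀ hC (n := 2)]
  rcases Finset.eq_empty_or_nonempty ((weylIndex L).filter (fun p => formMul p = v)) with he | hne
  · rw [he]
    simp only [Finset.card_empty, Nat.cast_zero]
    positivity
  obtain ⟨p, hp⟩ := hne
  rw [Finset.mem_filter] at hp
  obtain ⟨b1, b2, b3⟩ := formMul_bound hp.1
  rw [hp.2] at b1 b2 b3
  have hcard : ∀ A : ℤ, A ≠ 0 → |A| ≤ 8 * L ^ 2 →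
      ((intDivs A).card : ℝ) ≤ 2 * (C * ((8 : ℝ) ^ (ε / 4) * (L : ℝ) ^ (ε / 2))) := by
    intro A hA hA8
    have h1 : ((intDivs A).card : ℝ) ≤ 2 * (A.natAbs.divisors.card : ℝ) := by
      exact_mod_cast card_intDivs_le A
    have h2 := hdiv A.natAbs (Int.natAbs_ne_zero.mpr hA)
    have h3 : (A.natAbs : ℝ) ≤ 8 * (L : ℝ) ^ 2 := by
      rw [Nat.cast_natAbs]
      exact_mod_cast hA8
    refine h1.trans ?_
    gcongr
    refine h2.trans ?_
    gcongr
    calc (A.natAbs : ℝ) ^ (ε / 4) ≤ (8 * (L : ℝ) ^ 2) ^ (ε / 4) := by gcongr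
      _ = _ := by
        rw [Real.mul_rpow (by norm_num) (by positivity), ← Real.rpow_natCast,
          ← Real.rpow_mul (by positivity)]
        congr 2
        push_cast
        ring
  have hL2 : (0 : ℤ) ≤ L ^ 2 := by positivity
  have main : ∀ x y x' y' : ℤ, |x| ≤ 1 → |y| ≤ 1 → |x'| ≤ 1 → |y'| ≤ 1 →
      x * y' - x' * y ≠ 0 → v.1 * x ^ 2 + v.2.1 * x * y + v.2.2 * y ^ 2 ≠ 0 →
      v.1 * x' ^ 2 + v.2.1 * x' * y' + v.2.2 * y' ^ 2 ≠ 0 →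
      (((weylIndex L).filter (fun p => formMul p = v)).card : ℝ) ≤
        4 * C ^ 2 * (8 : ℝ) ^ (ε / 2) * (L : ℝ) ^ ε := by
    intro x y x' y' hx hy hx' hy' hdet h1 h2
    have hbd : ∀ x y : ℤ, |x| ≤ 1 → |y| ≤ 1 →
        |v.1 * x ^ 2 + v.2.1 * x * y + v.2.2 * y ^ 2| ≤ 8 * L ^ 2 := by
      intro x y hx hy
      have c1 : |v.1 * x ^ 2| ≤ 2 * L ^ 2 * 1 :=
        abs_mul_le_of_abs_le b1 (by rw [abs_pow]; exact pow_le_one₀ (abs_nonneg _) hx)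
      have c2 : |v.2.1 * x * y| ≤ 4 * L ^ 2 * 1 * 1 :=
        abs_mul_le_of_abs_le (abs_mul_le_of_abs_le b2 hx) hy
      have c3 : |v.2.2 * y ^ 2| ≤ 2 * L ^ 2 * 1 :=
        abs_mul_le_of_abs_le b3 (by rw [abs_pow]; exact pow_le_one₀ (abs_nonneg _) hy)
      exact (abs_add_three _ _ _).trans (by linarith)
    have h3 := card_fiber_le_of_eval (weylIndex L) v x y x' y' hdet h1 h2
    calc _ ≤ ((intDivs _).card : ℝ) * ((intDivs _).card : ℝ) := by exact_mod_cast h3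
      _ ≤ 2 * (C * ((8 : ℝ) ^ (ε / 4) * (L : ℝ) ^ (ε / 2))) *
          (2 * (C * ((8 : ℝ) ^ (ε / 4) * (L : ℝ) ^ (ε / 2)))) := by
        gcongr
        · exact hcard _ h1 (hbd x y hx hy)
        · exact hcard _ h2 (hbd x' y' hx' hy')
      _ = 4 * C ^ 2 * ((8 : ℝ) ^ (ε / 4) * (8 : ℝ) ^ (ε / 4)) *
          ((L : ℝ) ^ (ε / 2) * (L : ℝ) ^ (ε / 2)) := by ring
      _ = _ := by
        rw [← Real.rpow_add (by norm_num), ← Real.rpow_add (by positivity)]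
        congr 2
        · congr 1; ring
        · ring
  obtain ⟨A, B, D⟩ := v
  simp only at main
  -- A nonzero binary quadratic form vanishes on at most two lines through the origin, so two of
  -- `(1,0)`, `(0,1)`, `(1,1)`, `(1,-1)` serve as evaluation points.
  by_cases hA : A = 0
  · by_cases hD : D = 0
    · have hB : B ≠ 0 := by
        rintro rfl
        exact hv (by simp [hA, hD])
      exact main 1 1 1 (-1) (by simp) (by simp) (by simp) (by simp) (by norm_num)
        (by simpa [hA, hD] using hB) (by simpa [hA, hD] using hB)
    · by_cases hB : B + D = 0
      · exact main 0 1 1 (-1) (by simp) (by simp) (by simp) (by simp) (by norm_num)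
          (by simpa using hD) (by ring_nf; omega)
      · exact main 0 1 1 1 (by simp) (by simp) (by simp) (by simp) (by norm_num)
          (by simpa using hD) (by ring_nf; omega)
  · by_cases hD : D = 0
    · by_cases hB : A + B = 0
      · exact main 1 0 1 (-1) (by simp) (by simp) (by simp) (by simp) (by norm_num)
          (by simpa using hA) (by ring_nf; omega)
      · exact main 1 0 1 1 (by simp) (by simp) (by simp) (by simp) (by norm_num)
          (by simpa using hA) (by ring_nf; omega)
    · exact main 1 0 0 1 (by simp) (by simp) (by simp) (by simp) (by norm_num)
          (by simpa using hA) (by simpa using hD)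

theorem card_formMul_eq_zero_le {L : ℕ} (hL : L ≠ 0) :
    ((weylIndex L).filter (fun p => formMul p = 0)).card ≤ 34 * L ^ 2 := by
  have h1 : (2 * (L : ℤ) + 1 - (-(2 * L : ℤ))).toNat = 4 * L + 1 := by omega
  have h2 : ((L : ℤ) + 1 - (-(L : ℤ))).toNat = 2 * L + 1 := by omega
  have h3 : 4 * L + 1 ≤ 5 * L := by omega
  have h4 : 2 * L + 1 ≤ 3 * L := by omega
  have hsub : (weylIndex L).filter (fun p => formMul p = 0) ⊆
      (Finset.Icc (-(2 * L : ℤ)) (2 * L) ×ˢ Finset.Icc (-(2 * L : ℤ)) (2 * L)) ×ˢ {0} ∪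
      {0} ×ˢ (Finset.Icc (-L : ℤ) L ×ˢ Finset.Icc (-L : ℤ) L) := by
    intro p hp
    rw [Finset.mem_filter, formMul_eq_zero_iff, weylIndex, Finset.mem_product] at hp
    rw [Finset.mem_union, Finset.mem_product (s := _ ×ˢ _), Finset.mem_product (t := _ ×ˢ _),
      Finset.mem_singleton, Finset.mem_singleton]
    tauto
  refine (Finset.card_le_card hsub).trans ((Finset.card_union_le _ _).trans ?_)
  simp only [Finset.card_product, Int.card_Icc, h1, h2, Finset.card_singleton]
  calc _ ≤ (5 * L) * (5 * L) * 1 + 1 * ((3 * L) * (3 * L)) := by gcongr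
    _ = _ := by ring

/-- The zero frequency has `O(L²)` representations, hence contributes `O(L⁴)` pairs. Each of the
`O(L⁴)` remaining indices has `O(L^ε)` partners. -/
theorem exists_card_formMul_eq_le {ε : ℝ} (hε : 0 < ε) :
    ∃ C : ℝ, 1 ≤ C ∧ ∀ L : ℕ, L ≠ 0 →
      (((weylIndex L ×ˢ weylIndex L).filter (fun q => formMul q.1 = formMul q.2)).card : ℝ) ≤
        C * (L : ℝ) ^ (4 + ε) := by
  obtain ⟨C, hC, hfib⟩ := exists_card_fiber_le hε
  refine ⟨34 ^ 2 + 225 * C, by linarith, fun L hL => ?_⟩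
  have hL1 : (1 : ℝ) ≤ L := by exact_mod_cast Nat.one_le_iff_ne_zero.mpr hL
  have hLε : 1 ≤ (L : ℝ) ^ ε := Real.one_le_rpow hL1 hε.le
  have e1 : (((weylIndex L ×ˢ weylIndex L).filter (fun q => formMul q.1 = formMul q.2)).card : ℝ) =
      ∑ p ∈ weylIndex L, (((weylIndex L).filter (fun p' => formMul p' = formMul p)).card : ℝ) := by
    rw [Finset.card_filter, Finset.sum_product, Nat.cast_sum]
    refine Finset.sum_congr rfl fun p _ => ?_
    rw [Finset.card_filter]
    congr 1
    refine Finset.sum_congr rfl fun p' _ => ?_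
    simp only [eq_comm]
  rw [e1, ← Finset.sum_filter_add_sum_filter_not _ (fun p => formMul p = 0)]
  have hz : ((((weylIndex L).filter (fun p => formMul p = 0)).card : ℕ) : ℝ) ≤ 34 * (L : ℝ) ^ 2 := by
    exact_mod_cast card_formMul_eq_zero_le hL
  have s1 : ∑ p ∈ (weylIndex L).filter (fun p => formMul p = 0),
      (((weylIndex L).filter (fun p' => formMul p' = formMul p)).card : ℝ) ≤
      34 ^ 2 * (L : ℝ) ^ 4 := by
    calc _ = ∑ p ∈ (weylIndex L).filter (fun p => formMul p = 0),
          (((weylIndex L).filter (fun p' => formMul p' = 0)).card : ℝ) := by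
          refine Finset.sum_congr rfl fun p hp => ?_
          rw [(Finset.mem_filter.mp hp).2]
      _ ≤ (34 * (L : ℝ) ^ 2) * (34 * (L : ℝ) ^ 2) := by
        rw [Finset.sum_const, nsmul_eq_mul]
        gcongr
      _ = _ := by ring
  have s2 : ∑ p ∈ (weylIndex L).filter (fun p => ¬ formMul p = 0),
      (((weylIndex L).filter (fun p' => formMul p' = formMul p)).card : ℝ) ≤
      225 * (L : ℝ) ^ 4 * (C * (L : ℝ) ^ ε) := by
    have hc : (((weylIndex L).filter (fun p => ¬ formMul p = 0)).card : ℝ) ≤ 225 * (L : ℝ) ^ 4 := by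
      exact_mod_cast (Finset.card_filter_le _ _).trans (card_weylIndex_le hL)
    calc _ ≤ ∑ p ∈ (weylIndex L).filter (fun p => ¬ formMul p = 0), C * (L : ℝ) ^ ε :=
          Finset.sum_le_sum fun p hp => hfib L hL _ (Finset.mem_filter.mp hp).2
      _ ≤ _ := by
        rw [Finset.sum_const, nsmul_eq_mul]
        gcongr
  have e2 : (L : ℝ) ^ (4 + ε) = (L : ℝ) ^ 4 * (L : ℝ) ^ ε := by
    rw [Real.rpow_add (by linarith)]
    norm_cast
  rw [e2]
  have : 34 ^ 2 * (L : ℝ) ^ 4 ≤ 34 ^ 2 * (L : ℝ) ^ 4 * (L : ℝ) ^ ε :=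
    le_mul_of_one_le_right (by positivity) hLε
  calc _ ≤ 34 ^ 2 * (L : ℝ) ^ 4 * (L : ℝ) ^ ε + 225 * (L : ℝ) ^ 4 * (C * (L : ℝ) ^ ε) := by linarith
    _ = _ := by ring

/-! ### Fourier expansion of the Weyl sum -/

/-- The Fourier coefficients of `gridKernel L`. -/
noncomputable def gridCoeff (L : ℕ) (k : ℤ) : ℝ :=
  ∑ j ∈ (Finset.range L ×ˢ Finset.range L).filter (fun j => (j.1 : ℤ) - j.2 = k),
    geomRatio L ^ (j.1 + j.2) / L

theorem gridCoeff_nonneg (L : ℕ) (k : ℤ) : 0 ≤ gridCoeff L k :=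
  Finset.sum_nonneg fun _ _ => div_nonneg (pow_nonneg (geomRatio_pos L).le _) (Nat.cast_nonneg _)

/-- A given difference `k` arises from at most `L` pairs, each of weight at most `1/L`. -/
theorem gridCoeff_le_one (L : ℕ) (k : ℤ) : gridCoeff L k ≤ 1 := by
  have hcard : ((Finset.range L ×ˢ Finset.range L).filter
      (fun j => (j.1 : ℤ) - j.2 = k)).card ≤ L := by
    conv_rhs => rw [← Finset.card_range L]
    refine Finset.card_le_card_of_injOn Prod.fst ?_ ?_
    · intro j hj
      rw [Finset.mem_coe, Finset.mem_filter, Finset.mem_product] at hj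
      exact hj.1.1
    · intro j hj j' hj' he
      rw [Finset.mem_coe, Finset.mem_filter] at hj hj'
      exact Prod.ext he (by omega)
  rcases Nat.eq_zero_or_pos L with rfl | hL
  · simp [gridCoeff]
  have hL0 : (0 : ℝ) < L := by exact_mod_cast hL
  calc gridCoeff L k ≤ ∑ j ∈ (Finset.range L ×ˢ Finset.range L).filter
        (fun j => (j.1 : ℤ) - j.2 = k), 1 / (L : ℝ) := by
        refine Finset.sum_le_sum fun j _ => ?_
        gcongr
        exact pow_le_one₀ (geomRatio_pos L).le (geomRatio_le_one L)
    _ ≤ L * (1 / (L : ℝ)) := by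
      rw [Finset.sum_const, nsmul_eq_mul]
      gcongr
    _ = 1 := mul_one_div_cancel hL0.ne'

theorem gridKernel_eq_sum (L : ℕ) (x : ℝ) :
    (gridKernel L x : ℂ) = ∑ k ∈ Finset.Icc (-L : ℤ) L, (gridCoeff L k : ℂ) * expi (k * x) := by
  have h1 : (gridKernel L x : ℂ) = ∑ j ∈ Finset.range L ×ˢ Finset.range L,
      ((geomRatio L ^ (j.1 + j.2) / L : ℝ) : ℂ) * expi (((j.1 : ℤ) - j.2 : ℤ) * x) := by
    rw [gridKernel, Complex.ofReal_div, ← Complex.normSq_eq_norm_sq, ← Complex.mul_conj, map_sum,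
      Finset.sum_mul_sum, ← Finset.sum_product', Finset.sum_div]
    refine Finset.sum_congr rfl fun j _ => ?_
    rw [map_mul, ← expi_neg, map_pow, Complex.conj_ofReal]
    have : expi (((j.1 : ℤ) - j.2 : ℤ) * x) = expi (j.1 * x) * expi (-(j.2 * x)) := by
      rw [← expi_add]
      congr 1
      push_cast
      ring
    rw [this]
    push_cast
    ring
  rw [h1, ← Finset.sum_fiberwise_of_maps_to (t := Finset.Icc (-L : ℤ) L)
    (g := fun j : ℕ × ℕ => (j.1 : ℤ) - j.2)]
  · refine Finset.sum_congr rfl fun k _ => ?_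
    rw [gridCoeff, Complex.ofReal_sum, Finset.sum_mul]
    refine Finset.sum_congr rfl fun j hj => ?_
    rw [(Finset.mem_filter.mp hj).2]
  · intro j hj
    rw [Finset.mem_product, Finset.mem_range, Finset.mem_range] at hj
    rw [Finset.mem_Icc]
    omega

/-- The pairing of an integer frequency with the coordinates of a symmetric matrix. -/
def freq (v : ℤ × ℤ × ℤ) (θ : ℝ × ℝ × ℝ) : ℝ := v.1 * θ.1 + v.2.1 * θ.2.1 + v.2.2 * θ.2.2

/-- The Fourier coefficients of `weylSum L`, before collecting equal frequencies. -/
noncomputable def weylCoeff (L : ℕ) (p : (ℤ × ℤ) × (ℤ × ℤ)) : ℝ :=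
  gridCoeff L p.2.1 * gridCoeff L p.2.2

theorem weylCoeff_nonneg (L : ℕ) (p : (ℤ × ℤ) × (ℤ × ℤ)) : 0 ≤ weylCoeff L p :=
  mul_nonneg (gridCoeff_nonneg _ _) (gridCoeff_nonneg _ _)

theorem weylCoeff_le_one (L : ℕ) (p : (ℤ × ℤ) × (ℤ × ℤ)) : weylCoeff L p ≤ 1 :=
  mul_le_one₀ (gridCoeff_le_one _ _) (gridCoeff_nonneg _ _) (gridCoeff_le_one _ _)

theorem weylSum_eq_sum (L : ℕ) (θ : ℝ × ℝ × ℝ) :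
    (weylSum L θ : ℂ) = ∑ p ∈ weylIndex L, (weylCoeff L p : ℂ) * expi (2 * freq (formMul p) θ) := by
  rw [weylSum, weylIndex, Complex.ofReal_sum]
  conv_rhs => rw [Finset.sum_product]
  refine Finset.sum_congr rfl fun h _ => ?_
  rw [Complex.ofReal_mul, gridKernel_eq_sum, gridKernel_eq_sum, Finset.sum_mul_sum,
    ← Finset.sum_product']
  refine Finset.sum_congr rfl fun k _ => ?_
  have : expi (2 * freq (formMul (h, k)) θ) =
      expi (k.1 * (2 * (h.1 * θ.1 + h.2 * θ.2.1))) *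
        expi (k.2 * (2 * (h.1 * θ.2.1 + h.2 * θ.2.2))) := by
    rw [← expi_add]
    congr 1
    simp only [freq, formMul]
    push_cast
    ring
  rw [this, weylCoeff]
  push_cast
  ring

theorem weylSum_sq_eq_sum (L : ℕ) (θ : ℝ × ℝ × ℝ) :
    ((weylSum L θ ^ 2 : ℝ) : ℂ) = ∑ q ∈ weylIndex L ×ˢ weylIndex L,
      ((weylCoeff L q.1 * weylCoeff L q.2 : ℝ) : ℂ) *
        expi (2 * freq (formMul q.1 - formMul q.2) θ) := by
  have hreal : (weylSum L θ : ℂ) = (starRingEnd ℂ) (weylSum L θ : ℂ) :=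
    (Complex.conj_ofReal _).symm
  rw [Complex.ofReal_pow, sq]
  nth_rw 2 [hreal]
  rw [weylSum_eq_sum, map_sum, Finset.sum_mul_sum, ← Finset.sum_product']
  refine Finset.sum_congr rfl fun q _ => ?_
  rw [map_mul, Complex.conj_ofReal, ← expi_neg]
  have : expi (2 * freq (formMul q.1 - formMul q.2) θ) =
      expi (2 * freq (formMul q.1) θ) * expi (-(2 * freq (formMul q.2) θ)) := by
    rw [← expi_add]
    congr 1
    simp only [freq, Prod.fst_sub, Prod.snd_sub]
    push_cast
    ring
  rw [this]
  push_cast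
  ring

/-! ### Second moments of the Weyl sum -/

theorem freq_smul (v : ℤ × ℤ × ℤ) (t : ℝ) (a : ℝ × ℝ × ℝ) : freq v (t • a) = t * freq v a := by
  simp only [freq, Prod.smul_fst, Prod.smul_snd, smul_eq_mul]
  ring

@[fun_prop]
theorem continuous_freq (v : ℤ × ℤ × ℤ) : Continuous (freq v) := by
  unfold freq
  fun_prop

theorem integral_expi_mul {c : ℝ} (hc : c ≠ 0) (x y : ℝ) :
    ∫ s in x..y, expi (c * s) = (expi (c * y) - expi (c * x)) / (2 * Real.pi * Complex.I * c) := by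
  have hc' : (2 * Real.pi * Complex.I * c : ℂ) ≠ 0 := by
    simp [hc, Real.pi_ne_zero, Complex.I_ne_zero]
  have := integral_exp_mul_complex (a := x) (b := y) hc'
  simp only [expi]
  convert this using 3
  · push_cast; ring_nf
  · congr 1; push_cast; ring
  · congr 1; push_cast; ring

theorem norm_integral_expi_le {ξ : ℝ} (hξ : ξ ≠ 0) (x y : ℝ) :
    ‖∫ t in x..y, expi (2 * (t * ξ))‖ ≤ 1 / |ξ| := by
  have h1 : ∀ t : ℝ, 2 * (t * ξ) = (2 * ξ) * t := fun t => by ring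
  simp_rw [h1]
  rw [integral_expi_mul (by simpa using hξ), norm_div]
  have h2 : ‖expi (2 * ξ * y) - expi (2 * ξ * x)‖ ≤ 2 := by
    refine (norm_sub_le _ _).trans ?_
    rw [norm_expi, norm_expi]
    norm_num
  have h3 : ‖(2 * Real.pi * Complex.I * ((2 * ξ : ℝ) : ℂ) : ℂ)‖ = 4 * Real.pi * |ξ| := by
    simp only [norm_mul, Complex.norm_real, Complex.norm_I, Real.norm_eq_abs]
    rw [abs_of_pos Real.pi_pos]
    norm_num
    ring
  rw [h3]
  have hpos : 0 < |ξ| := abs_pos.mpr hξ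
  rw [div_le_div_iff₀ (by positivity) hpos]
  nlinarith [Real.pi_gt_three]

/-- When `tR` is an integer, `[-R, R]` is a whole number of periods of every nonzero mode, so
orthogonality is exact. -/
theorem integral_expi_period {t R : ℝ} (ht : 0 < t) {m : ℤ} (hR : t * R = m) (hR0 : 0 ≤ R) (k : ℤ) :
    ∫ x in Set.Icc (-R) R, expi (2 * t * k * x) = if k = 0 then ((2 * R : ℝ) : ℂ) else 0 := by
  rw [integral_Icc_eq_integral_Ioc, ← intervalIntegral.integral_of_le (by linarith)]
  split_ifs with hk
  · subst hk
    simp [expi_zero]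
    ring
  · have hk' : (2 * t * k : ℝ) ≠ 0 := by
      have : (k : ℝ) ≠ 0 := by exact_mod_cast hk
      positivity
    rw [integral_expi_mul hk']
    have e1 : 2 * t * k * R = ((2 * k * m : ℤ) : ℝ) := by
      push_cast
      rw [← hR]
      ring
    have e2 : 2 * t * k * (-R) = ((-(2 * k * m) : ℤ) : ℝ) := by
      push_cast
      rw [← hR]
      ring
    rw [e1, e2, expi_intCast, expi_intCast, sub_self, zero_div]

/-- The cube `[-R, R]³`. -/
def cube (R : ℝ) : Set (ℝ × ℝ × ℝ) := Set.Icc (-R) R ×ˢ (Set.Icc (-R) R ×ˢ Set.Icc (-R) R)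

theorem measurableSet_cube (R : ℝ) : MeasurableSet (cube R) :=
  measurableSet_Icc.prod (measurableSet_Icc.prod measurableSet_Icc)

theorem isCompact_cube (R : ℝ) : IsCompact (cube R) :=
  isCompact_Icc.prod (isCompact_Icc.prod isCompact_Icc)

theorem integral_cube_expi_freq {t R : ℝ} (ht : 0 < t) {m : ℤ} (hR : t * R = m) (hR0 : 0 ≤ R)
    (v : ℤ × ℤ × ℤ) :
    ∫ a in cube R, expi (2 * freq v (t • a)) = if v = 0 then (((2 * R) ^ 3 : ℝ) : ℂ) else 0 := by
  have e : ∀ a : ℝ × ℝ × ℝ, expi (2 * freq v (t • a)) =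
      expi (2 * t * v.1 * a.1) * (expi (2 * t * v.2.1 * a.2.1) * expi (2 * t * v.2.2 * a.2.2)) := by
    intro a
    rw [← expi_add, ← expi_add, freq_smul, freq]
    congr 1
    ring
  simp_rw [e]
  rw [cube, Measure.volume_eq_prod, ← Measure.prod_restrict,
    integral_prod_mul (fun x => expi (2 * t * v.1 * x))
      (fun y : ℝ × ℝ => expi (2 * t * v.2.1 * y.1) * expi (2 * t * v.2.2 * y.2)),
    Measure.volume_eq_prod, ← Measure.prod_restrict,
    integral_prod_mul (fun x => expi (2 * t * v.2.1 * x)) (fun x => expi (2 * t * v.2.2 * x)),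
    integral_expi_period ht hR hR0, integral_expi_period ht hR hR0, integral_expi_period ht hR hR0]
  obtain ⟨v1, v2, v3⟩ := v
  simp only [Prod.mk_eq_zero]
  split_ifs <;> first | tauto | (push_cast; ring)

/-- The number of pairs of indices with equal frequency. -/
noncomputable def diagCount (L : ℕ) : ℕ :=
  ((weylIndex L ×ˢ weylIndex L).filter (fun q => formMul q.1 = formMul q.2)).card

theorem sum_weylCoeff_diag_le (L : ℕ) :
    ∑ q ∈ (weylIndex L ×ˢ weylIndex L).filter (fun q => formMul q.1 = formMul q.2),
      weylCoeff L q.1 * weylCoeff L q.2 ≤ diagCount L := by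
  calc _ ≤ ∑ q ∈ (weylIndex L ×ˢ weylIndex L).filter (fun q => formMul q.1 = formMul q.2),
        (1 : ℝ) := Finset.sum_le_sum fun q _ =>
          mul_le_one₀ (weylCoeff_le_one _ _) (weylCoeff_nonneg _ _) (weylCoeff_le_one _ _)
    _ = _ := by rw [Finset.sum_const, nsmul_one, diagCount]

theorem continuous_weylSum_smul_sq (L : ℕ) (t : ℝ) :
    Continuous fun a : ℝ × ℝ × ℝ => weylSum L (t • a) ^ 2 := by
  fun_prop

/-- Parseval in the matrix variable at fixed `t`: only pairs of indices with equal frequency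
survive. -/
theorem integral_cube_weylSum_sq_le (L : ℕ) {t : ℝ} (ht : 1 ≤ t) :
    ∫ a in cube 2, weylSum L (t • a) ^ 2 ≤ 216 * diagCount L := by
  have ht0 : 0 < t := by linarith
  -- The least `R ≥ 2` with `tR` an integer. As `t ≥ 1`, it is at most 3, whence the volume factor
  -- `6³ = 216`.
  set R : ℝ := ⌈2 * t⌉ / t with hRdef
  have hR : t * R = ⌈2 * t⌉ := by
    rw [hRdef]
    field_simp
  have hR2 : 2 ≤ R := by
    rw [hRdef, le_div_iff₀ ht0]
    exact Int.le_ceil _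
  have hR3 : R ≤ 3 := by
    rw [hRdef, div_le_iff₀ ht0]
    linarith [Int.ceil_lt_add_one (2 * t)]
  have hsub : cube 2 ⊆ cube R := by
    have : Set.Icc (-2 : ℝ) 2 ⊆ Set.Icc (-R) R := Set.Icc_subset_Icc (by linarith) hR2
    exact Set.prod_mono this (Set.prod_mono this this)
  have hint : IntegrableOn (fun a : ℝ × ℝ × ℝ => weylSum L (t • a) ^ 2) (cube R) :=
    (continuous_weylSum_smul_sq L t).continuousOn.integrableOn_compact (isCompact_cube R)
  refine (setIntegral_mono_set hint (ae_of_all _ fun a => sq_nonneg _)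
    (LE.le.eventuallyLE hsub)).trans ?_
  have e : ((∫ a in cube R, weylSum L (t • a) ^ 2 : ℝ) : ℂ) =
      (((2 * R) ^ 3 * ∑ q ∈ (weylIndex L ×ˢ weylIndex L).filter
        (fun q => formMul q.1 = formMul q.2), weylCoeff L q.1 * weylCoeff L q.2 : ℝ) : ℂ) := by
    rw [← integral_complex_ofReal]
    have : ∀ a : ℝ × ℝ × ℝ, ((weylSum L (t • a) ^ 2 : ℝ) : ℂ) = _ :=
      fun a => weylSum_sq_eq_sum L (t • a)
    calc _ = ∫ a in cube R, ∑ q ∈ weylIndex L ×ˢ weylIndex L,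
          ((weylCoeff L q.1 * weylCoeff L q.2 : ℝ) : ℂ) *
          expi (2 * freq (formMul q.1 - formMul q.2) (t • a)) :=
          integral_congr_ae (ae_of_all _ this)
      _ = ∑ q ∈ weylIndex L ×ˢ weylIndex L, ((weylCoeff L q.1 * weylCoeff L q.2 : ℝ) : ℂ) *
          (if formMul q.1 = formMul q.2 then (((2 * R) ^ 3 : ℝ) : ℂ) else 0) := by
        rw [integral_finsetSum]
        · refine Finset.sum_congr rfl fun q _ => ?_
          rw [integral_const_mul, integral_cube_expi_freq ht0 hR (by linarith)]
          simp only [sub_eq_zero]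
        · intro q _
          refine ContinuousOn.integrableOn_compact (isCompact_cube R) (Continuous.continuousOn ?_)
          fun_prop
      _ = _ := by
        simp_rw [mul_ite, mul_zero]
        rw [← Finset.sum_filter, ← Finset.sum_mul]
        push_cast
        ring
  rw [Complex.ofReal_inj] at e
  rw [e]
  have h1 := sum_weylCoeff_diag_le L
  have h0 : 0 ≤ ∑ q ∈ (weylIndex L ×ˢ weylIndex L).filter
      (fun q => formMul q.1 = formMul q.2), weylCoeff L q.1 * weylCoeff L q.2 :=
    Finset.sum_nonneg fun q _ => mul_nonneg (weylCoeff_nonneg _ _) (weylCoeff_nonneg _ _)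
  have h2 : (2 * R) ^ 3 ≤ 6 ^ 3 := by gcongr; linarith
  calc _ ≤ 6 ^ 3 * (diagCount L : ℝ) := by gcongr
    _ = _ := by norm_num

theorem lintegral_cube_weylSum_sq_le (L : ℕ) {t : ℝ} (ht : 1 ≤ t) :
    ∫⁻ a in cube 2, ENNReal.ofReal (weylSum L (t • a) ^ 2) ≤
      ENNReal.ofReal (216 * diagCount L) := by
  rw [← ofReal_integral_eq_lintegral_ofReal]
  · exact ENNReal.ofReal_le_ofReal (integral_cube_weylSum_sq_le L ht)
  · exact (continuous_weylSum_smul_sq L t).continuousOn.integrableOn_compact (isCompact_cube 2)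
  · exact ae_of_all _ fun a => sq_nonneg _

/-- Integration in `t` for one fixed matrix: coinciding frequencies contribute `T` each, and
separated ones oscillate and contribute at most `1/κ`. -/
theorem integral_weylSum_sq_le_of_lower (L : ℕ) (a : ℝ × ℝ × ℝ) {κ : ℝ} (hκ : 0 < κ)
    (hfreq : ∀ q ∈ weylIndex L ×ˢ weylIndex L, formMul q.1 ≠ formMul q.2 →
      κ ≤ |freq (formMul q.1 - formMul q.2) a|) {T : ℝ} (hT : 1 ≤ T) :
    ∫ t in (1 : ℝ)..T, weylSum L (t • a) ^ 2 ≤ diagCount L * T + (weylIndex L).card ^ 2 * (1 / κ) := by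
  have e : ((∫ t in (1 : ℝ)..T, weylSum L (t • a) ^ 2 : ℝ) : ℂ) =
      ∑ q ∈ weylIndex L ×ˢ weylIndex L, ((weylCoeff L q.1 * weylCoeff L q.2 : ℝ) : ℂ) *
        ∫ t in (1 : ℝ)..T, expi (2 * (t * freq (formMul q.1 - formMul q.2) a)) := by
    rw [← intervalIntegral.integral_ofReal]
    simp_rw [weylSum_sq_eq_sum, freq_smul]
    rw [intervalIntegral.integral_finsetSum]
    · simp_rw [intervalIntegral.integral_const_mul]
    · intro q _
      apply Continuous.intervalIntegrable
      fun_prop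
  have h0 : 0 ≤ ∫ t in (1 : ℝ)..T, weylSum L (t • a) ^ 2 :=
    intervalIntegral.integral_nonneg hT fun t _ => sq_nonneg _
  calc ∫ t in (1 : ℝ)..T, weylSum L (t • a) ^ 2
      = ‖((∫ t in (1 : ℝ)..T, weylSum L (t • a) ^ 2 : ℝ) : ℂ)‖ := by
        rw [Complex.norm_real, Real.norm_eq_abs, abs_of_nonneg h0]
    _ ≤ ∑ q ∈ weylIndex L ×ˢ weylIndex L, ((if formMul q.1 = formMul q.2 then T else 0) + 1 / κ) := by
      rw [e]
      refine (norm_sum_le _ _).trans (Finset.sum_le_sum fun q hq => ?_)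
      have hw : ‖((weylCoeff L q.1 * weylCoeff L q.2 : ℝ) : ℂ)‖ ≤ 1 := by
        rw [Complex.norm_real, Real.norm_eq_abs,
          abs_of_nonneg (mul_nonneg (weylCoeff_nonneg _ _) (weylCoeff_nonneg _ _))]
        exact mul_le_one₀ (weylCoeff_le_one _ _) (weylCoeff_nonneg _ _) (weylCoeff_le_one _ _)
      rw [norm_mul]
      refine (mul_le_of_le_one_left (norm_nonneg _) hw).trans ?_
      split_ifs with hqq
      · rw [hqq, sub_self]
        have h1 : 0 ≤ 1 / κ := by positivity
        have h2 := intervalIntegral.norm_integral_le_of_norm_le_const (a := 1) (b := T) (C := 1)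
          (f := fun t => expi (2 * (t * freq 0 a))) (fun t _ => (norm_expi _).le)
        rw [abs_of_nonneg (by linarith)] at h2
        linarith
      · have h1 := hfreq q hq hqq
        rw [zero_add]
        refine (norm_integral_expi_le (abs_pos.mp (hκ.trans_le h1)) 1 T).trans ?_
        exact one_div_le_one_div_of_le hκ h1
    _ = _ := by
      rw [Finset.sum_add_distrib, ← Finset.sum_filter, Finset.sum_const, Finset.sum_const,
        Finset.card_product, nsmul_eq_mul, nsmul_eq_mul, diagCount]
      push_cast
      ring

/-- The second moment over matrices becomes an almost sure bound because a function with finite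
integral is finite almost everywhere. Summing over dyadic scales makes one constant serve all `j`
and `T`; the weight `t^(-1-δ)` makes the `t`-integral converge, at the price of `T^δ`. -/
theorem ae_exists_integral_weylSum_sq_le {ε δ : ℝ} (hε : 0 < ε) (hδ : 0 < δ) :
    ∀ᵐ a : ℝ × ℝ × ℝ ∂volume.restrict (cube 2), ∃ C : ℝ, 0 < C ∧ ∀ (j : ℕ) (T : ℝ), 1 ≤ T →
      ∫ t in (1 : ℝ)..T, weylSum (2 ^ j) (t • a) ^ 2 ≤
        C * ((2 : ℝ) ^ j) ^ (4 + ε) * T ^ (1 + δ) := by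
  obtain ⟨C, hC, hcount⟩ := exists_card_formMul_eq_le (ε := ε / 2) (by positivity)
  -- The scale weight `(2^j)^(-(4+ε))` beats the diagonal count, taken with `ε/2`, by a geometric
  -- factor `2^(-jε/2)`.
  set G : ℕ → ℝ × ℝ × ℝ → ENNReal := fun j a => ENNReal.ofReal (((2 : ℝ) ^ j) ^ (-(4 + ε))) *
    ∫⁻ t in Set.Ioi (1 : ℝ), ENNReal.ofReal (t ^ (-1 - δ)) * ENNReal.ofReal (weylSum (2 ^ j) (t • a) ^ 2)
    with hG
  have hmeas2 : ∀ j, Measurable fun p : (ℝ × ℝ × ℝ) × ℝ =>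
      ENNReal.ofReal (p.2 ^ (-1 - δ)) * ENNReal.ofReal (weylSum (2 ^ j) (p.2 • p.1) ^ 2) := by
    intro j
    have h1 : Measurable fun p : (ℝ × ℝ × ℝ) × ℝ => p.2 ^ (-1 - δ) :=
      measurable_snd.pow_const _
    have h2 : Continuous fun p : (ℝ × ℝ × ℝ) × ℝ => weylSum (2 ^ j) (p.2 • p.1) ^ 2 := by fun_prop
    exact h1.ennreal_ofReal.mul h2.measurable.ennreal_ofReal
  have hGm : ∀ j, Measurable (G j) := fun j =>
    ((hmeas2 j).lintegral_prod_right' (ν := volume.restrict (Set.Ioi (1 : ℝ)))).const_mul _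
  have hIfin : ∫⁻ t in Set.Ioi (1 : ℝ), ENNReal.ofReal (t ^ (-1 - δ)) < ⊤ := by
    have := integrableOn_Ioi_rpow_of_lt (a := -1 - δ) (by linarith) (zero_lt_one (α := ℝ))
    rw [← ofReal_integral_eq_lintegral_ofReal this]
    · exact ENNReal.ofReal_lt_top
    · refine (ae_restrict_iff' measurableSet_Ioi).mpr (ae_of_all _ fun t ht => ?_)
      exact Real.rpow_nonneg (zero_le_one.trans (le_of_lt ht)) _
  set I := ∫⁻ t in Set.Ioi (1 : ℝ), ENNReal.ofReal (t ^ (-1 - δ)) with hI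
  have hGint : ∀ j, ∫⁻ a in cube 2, G j a ≤
      I * ENNReal.ofReal (216 * C * ((2 : ℝ) ^ (-(ε / 2))) ^ j) := by
    intro j
    have h2j : (0 : ℝ) < 2 ^ j := by positivity
    have e1 : ∫⁻ a in cube 2, G j a = ENNReal.ofReal (((2 : ℝ) ^ j) ^ (-(4 + ε))) *
        ∫⁻ t in Set.Ioi (1 : ℝ), ∫⁻ a in cube 2, ENNReal.ofReal (t ^ (-1 - δ)) *
          ENNReal.ofReal (weylSum (2 ^ j) (t • a) ^ 2) := by
      rw [hG]
      simp only
      rw [lintegral_const_mul _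
        ((hmeas2 j).lintegral_prod_right' (ν := volume.restrict (Set.Ioi (1 : ℝ)))),
        lintegral_lintegral_swap (hmeas2 j).aemeasurable]
    have e2 : ∫⁻ t in Set.Ioi (1 : ℝ), ∫⁻ a in cube 2, ENNReal.ofReal (t ^ (-1 - δ)) *
          ENNReal.ofReal (weylSum (2 ^ j) (t • a) ^ 2) ≤
        I * ENNReal.ofReal (216 * diagCount (2 ^ j)) := by
      rw [hI, ← lintegral_mul_const' _ _ ENNReal.ofReal_ne_top]
      refine setLIntegral_mono' measurableSet_Ioi fun t ht => ?_
      rw [lintegral_const_mul' _ _ ENNReal.ofReal_ne_top]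
      gcongr
      exact lintegral_cube_weylSum_sq_le _ (le_of_lt ht)
    rw [e1]
    calc _ ≤ ENNReal.ofReal (((2 : ℝ) ^ j) ^ (-(4 + ε))) *
          (I * ENNReal.ofReal (216 * diagCount (2 ^ j))) := by gcongr
      _ = I * ENNReal.ofReal (((2 : ℝ) ^ j) ^ (-(4 + ε)) * (216 * diagCount (2 ^ j))) := by
        rw [ENNReal.ofReal_mul (p := ((2 : ℝ) ^ j) ^ (-(4 + ε))) (by positivity)]
        ring
      _ ≤ _ := by
        refine mul_le_mul' le_rfl (ENNReal.ofReal_le_ofReal ?_)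
        have hc := hcount (2 ^ j) (by positivity)
        rw [← diagCount] at hc
        push_cast at hc
        calc ((2 : ℝ) ^ j) ^ (-(4 + ε)) * (216 * (diagCount (2 ^ j) : ℝ)) ≤
              ((2 : ℝ) ^ j) ^ (-(4 + ε)) * (216 * (C * ((2 : ℝ) ^ j) ^ (4 + ε / 2))) := by gcongr
          _ = 216 * C * (((2 : ℝ) ^ j) ^ (-(4 + ε)) * ((2 : ℝ) ^ j) ^ (4 + ε / 2)) := by ring
          _ = _ := by
            rw [← Real.rpow_add h2j, ← Real.rpow_natCast, ← Real.rpow_mul (by norm_num),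
              ← Real.rpow_natCast, ← Real.rpow_mul (by norm_num)]
            congr 2
            ring
  have hZ : ∫⁻ a in cube 2, ∑' j, G j a < ⊤ := by
    rw [lintegral_tsum fun j => (hGm j).aemeasurable]
    have hr0 : 0 ≤ (2 : ℝ) ^ (-(ε / 2)) := by positivity
    have hr1 : (2 : ℝ) ^ (-(ε / 2)) < 1 :=
      Real.rpow_lt_one_of_one_lt_of_neg (by norm_num) (by linarith)
    calc _ ≤ ∑' j, I * ENNReal.ofReal (216 * C * ((2 : ℝ) ^ (-(ε / 2))) ^ j) :=
          ENNReal.tsum_le_tsum hGint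
      _ = I * ENNReal.ofReal (∑' j, 216 * C * ((2 : ℝ) ^ (-(ε / 2))) ^ j) := by
        rw [ENNReal.tsum_mul_left, ENNReal.ofReal_tsum_of_nonneg]
        · intro j; positivity
        · exact (summable_geometric_of_lt_one hr0 hr1).mul_left _
      _ < ⊤ := ENNReal.mul_lt_top hIfin ENNReal.ofReal_lt_top
  filter_upwards [ae_lt_top (Measurable.tsum hGm) hZ.ne] with a ha
  refine ⟨(∑' j, G j a).toReal + 1, by positivity, fun j T hT => ?_⟩
  have h2j : (0 : ℝ) < 2 ^ j := by positivity
  have hT0 : 0 < T := by linarith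
  set Z := ∑' j, G j a with hZdef
  have hGj : G j a ≤ Z := ENNReal.le_tsum j
  have hcont : Continuous fun t : ℝ => weylSum (2 ^ j) (t • a) ^ 2 := by fun_prop
  have hI0 : 0 ≤ ∫ t in (1 : ℝ)..T, weylSum (2 ^ j) (t • a) ^ 2 :=
    intervalIntegral.integral_nonneg hT fun t _ => sq_nonneg _
  have hpt : ENNReal.ofReal (((2 : ℝ) ^ j) ^ (-(4 + ε)) * (T ^ (-1 - δ) *
      ∫ t in (1 : ℝ)..T, weylSum (2 ^ j) (t • a) ^ 2)) ≤ Z := by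
    refine le_trans ?_ hGj
    rw [ENNReal.ofReal_mul (by positivity), ENNReal.ofReal_mul (by positivity)]
    simp only [hG]
    gcongr
    rw [intervalIntegral.integral_of_le hT, ofReal_integral_eq_lintegral_ofReal
      (hcont.integrableOn_Ioc) (ae_of_all _ fun t => sq_nonneg _),
      ← lintegral_const_mul' _ _ ENNReal.ofReal_ne_top]
    -- On `(1, T]` the weight `t^(-1-δ)` is at least `T^(-1-δ)`, so the weighted integral controls
    -- the truncated one.
    refine (setLIntegral_mono' measurableSet_Ioc fun t ht => ?_).trans
      (lintegral_mono_set Set.Ioc_subset_Ioi_self)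
    gcongr ENNReal.ofReal ?_ * _
    exact Real.rpow_le_rpow_of_nonpos (by linarith [ht.1]) ht.2 (by linarith)
  have hreal := ENNReal.toReal_mono ha.ne hpt
  rw [ENNReal.toReal_ofReal (by positivity)] at hreal
  have e3 : ((2 : ℝ) ^ j) ^ (4 + ε) * ((2 : ℝ) ^ j) ^ (-(4 + ε)) = 1 := by
    rw [← Real.rpow_add h2j, add_neg_cancel, Real.rpow_zero]
  have e4 : T ^ (1 + δ) * T ^ (-1 - δ) = 1 := by
    rw [← Real.rpow_add hT0]
    ring_nf
    exact Real.rpow_zero T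
  calc _ = (((2 : ℝ) ^ j) ^ (4 + ε) * ((2 : ℝ) ^ j) ^ (-(4 + ε))) * (T ^ (1 + δ) * T ^ (-1 - δ)) *
        ∫ t in (1 : ℝ)..T, weylSum (2 ^ j) (t • a) ^ 2 := by rw [e3, e4]; ring
    _ = ((2 : ℝ) ^ j) ^ (4 + ε) * T ^ (1 + δ) * (((2 : ℝ) ^ j) ^ (-(4 + ε)) * (T ^ (-1 - δ) *
      ∫ t in (1 : ℝ)..T, weylSum (2 ^ j) (t • a) ^ 2)) := by ring
    _ ≤ ((2 : ℝ) ^ j) ^ (4 + ε) * T ^ (1 + δ) * (Z.toReal + 1) := by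
      gcongr
      linarith
    _ = _ := by ring

/-! ### Diophantine properties of almost every matrix -/

theorem prod_measure_le_left {X Y : Type*} [MeasurableSpace X] [MeasurableSpace Y] (μ : Measure X)
    (ν : Measure Y) [SFinite μ] [SFinite ν] {S : Set (X × Y)} (hS : MeasurableSet S) {B : Set Y}
    (hB : MeasurableSet B) (hSB : ∀ z ∈ S, z.2 ∈ B) {κ : ENNReal}
    (h : ∀ y ∈ B, μ {x | (x, y) ∈ S} ≤ κ) : (μ.prod ν) S ≤ κ * ν B := by
  rw [Measure.prod_apply_symm hS, ← lintegral_indicator_const hB]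
  refine lintegral_mono fun y => ?_
  by_cases hy : y ∈ B
  · rw [Set.indicator_of_mem hy]
    exact h y hy
  · have : (fun x => (x, y)) ⁻¹' S = ∅ := by
      ext x
      simp only [Set.mem_preimage, Set.mem_empty_iff_false, iff_false]
      exact fun hx => hy (hSB _ hx)
    rw [this, measure_empty]
    exact zero_le

theorem prod_measure_le_right {X Y : Type*} [MeasurableSpace X] [MeasurableSpace Y] (μ : Measure X)
    (ν : Measure Y) [SFinite μ] [SFinite ν] {S : Set (X × Y)} (hS : MeasurableSet S) {A : Set X}
    (hA : MeasurableSet A) (hSA : ∀ z ∈ S, z.1 ∈ A) {κ : ENNReal}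
    (h : ∀ x ∈ A, ν {y | (x, y) ∈ S} ≤ κ) : (μ.prod ν) S ≤ κ * μ A := by
  rw [Measure.prod_apply hS, ← lintegral_indicator_const hA]
  refine lintegral_mono fun x => ?_
  by_cases hx : x ∈ A
  · rw [Set.indicator_of_mem hx]
    exact h x hx
  · have : Prod.mk x ⁻¹' S = ∅ := by
      ext y
      simp only [Set.mem_preimage, Set.mem_empty_iff_false, iff_false]
      exact fun hy => hx (hSA _ hy)
    rw [this, measure_empty]
    exact zero_le

theorem volume_abs_affine_lt_le {p : ℝ} (hp : p ≠ 0) (s δ : ℝ) :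
    volume {x : ℝ | |p * x + s| < δ} ≤ ENNReal.ofReal (2 * (δ / |p|)) := by
  rw [← Real.volume_ball (-s / p)]
  refine measure_mono fun x hx => ?_
  rw [Set.mem_ofPred_eq] at hx
  rw [Metric.mem_ball, Real.dist_eq, lt_div_iff₀ (abs_pos.mpr hp), ← abs_mul]
  have e : (x - -s / p) * p = p * x + s := by
    rw [sub_mul, div_mul_cancel₀ _ hp]
    ring
  rwa [e]

theorem volume_Icc_two : volume (Set.Icc (-2 : ℝ) 2) = ENNReal.ofReal 4 := by
  rw [Real.volume_Icc]
  norm_num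

theorem volume_square_abs_affine_lt_le {p q : ℝ} (s : ℝ) {δ m : ℝ} (hδ : 0 ≤ δ) (hm : 0 < m)
    (h : m ≤ |p| ∨ m ≤ |q|) :
    volume {y : ℝ × ℝ | y ∈ Set.Icc (-2 : ℝ) 2 ×ˢ Set.Icc (-2 : ℝ) 2 ∧ |p * y.1 + q * y.2 + s| < δ} ≤
      ENNReal.ofReal (8 * (δ / m)) := by
  have hmeas : MeasurableSet {y : ℝ × ℝ | y ∈ Set.Icc (-2 : ℝ) 2 ×ˢ Set.Icc (-2 : ℝ) 2 ∧
      |p * y.1 + q * y.2 + s| < δ} := by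
    have h1 : MeasurableSet {y : ℝ × ℝ | |p * y.1 + q * y.2 + s| < δ} :=
      measurableSet_lt (by fun_prop) measurable_const
    exact (measurableSet_Icc.prod measurableSet_Icc).inter h1
  have e : ENNReal.ofReal (8 * (δ / m)) = ENNReal.ofReal (2 * (δ / m)) * ENNReal.ofReal 4 := by
    rw [← ENNReal.ofReal_mul (by positivity)]
    congr 1
    ring
  rw [e, ← volume_Icc_two, Measure.volume_eq_prod]
  rcases h with h | h
  · refine prod_measure_le_left volume volume hmeas measurableSet_Icc (fun z hz => hz.1.2) ?_
    intro y _
    refine (measure_mono fun x hx => ?_).trans ((volume_abs_affine_lt_le (p := p)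
      (abs_pos.mp (hm.trans_le h)) (q * y + s) δ).trans (ENNReal.ofReal_le_ofReal (by gcongr)))
    have := hx.2
    rwa [add_assoc] at this
  · refine prod_measure_le_right volume volume hmeas measurableSet_Icc (fun z hz => hz.1.1) ?_
    intro x _
    refine (measure_mono fun y hy => ?_).trans ((volume_abs_affine_lt_le (p := q)
      (abs_pos.mp (hm.trans_le h)) (p * x + s) δ).trans (ENNReal.ofReal_le_ofReal (by gcongr)))
    have := hy.2
    rw [Set.mem_ofPred_eq]
    convert this using 2
    ring

theorem measurableSet_slab (v : ℤ × ℤ × ℤ) (δ : ℝ) :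
    MeasurableSet {a : ℝ × ℝ × ℝ | a ∈ cube 2 ∧ |freq v a| < δ} := by
  have h1 : MeasurableSet {a : ℝ × ℝ × ℝ | |freq v a| < δ} :=
    measurableSet_lt (by fun_prop) measurable_const
  exact (measurableSet_cube 2).inter h1

/-- Fix the other two coordinates and solve for one whose coefficient is largest: it ranges over an
interval of length `2δ/‖v‖`, and the other two fill a square of area 16. -/
theorem volume_slab_le {v : ℤ × ℤ × ℤ} (hv : v ≠ 0) {δ : ℝ} (hδ : 0 ≤ δ) :
    volume {a : ℝ × ℝ × ℝ | a ∈ cube 2 ∧ |freq v a| < δ} ≤ ENNReal.ofReal (32 * (δ / ‖v‖)) := by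
  have hv0 : 0 < ‖v‖ := norm_pos_iff.mpr hv
  have hmeas := measurableSet_slab v δ
  have hor : ‖v‖ ≤ |(v.1 : ℝ)| ∨ (‖v‖ ≤ |(v.2.1 : ℝ)| ∨ ‖v‖ ≤ |(v.2.2 : ℝ)|) := by
    rw [Prod.norm_def, Prod.norm_def]
    simp only [Int.norm_eq_abs]
    rcases max_choice |(v.1 : ℝ)| (max |(v.2.1 : ℝ)| |(v.2.2 : ℝ)|) with h | h
    · exact Or.inl h.le
    · rcases max_choice |(v.2.1 : ℝ)| |(v.2.2 : ℝ)| with h' | h'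
      · exact Or.inr (Or.inl (by rw [h, h']))
      · exact Or.inr (Or.inr (by rw [h, h']))
  rw [Measure.volume_eq_prod]
  rcases hor with h | h
  · have e : ENNReal.ofReal (32 * (δ / ‖v‖)) = ENNReal.ofReal (2 * (δ / ‖v‖)) *
        (volume : Measure (ℝ × ℝ)) (Set.Icc (-2 : ℝ) 2 ×ˢ Set.Icc (-2 : ℝ) 2) := by
      rw [Measure.volume_eq_prod, Measure.prod_prod, volume_Icc_two, ← ENNReal.ofReal_mul (by norm_num),
        ← ENNReal.ofReal_mul (by positivity)]
      congr 1
      ring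
    rw [e]
    refine prod_measure_le_left volume volume hmeas (measurableSet_Icc.prod measurableSet_Icc)
      (fun z hz => hz.1.2) ?_
    intro y _
    refine (measure_mono fun x hx => ?_).trans ((volume_abs_affine_lt_le (p := (v.1 : ℝ))
      (abs_pos.mp (hv0.trans_le h)) (v.2.1 * y.1 + v.2.2 * y.2) δ).trans
        (ENNReal.ofReal_le_ofReal (by gcongr)))
    have := hx.2
    rwa [freq, add_assoc] at this
  · have e : ENNReal.ofReal (32 * (δ / ‖v‖)) = ENNReal.ofReal (8 * (δ / ‖v‖)) * ENNReal.ofReal 4 := by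
      rw [← ENNReal.ofReal_mul (by positivity)]
      congr 1
      ring
    rw [e, ← volume_Icc_two]
    refine prod_measure_le_right volume volume hmeas measurableSet_Icc (fun z hz => hz.1.1) ?_
    intro x _
    refine (measure_mono fun y hy => ?_).trans
      (volume_square_abs_affine_lt_le (v.1 * x) hδ hv0 h)
    refine ⟨hy.1.2, ?_⟩
    have := hy.2
    rw [freq] at this
    convert this using 2
    ring

/-- Used with `m` the measure of the matrices for which no constant `c` works: they fail for each
given `c`, on a set of measure `O(c)`. -/
theorem eq_zero_of_forall_le_ofReal {m : ENNReal} {K : ℝ}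
    (h : ∀ c : ℝ, 0 < c → c ≤ 1 → m ≤ ENNReal.ofReal (K * c)) : m = 0 := by
  have ht : Filter.Tendsto (fun c : ℝ => ENNReal.ofReal (K * c)) (nhdsWithin 0 (Set.Ioi 0))
      (nhds 0) := by
    have : Filter.Tendsto (fun c : ℝ => ENNReal.ofReal (K * c)) (nhds 0)
        (nhds (ENNReal.ofReal (K * 0))) :=
      (ENNReal.continuous_ofReal.comp (continuous_const.mul continuous_id)).tendsto 0
    rw [mul_zero, ENNReal.ofReal_zero] at this
    exact this.mono_left nhdsWithin_le_nhds
  refine le_antisymm (ge_of_tendsto ht ?_) zero_le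
  filter_upwards [Ioc_mem_nhdsGT (zero_lt_one (α := ℝ))] with c hc
  exact h c hc.1 hc.2

/-- A summable weight on `ℤ`. -/
noncomputable def intWeight (η : ℝ) (k : ℤ) : ℝ := max 1 |(k : ℝ)| ^ (-(1 + η))

theorem intWeight_pos (η : ℝ) (k : ℤ) : 0 < intWeight η k :=
  Real.rpow_pos_of_pos (lt_max_of_lt_left one_pos) _

theorem summable_intWeight {η : ℝ} (hη : 0 < η) : Summable (intWeight η) := by
  have h1 := Real.summable_abs_int_rpow (b := 1 + η) (by linarith)
  rw [← summable_congr_cofinite (f := fun k : ℤ => |(k : ℝ)| ^ (-(1 + η)))]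
  · exact h1
  · have : ({0} : Set ℤ)ᶜ ∈ Filter.cofinite := (Set.finite_singleton 0).compl_mem_cofinite
    filter_upwards [this] with k hk
    have hk0 : k ≠ 0 := hk
    have : (1 : ℝ) ≤ |(k : ℝ)| := by exact_mod_cast Int.one_le_abs hk0
    rw [intWeight, max_eq_right this]

theorem abs_fst_le_norm (v : ℤ × ℤ × ℤ) : |(v.1 : ℝ)| ≤ ‖v‖ ∧ |(v.2.1 : ℝ)| ≤ ‖v‖ ∧
    |(v.2.2 : ℝ)| ≤ ‖v‖ := by
  refine ⟨?_, ?_, ?_⟩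
  · rw [← Int.norm_eq_abs]; exact norm_fst_le v
  · rw [← Int.norm_eq_abs]; exact (norm_fst_le v.2).trans (norm_snd_le v)
  · rw [← Int.norm_eq_abs]; exact (norm_snd_le v.2).trans (norm_snd_le v)

theorem one_le_norm_of_ne_zero {v : ℤ × ℤ × ℤ} (hv : v ≠ 0) : 1 ≤ ‖v‖ := by
  obtain ⟨h1, h2, h3⟩ := abs_fst_le_norm v
  have : v.1 ≠ 0 ∨ v.2.1 ≠ 0 ∨ v.2.2 ≠ 0 := by
    by_contra! h
    exact hv (Prod.ext h.1 (Prod.ext h.2.1 h.2.2))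
  rcases this with h | h | h
  · exact le_trans (by exact_mod_cast Int.one_le_abs h) h1
  · exact le_trans (by exact_mod_cast Int.one_le_abs h) h2
  · exact le_trans (by exact_mod_cast Int.one_le_abs h) h3

/-- The Diophantine condition on linear forms satisfied by almost every matrix. -/
def IsDiophantine (η : ℝ) (a : ℝ × ℝ × ℝ) : Prop :=
  ∃ c : ℝ, 0 < c ∧ ∀ v : ℤ × ℤ × ℤ, v ≠ 0 → c ≤ |freq v a| * ‖v‖ ^ (2 + η)

/-- A union bound over slabs. A slab of half-width `c ‖v‖ w v` has volume at most `32 c w v`, which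
is summable, and `w v ≥ ‖v‖^(-(3+η))` turns the half-width into the exponent `2 + η`. -/
theorem ae_isDiophantine {η : ℝ} (hη : 0 < η) :
    ∀ᵐ a : ℝ × ℝ × ℝ, a ∈ cube 2 → IsDiophantine η a := by
  set w : ℤ × ℤ × ℤ → ℝ := fun v =>
    intWeight (η / 3) v.1 * (intWeight (η / 3) v.2.1 * intWeight (η / 3) v.2.2) with hw
  have hw0 : ∀ v, 0 < w v := fun v =>
    mul_pos (intWeight_pos _ _) (mul_pos (intWeight_pos _ _) (intWeight_pos _ _))
  have hs := summable_intWeight (η := η / 3) (by positivity)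
  have hws : Summable w :=
    hs.mul_of_nonneg (hs.mul_of_nonneg hs (fun k => (intWeight_pos _ k).le)
      (fun k => (intWeight_pos _ k).le)) (fun k => (intWeight_pos _ k).le)
      (fun k => (mul_pos (intWeight_pos _ _) (intWeight_pos _ _)).le)
  rw [ae_iff]
  refine eq_zero_of_forall_le_ofReal (K := ∑' v, 32 * w v) fun c hc _ => ?_
  have hsub : {a : ℝ × ℝ × ℝ | ¬ (a ∈ cube 2 → IsDiophantine η a)} ⊆
      ⋃ v : ℤ × ℤ × ℤ, (if v = 0 then ∅ else {a | a ∈ cube 2 ∧ |freq v a| < c * ‖v‖ * w v}) := by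
    intro a ha
    simp only [Set.mem_ofPred_eq, Classical.not_imp, IsDiophantine, not_exists, not_and,
      not_forall, not_le] at ha
    obtain ⟨v, hv, hlt⟩ := ha.2 c hc
    refine Set.mem_iUnion.mpr ⟨v, ?_⟩
    rw [if_neg hv]
    refine ⟨ha.1, ?_⟩
    have hv1 := one_le_norm_of_ne_zero hv
    have hv0 : 0 < ‖v‖ := by linarith
    obtain ⟨h1, h2, h3⟩ := abs_fst_le_norm v
    have hle : ‖v‖ ^ (-(3 + η)) ≤ w v := by
      have key : ∀ k : ℤ, |(k : ℝ)| ≤ ‖v‖ → ‖v‖ ^ (-(1 + η / 3)) ≤ intWeight (η / 3) k :=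
        fun k hk => Real.rpow_le_rpow_of_nonpos (lt_max_of_lt_left one_pos) (max_le hv1 hk)
          (by linarith)
      calc ‖v‖ ^ (-(3 + η)) = ‖v‖ ^ (-(1 + η / 3)) * (‖v‖ ^ (-(1 + η / 3)) * ‖v‖ ^ (-(1 + η / 3))) := by
            rw [← Real.rpow_add hv0, ← Real.rpow_add hv0]
            congr 1
            ring
        _ ≤ w v := mul_le_mul (key _ h1) (mul_le_mul (key _ h2) (key _ h3) (by positivity)
            (intWeight_pos _ _).le) (by positivity) (intWeight_pos _ _).le
    have e : ‖v‖ * ‖v‖ ^ (-(3 + η)) * ‖v‖ ^ (2 + η) = 1 := by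
      rw [← Real.rpow_one_add' hv0.le (by linarith), ← Real.rpow_add hv0]
      ring_nf
      exact Real.rpow_zero _
    have hp : 0 < ‖v‖ ^ (2 + η) := by positivity
    rw [← mul_lt_mul_iff_left₀ hp]
    calc _ < c := hlt
      _ = c * ‖v‖ * ‖v‖ ^ (-(3 + η)) * ‖v‖ ^ (2 + η) := by
        rw [mul_assoc, mul_assoc, ← mul_assoc ‖v‖, e, mul_one]
      _ ≤ _ := by gcongr
  refine (measure_mono hsub).trans ((measure_iUnion_le _).trans ?_)
  rw [← tsum_mul_right, ENNReal.ofReal_tsum_of_nonneg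
    (fun v => by have := hw0 v; positivity) ((hws.mul_left 32).mul_right c)]
  refine ENNReal.tsum_le_tsum fun v => ?_
  split_ifs with hv
  · rw [measure_empty]; exact zero_le
  · have hv0 : 0 < ‖v‖ := norm_pos_iff.mpr hv
    refine (volume_slab_le hv (by have := hw0 v; positivity)).trans
      (ENNReal.ofReal_le_ofReal (le_of_eq ?_))
    field_simp

/-- The condition of simultaneous Diophantine approximation satisfied by almost every matrix. -/
def IsSimDiophantine (η : ℝ) (a : ℝ × ℝ × ℝ) : Prop :=
  ∃ c : ℝ, 0 < c ∧ ∀ p q s : ℤ, 1 ≤ p →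
    c ≤ max |p * a.2.1 - q * a.1| |p * a.2.2 - s * a.1| * (p : ℝ) ^ (1 / 2 + η)

theorem volume_tube_le {p : ℤ} (hp : 1 ≤ p) (q s : ℤ) {δ : ℝ} (hδ : 0 ≤ δ) :
    volume {a : ℝ × ℝ × ℝ | a.1 ∈ Set.Icc (-2 : ℝ) 2 ∧ |p * a.2.1 - q * a.1| < δ ∧
      |p * a.2.2 - s * a.1| < δ} ≤ ENNReal.ofReal (16 * (δ / p) ^ 2) := by
  have hp0 : (0 : ℝ) < p := by exact_mod_cast hp
  have hmeas : MeasurableSet {a : ℝ × ℝ × ℝ | a.1 ∈ Set.Icc (-2 : ℝ) 2 ∧ |p * a.2.1 - q * a.1| < δ ∧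
      |p * a.2.2 - s * a.1| < δ} := by
    have h1 : MeasurableSet {a : ℝ × ℝ × ℝ | |p * a.2.1 - q * a.1| < δ} :=
      measurableSet_lt (by fun_prop) measurable_const
    have h2 : MeasurableSet {a : ℝ × ℝ × ℝ | |p * a.2.2 - s * a.1| < δ} :=
      measurableSet_lt (by fun_prop) measurable_const
    exact (measurable_fst measurableSet_Icc).inter (h1.inter h2)
  have e : ENNReal.ofReal (16 * (δ / p) ^ 2) =
      ENNReal.ofReal (2 * (δ / p)) * ENNReal.ofReal (2 * (δ / p)) * ENNReal.ofReal 4 := by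
    rw [← ENNReal.ofReal_mul (by positivity), ← ENNReal.ofReal_mul (by positivity)]
    congr 1
    ring
  rw [e, ← volume_Icc_two, Measure.volume_eq_prod]
  refine prod_measure_le_right volume volume hmeas measurableSet_Icc (fun z hz => hz.1) ?_
  intro x _
  have h1 := fun r : ℝ => volume_abs_affine_lt_le hp0.ne' r δ
  rw [abs_of_pos hp0] at h1
  refine (measure_mono (t := {y : ℝ | |p * y + -(q * x)| < δ} ×ˢ {y : ℝ | |p * y + -(s * x)| < δ})
    fun y hy => ?_).trans ?_
  · refine ⟨?_, ?_⟩
    · have := hy.2.1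
      rwa [sub_eq_add_neg] at this
    · have := hy.2.2
      rwa [sub_eq_add_neg] at this
  · rw [Measure.volume_eq_prod, Measure.prod_prod]
    exact mul_le_mul' (h1 _) (h1 _)

/-- For each `p` there are `O(p²)` relevant pairs `(q, s)`, each excluding a tube of volume
`O((δ/p)²)`. With `δ = c p^(-(1/2+η))` the total over `p` converges. -/
theorem ae_isSimDiophantine {η : ℝ} (hη : 0 < η) :
    ∀ᵐ a : ℝ × ℝ × ℝ, a ∈ cube 2 → 1 ≤ a.1 → IsSimDiophantine η a := by
  set w : ℤ → ℝ := fun p => |(p : ℝ)| ^ (-(1 + 2 * η)) with hw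
  have hws : Summable w := Real.summable_abs_int_rpow (by linarith)
  have hw0 : ∀ p, 0 ≤ w p := fun p => Real.rpow_nonneg (abs_nonneg _) _
  rw [ae_iff]
  refine eq_zero_of_forall_le_ofReal (K := ∑' p, 784 * w p) fun c hc hc1 => ?_
  set δ : ℤ → ℝ := fun p => c * (p : ℝ) ^ (-(1 / 2 + η)) with hδ
  have hsub : {a : ℝ × ℝ × ℝ | ¬ (a ∈ cube 2 → 1 ≤ a.1 → IsSimDiophantine η a)} ⊆
      ⋃ p : ℤ, (if 1 ≤ p then ⋃ z ∈ Finset.Icc (-(3 * p)) (3 * p) ×ˢ Finset.Icc (-(3 * p)) (3 * p),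
        {a : ℝ × ℝ × ℝ | a.1 ∈ Set.Icc (-2 : ℝ) 2 ∧ |p * a.2.1 - z.1 * a.1| < δ p ∧
          |p * a.2.2 - z.2 * a.1| < δ p} else ∅) := by
    intro a ha
    simp only [Set.mem_ofPred_eq, Classical.not_imp, IsSimDiophantine, not_exists, not_and,
      not_forall, not_le] at ha
    obtain ⟨hcube, ha1, ha2⟩ := ha
    obtain ⟨p, q, s, hp, hlt⟩ := ha2 c hc
    have hp1 : (1 : ℝ) ≤ p := by exact_mod_cast hp
    have hp0 : (0 : ℝ) < p := by linarith
    have hlt2 : max |p * a.2.1 - q * a.1| |p * a.2.2 - s * a.1| < δ p := by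
      have hpp : 0 < (p : ℝ) ^ (1 / 2 + η) := by positivity
      rw [← mul_lt_mul_iff_left₀ hpp]
      refine hlt.trans_le (le_of_eq ?_)
      rw [hδ]
      simp only
      rw [mul_assoc, ← Real.rpow_add hp0, neg_add_cancel, Real.rpow_zero, mul_one]
    have hδ1 : δ p ≤ 1 := by
      have : (p : ℝ) ^ (-(1 / 2 + η)) ≤ 1 := Real.rpow_le_one_of_one_le_of_nonpos hp1 (by linarith)
      calc δ p ≤ 1 * 1 := mul_le_mul hc1 this (by positivity) zero_le_one
        _ = 1 := one_mul 1
    -- Since `a.1 ≥ 1`, a numerator this close to `p x / a.1` is at most `3p` in absolute value,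
    -- which makes the union finite for each `p`.
    have hq : ∀ (x : ℝ) (q : ℤ), x ∈ Set.Icc (-2 : ℝ) 2 → |p * x - q * a.1| < δ p →
        q ∈ Finset.Icc (-(3 * p)) (3 * p) := by
      intro x q hx hlt
      rw [Finset.mem_Icc, ← abs_le]
      have h1 : |(q : ℝ)| ≤ 3 * p := by
        calc |(q : ℝ)| ≤ |(q : ℝ)| * a.1 := le_mul_of_one_le_right (abs_nonneg _) ha1
          _ = |q * a.1| := by rw [abs_mul, abs_of_pos (by linarith : 0 < a.1)]
          _ = |p * x - (p * x - q * a.1)| := by rw [sub_sub_cancel]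
          _ ≤ |p * x| + |p * x - q * a.1| := abs_sub _ _
          _ ≤ p * 2 + 1 := by
            rw [abs_mul, abs_of_pos hp0]
            gcongr
            · exact abs_le.mpr hx
            · linarith
          _ ≤ 3 * p := by linarith
      exact_mod_cast h1
    rw [max_lt_iff] at hlt2
    refine Set.mem_iUnion.mpr ⟨p, ?_⟩
    rw [if_pos hp]
    refine Set.mem_iUnion₂.mpr ⟨(q, s), ?_, hcube.1, hlt2⟩
    rw [Finset.mem_product]
    exact ⟨hq _ _ hcube.2.1 hlt2.1, hq _ _ hcube.2.2 hlt2.2⟩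
  refine (measure_mono hsub).trans ((measure_iUnion_le _).trans ?_)
  rw [← tsum_mul_right, ENNReal.ofReal_tsum_of_nonneg
    (fun v => by have := hw0 v; positivity) ((hws.mul_left 784).mul_right c)]
  refine ENNReal.tsum_le_tsum fun p => ?_
  split_ifs with hp
  · have hp1 : (1 : ℝ) ≤ p := by exact_mod_cast hp
    have hp0 : (0 : ℝ) < p := by linarith
    have hδ0 : 0 ≤ δ p := by positivity
    refine (measure_biUnion_finset_le _ _).trans ?_
    refine (Finset.sum_le_sum fun z _ => volume_tube_le hp z.1 z.2 hδ0).trans ?_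
    rw [Finset.sum_const, ← ENNReal.ofReal_nsmul]
    refine ENNReal.ofReal_le_ofReal ?_
    have hcard : ((Finset.Icc (-(3 * p)) (3 * p) ×ˢ Finset.Icc (-(3 * p)) (3 * p)).card : ℝ) ≤
        49 * (p : ℝ) ^ 2 := by
      have h1 : ((3 * p + 1 - (-(3 * p))).toNat : ℤ) = 6 * p + 1 := by omega
      have h2 : ((3 * p + 1 - (-(3 * p))).toNat : ℝ) = 6 * p + 1 := by exact_mod_cast h1
      rw [Finset.card_product, Int.card_Icc, Nat.cast_mul, h2]
      nlinarith
    have hδ2 : (δ p) ^ 2 = c ^ 2 * w p := by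
      rw [hδ, hw]
      simp only
      rw [mul_pow, abs_of_pos hp0, ← Real.rpow_natCast (_ ^ _), ← Real.rpow_mul hp0.le]
      congr 2
      push_cast
      ring
    rw [nsmul_eq_mul]
    calc _ ≤ 49 * (p : ℝ) ^ 2 * (16 * (δ p / p) ^ 2) := by gcongr
      _ = 784 * (δ p) ^ 2 := by field_simp; ring
      _ = 784 * w p * (c * c) := by rw [hδ2]; ring
      _ ≤ 784 * w p * (c * 1) := by
        have := hw0 p
        gcongr
      _ = _ := by ring
  · rw [measure_empty]; exact zero_le

/-! ### Lattice points near the graph of `2tα` -/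

theorem exists_ne_abs_sub_le {ι : Type*} {S : Finset ι} (hS : 2 ≤ S.card) (f : ι → ℝ) {W : ℝ}
    (hW : 0 < W) (hf : ∀ x ∈ S, |f x| ≤ W) :
    ∃ x ∈ S, ∃ y ∈ S, x ≠ y ∧ |f x - f y| ≤ 4 * W / (S.card - 1) := by
  set n := S.card with hn
  have hn1 : (0 : ℝ) < n - 1 := by
    have : (2 : ℝ) ≤ n := by exact_mod_cast hS
    linarith
  set G : ℝ := 4 * W / (n - 1) with hG
  have hG0 : 0 < G := by positivity
  -- Cells of length `4W/(n-1)` cover `[-W, W]` using at most `⌊(n-1)/2⌋ + 1` of them, fewer than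
  -- `n` because `n ≥ 2`.
  have hmaps : ∀ x ∈ S, ⌊(f x + W) / G⌋ ∈ Finset.Icc (0 : ℤ) ((n - 1 : ℕ) / 2 : ℕ) := by
    intro x hx
    have h1 := abs_le.mp (hf x hx)
    rw [Finset.mem_Icc]
    constructor
    · exact Int.floor_nonneg.mpr (div_nonneg (by linarith) hG0.le)
    · have h2 : (f x + W) / G ≤ ((n - 1 : ℕ) : ℝ) / 2 := by
        rw [div_le_iff₀ hG0, hG, Nat.cast_sub (by omega), Nat.cast_one]
        field_simp
        linarith
      have h3 : ((n - 1 : ℕ) : ℝ) < 2 * (((n - 1) / 2 : ℕ) : ℝ) + 2 := by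
        exact_mod_cast (by omega : n - 1 < 2 * ((n - 1) / 2) + 2)
      rw [Int.floor_le_iff, Int.cast_natCast]
      linarith
  have hcard : (Finset.Icc (0 : ℤ) ((n - 1 : ℕ) / 2 : ℕ)).card < S.card := by
    rw [Int.card_Icc]
    omega
  obtain ⟨x, hx, y, hy, hxy, he⟩ := Finset.exists_ne_map_eq_of_card_lt_of_maps_to hcard hmaps
  refine ⟨x, hx, y, hy, hxy, ?_⟩
  have h1 := Int.abs_sub_lt_one_of_floor_eq_floor he
  rw [← sub_div, abs_div, abs_of_pos hG0, div_lt_one hG0] at h1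
  have h2 : f x + W - (f y + W) = f x - f y := by ring
  rw [h2] at h1
  exact h1.le

/-- The error `2tαh - m` and the vector `h`, rescaled so that the lattice of all `(h, m)` is
unimodular. -/
noncomputable def latEmb (L t : ℝ) (a : ℝ × ℝ × ℝ) (x : (ℤ × ℤ) × (ℤ × ℤ)) : (ℝ × ℝ) × (ℝ × ℝ) :=
  ((x.1.1 / L, x.1.2 / L),
    (L * (2 * t * (x.1.1 * a.1 + x.1.2 * a.2.1) - x.2.1),
      L * (2 * t * (x.1.1 * a.2.1 + x.1.2 * a.2.2) - x.2.2)))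

theorem latEmb_sub (L t : ℝ) (a : ℝ × ℝ × ℝ) (x y : (ℤ × ℤ) × (ℤ × ℤ)) :
    latEmb L t a (x - y) = latEmb L t a x - latEmb L t a y := by
  simp only [latEmb, Prod.fst_sub, Prod.snd_sub, Prod.mk_sub_mk]
  push_cast
  refine Prod.ext (Prod.ext ?_ ?_) (Prod.ext ?_ ?_) <;> simp only <;> ring

/-- First coordinate of the error. -/
def latErr₁ (t : ℝ) (a : ℝ × ℝ × ℝ) (x : (ℤ × ℤ) × (ℤ × ℤ)) : ℝ :=
  2 * t * (x.1.1 * a.1 + x.1.2 * a.2.1) - x.2.1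

/-- Second coordinate of the error. -/
def latErr₂ (t : ℝ) (a : ℝ × ℝ × ℝ) (x : (ℤ × ℤ) × (ℤ × ℤ)) : ℝ :=
  2 * t * (x.1.1 * a.2.1 + x.1.2 * a.2.2) - x.2.2

theorem norm_latEmb_le_iff {L : ℝ} (hL : 0 < L) (t : ℝ) (a : ℝ × ℝ × ℝ) (x : (ℤ × ℤ) × (ℤ × ℤ))
    (ρ : ℝ) : ‖latEmb L t a x‖ ≤ ρ ↔ (|(x.1.1 : ℝ)| ≤ L * ρ ∧ |(x.1.2 : ℝ)| ≤ L * ρ) ∧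
      |latErr₁ t a x| ≤ ρ / L ∧ |latErr₂ t a x| ≤ ρ / L := by
  simp only [latEmb, Prod.norm_def, max_le_iff, Real.norm_eq_abs, abs_div, abs_mul, abs_of_pos hL,
    div_le_iff₀' hL, le_div_iff₀' hL, latErr₁, latErr₂]

theorem latEmb_bounds {L : ℝ} (hL : 0 < L) (t : ℝ) (a : ℝ × ℝ × ℝ) (x : (ℤ × ℤ) × (ℤ × ℤ)) :
    (|(x.1.1 : ℝ)| ≤ L * ‖latEmb L t a x‖ ∧ |(x.1.2 : ℝ)| ≤ L * ‖latEmb L t a x‖) ∧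
      |latErr₁ t a x| ≤ ‖latEmb L t a x‖ / L ∧ |latErr₂ t a x| ≤ ‖latEmb L t a x‖ / L :=
  (norm_latEmb_le_iff hL t a x _).mp le_rfl

theorem abs_mul_sub_mul_le {L ρ σ e f x y : ℝ} (hL : 0 < L) (he : |e| ≤ ρ / L) (hy : |y| ≤ L * σ)
    (hf : |f| ≤ σ / L) (hx : |x| ≤ L * ρ) : |e * y - f * x| ≤ 2 * (ρ * σ) := by
  have h0 : 0 ≤ ρ / L := (abs_nonneg _).trans he
  have h1 : 0 ≤ σ / L := (abs_nonneg _).trans hf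
  calc |e * y - f * x| ≤ |e * y| + |f * x| := abs_sub _ _
    _ ≤ ρ / L * (L * σ) + σ / L * (L * ρ) := by
      rw [abs_mul, abs_mul]
      gcongr
    _ = _ := by field_simp; ring

theorem fst_ne_zero_of_norm_latEmb_lt {L : ℝ} (hL : 1 ≤ L) {t : ℝ} {a : ℝ × ℝ × ℝ}
    {x : (ℤ × ℤ) × (ℤ × ℤ)} (hx : x ≠ 0) (hn : ‖latEmb L t a x‖ < 1) : x.1 ≠ 0 := by
  intro h
  have hL0 : 0 < L := by linarith
  obtain ⟨-, h1, h2⟩ := latEmb_bounds hL0 t a x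
  have hlt : ‖latEmb L t a x‖ / L < 1 := by
    rw [div_lt_one hL0]
    linarith
  simp only [latErr₁, latErr₂, h, Prod.fst_zero, Prod.snd_zero, Int.cast_zero, zero_mul, add_zero,
    mul_zero, zero_sub, abs_neg] at h1 h2
  have e1 : x.2.1 = 0 := Int.abs_lt_one_iff.mp (by exact_mod_cast h1.trans_lt hlt)
  have e2 : x.2.2 = 0 := Int.abs_lt_one_iff.mp (by exact_mod_cast h2.trans_lt hlt)
  exact hx (Prod.ext h (Prod.ext e1 e2))

theorem norm_latEmb_pos {L : ℝ} (hL : 0 < L) (t : ℝ) (a : ℝ × ℝ × ℝ)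
    {x : (ℤ × ℤ) × (ℤ × ℤ)} (hx : x.1 ≠ 0) : 0 < ‖latEmb L t a x‖ := by
  rw [norm_pos_iff]
  intro h
  have h1 := congrArg (fun z => z.1.1) h
  have h2 := congrArg (fun z => z.1.2) h
  simp only [latEmb, Prod.fst_zero, Prod.snd_zero, div_eq_zero_iff, hL.ne', or_false,
    Int.cast_eq_zero] at h1 h2
  exact hx (Prod.ext h1 h2)

/-- The determinant of the first components of two lattice vectors. -/
def latDet (g x : (ℤ × ℤ) × (ℤ × ℤ)) : ℤ := g.1.1 * x.1.2 - g.1.2 * x.1.1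

theorem latDet_sub (g x y : (ℤ × ℤ) × (ℤ × ℤ)) : latDet g (x - y) = latDet g x - latDet g y := by
  simp only [latDet, Prod.fst_sub, Prod.snd_sub]
  ring

/-- When the first components are parallel, the contribution of `2tα` drops out of the mixed minors
of `g` and `z`. These are then integers of size at most `2‖g‖‖z‖ < 1`, hence zero, so all four
coordinates are proportional. -/
theorem exists_latEmb_eq_smul {L : ℝ} (hL : 0 < L) {t : ℝ} {a : ℝ × ℝ × ℝ}
    {g z : (ℤ × ℤ) × (ℤ × ℤ)} (hg : g.1 ≠ 0) (hdet : latDet g z = 0)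
    (hn : ‖latEmb L t a g‖ * ‖latEmb L t a z‖ ≤ 1 / 4) :
    ∃ s : ℝ, latEmb L t a z = s • latEmb L t a g := by
  obtain ⟨⟨g1, g2⟩, g3, g4⟩ := latEmb_bounds hL t a g
  obtain ⟨⟨z1, z2⟩, z3, z4⟩ := latEmb_bounds hL t a z
  have hdetR : (g.1.1 : ℝ) * z.1.2 - g.1.2 * z.1.1 = 0 := by exact_mod_cast hdet
  have small : ∀ k : ℤ, |(k : ℝ)| ≤ 2 * (‖latEmb L t a g‖ * ‖latEmb L t a z‖) → (k : ℝ) = 0 := by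
    intro k hk
    have : |(k : ℝ)| < 1 := by linarith
    have : k = 0 := Int.abs_lt_one_iff.mp (by exact_mod_cast this)
    exact_mod_cast this
  have finish : ∀ s : ℝ, (z.1.1 : ℝ) = s * g.1.1 → (z.1.2 : ℝ) = s * g.1.2 →
      (z.2.1 : ℝ) = s * g.2.1 → (z.2.2 : ℝ) = s * g.2.2 →
      latEmb L t a z = s • latEmb L t a g := by
    intro s e1 e2 e3 e4
    simp only [latEmb, e1, e2, e3, e4, Prod.smul_mk, smul_eq_mul]
    refine Prod.ext (Prod.ext ?_ ?_) (Prod.ext ?_ ?_) <;> simp only <;> ring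
  by_cases h1 : g.1.1 = 0
  · have h2 : g.1.2 ≠ 0 := fun h2 => hg (Prod.ext h1 h2)
    have h2R : (g.1.2 : ℝ) ≠ 0 := by exact_mod_cast h2
    have k1 := small (g.2.1 * z.1.2 - z.2.1 * g.1.2) (by
      convert abs_mul_sub_mul_le hL g3 z2 z3 g2 using 1
      rw [← abs_neg]
      congr 1
      simp only [latErr₁]
      push_cast
      linear_combination (-2 * t * a.1) * hdetR)
    have k2 := small (g.2.2 * z.1.2 - z.2.2 * g.1.2) (by
      convert abs_mul_sub_mul_le hL g4 z2 z4 g2 using 1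
      rw [← abs_neg]
      congr 1
      simp only [latErr₂]
      push_cast
      linear_combination (-2 * t * a.2.1) * hdetR)
    push_cast at k1 k2
    refine ⟨z.1.2 / g.1.2, finish _ ?_ ?_ ?_ ?_⟩
    · field_simp; linarith
    · field_simp
    · field_simp; linarith
    · field_simp; linarith
  · have h1R : (g.1.1 : ℝ) ≠ 0 := by exact_mod_cast h1
    have k1 := small (g.2.1 * z.1.1 - z.2.1 * g.1.1) (by
      convert abs_mul_sub_mul_le hL g3 z1 z3 g1 using 1
      rw [← abs_neg]
      congr 1
      simp only [latErr₁]
      push_cast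
      linear_combination (2 * t * a.2.1) * hdetR)
    have k2 := small (g.2.2 * z.1.1 - z.2.2 * g.1.1) (by
      convert abs_mul_sub_mul_le hL g4 z1 z4 g1 using 1
      rw [← abs_neg]
      congr 1
      simp only [latErr₂]
      push_cast
      linear_combination (2 * t * a.2.2) * hdetR)
    push_cast at k1 k2
    refine ⟨z.1.1 / g.1.1, finish _ ?_ ?_ ?_ ?_⟩
    · field_simp
    · field_simp; linarith
    · field_simp; linarith
    · field_simp; linarith

/-- The integer `m·h' - m'·h` can be computed from the errors alone because `α` is symmetric. It has
absolute value below 1, so it vanishes. -/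
theorem latErr_isotropic {L : ℝ} (hL : 0 < L) {t : ℝ} {a : ℝ × ℝ × ℝ}
    {x y : (ℤ × ℤ) × (ℤ × ℤ)} (hn : ‖latEmb L t a x‖ * ‖latEmb L t a y‖ ≤ 1 / 8) :
    latErr₁ t a x * y.1.1 + latErr₂ t a x * y.1.2 =
      latErr₁ t a y * x.1.1 + latErr₂ t a y * x.1.2 := by
  obtain ⟨⟨x1, x2⟩, x3, x4⟩ := latEmb_bounds hL t a x
  obtain ⟨⟨y1, y2⟩, y3, y4⟩ := latEmb_bounds hL t a y
  have b1 := abs_mul_sub_mul_le hL x3 y1 y3 x1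
  have b2 := abs_mul_sub_mul_le hL x4 y2 y4 x2
  have e : ((y.2.1 * x.1.1 + y.2.2 * x.1.2 - x.2.1 * y.1.1 - x.2.2 * y.1.2 : ℤ) : ℝ) =
      (latErr₁ t a x * y.1.1 - latErr₁ t a y * x.1.1) +
        (latErr₂ t a x * y.1.2 - latErr₂ t a y * x.1.2) := by
    simp only [latErr₁, latErr₂]
    push_cast
    ring
  have hlt : |((y.2.1 * x.1.1 + y.2.2 * x.1.2 - x.2.1 * y.1.1 - x.2.2 * y.1.2 : ℤ) : ℝ)| < 1 := by
    rw [e]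
    refine (abs_add_le _ _).trans_lt ?_
    linarith
  have hz : y.2.1 * x.1.1 + y.2.2 * x.1.2 - x.2.1 * y.1.1 - x.2.2 * y.1.2 = 0 :=
    Int.abs_lt_one_iff.mp (by exact_mod_cast hlt)
  rw [hz, Int.cast_zero] at e
  linarith

/-- All points of `Φ` lie on one line parallel to `g`. Two of them must be close, and their
difference is the short vector. -/
theorem exists_short_vector {L : ℝ} (hL : 1 ≤ L) {t : ℝ} {a : ℝ × ℝ × ℝ}
    {g : (ℤ × ℤ) × (ℤ × ℤ)} (hg : g.1 ≠ 0) (hg2 : ‖latEmb L t a g‖ ≤ 1 / 2)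
    {Φ : Finset ((ℤ × ℤ) × (ℤ × ℤ))} (hΦ : ∀ x ∈ Φ, ‖latEmb L t a x‖ ≤ 1 / 4) (hcard : 1 ≤ Φ.card)
    (hdet : ∀ x ∈ Φ, ∀ y ∈ Φ, latDet g x = latDet g y) :
    ∃ z : (ℤ × ℤ) × (ℤ × ℤ), z.1 ≠ 0 ∧ latDet g z = 0 ∧ ‖latEmb L t a z‖ ≤ 1 / 2 ∧
      ‖latEmb L t a z‖ ≤ 4 / Φ.card := by
  have hL0 : 0 < L := by linarith
  -- A single point gives no difference, but `g` itself is then short enough, as `1/2 ≤ 4`.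
  by_cases h1 : Φ.card = 1
  · refine ⟨g, hg, ?_, hg2, ?_⟩
    · simp only [latDet]; ring
    · rw [h1]; norm_num; linarith
  have h2 : 2 ≤ Φ.card := by omega
  have hsub : ∀ x ∈ Φ, ∀ y ∈ Φ, ‖latEmb L t a (x - y)‖ ≤ 1 / 2 := by
    intro x hx y hy
    rw [latEmb_sub]
    refine (norm_sub_le _ _).trans ?_
    linarith [hΦ x hx, hΦ y hy]
  have hg0 : 0 < ‖latEmb L t a g‖ := norm_latEmb_pos hL0 t a hg
  obtain ⟨x0, hx0⟩ := Finset.card_pos.mp (by omega : 0 < Φ.card)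
  have hs : ∀ x ∈ Φ, ∃ s : ℝ, latEmb L t a (x - x0) = s • latEmb L t a g := by
    intro x hx
    refine exists_latEmb_eq_smul hL0 hg (by rw [latDet_sub, hdet x hx x0 hx0, sub_self]) ?_
    calc _ ≤ (1 / 2 : ℝ) * (1 / 2) := by
          gcongr
          exact hsub x hx x0 hx0
      _ = 1 / 4 := by norm_num
  choose! s hs using hs
  have hsb : ∀ x ∈ Φ, |s x| ≤ 1 / (2 * ‖latEmb L t a g‖) := by
    intro x hx
    have := hsub x hx x0 hx0
    rw [hs x hx, norm_smul, Real.norm_eq_abs] at this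
    rw [le_div_iff₀ (by positivity)]
    linarith
  obtain ⟨x, hx, y, hy, hxy, hle⟩ := exists_ne_abs_sub_le h2 s (by positivity) hsb
  have hxy0 : x - y ≠ 0 := sub_ne_zero.mpr hxy
  have hn1 : (0 : ℝ) < Φ.card - 1 := by
    have : (2 : ℝ) ≤ Φ.card := by exact_mod_cast h2
    linarith
  have hn2 : (2 : ℝ) ≤ Φ.card := by exact_mod_cast h2
  have hle2 := hsub x hx y hy
  refine ⟨x - y, fst_ne_zero_of_norm_latEmb_lt hL hxy0 (by linarith), ?_, hle2, ?_⟩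
  · rw [latDet_sub, hdet x hx y hy, sub_self]
  · have e : latEmb L t a (x - y) = (s x - s y) • latEmb L t a g := by
      rw [sub_smul, ← hs x hx, ← hs y hy, ← latEmb_sub]
      congr 1
      abel
    rw [e, norm_smul, Real.norm_eq_abs]
    calc _ ≤ 4 * (1 / (2 * ‖latEmb L t a g‖)) / (Φ.card - 1) * ‖latEmb L t a g‖ := by gcongr
      _ = 2 / (Φ.card - 1) := by field_simp; norm_num
      _ ≤ _ := by
        rw [div_le_div_iff₀ hn1 (by linarith)]
        linarith

/-- On `Γ` the error is a linear function of `h`, given by a symmetric matrix `B`, because of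
isotropy. So `2tα - B` sends `h` to `m`, and multiplying it by the determinant of `h`-parts gives an
integer matrix. A small difference of two such determinants is the denominator sought. -/
theorem exists_rational_approx {L : ℝ} (hL : 1 ≤ L) {t : ℝ} {a : ℝ × ℝ × ℝ}
    {z : (ℤ × ℤ) × (ℤ × ℤ)} (hz : z.1 ≠ 0) (hz2 : ‖latEmb L t a z‖ ≤ 1 / 2)
    {Γ : Finset ((ℤ × ℤ) × (ℤ × ℤ))} (hΓ : ∀ x ∈ Γ, ‖latEmb L t a x‖ ≤ 1 / 4)
    (hq : 2 ≤ (Γ.image (latDet z)).card) :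
    ∃ D p₁₁ p₁₂ p₂₂ : ℤ, 1 ≤ D ∧
      D ≤ 4 * ‖latEmb L t a z‖ / (Γ.image (latDet z)).card * L ^ 2 ∧
      |2 * t * D * a.1 - p₁₁| ≤ 4 * ‖latEmb L t a z‖ / (Γ.image (latDet z)).card ∧
      |2 * t * D * a.2.1 - p₁₂| ≤ 4 * ‖latEmb L t a z‖ / (Γ.image (latDet z)).card ∧
      |2 * t * D * a.2.2 - p₂₂| ≤ 4 * ‖latEmb L t a z‖ / (Γ.image (latDet z)).card := by
  have hL0 : 0 < L := by linarith
  set q := (Γ.image (latDet z)).card with hqdef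
  set lam := ‖latEmb L t a z‖ with hlam
  have hlam0 : 0 < lam := norm_latEmb_pos hL0 t a hz
  have hx0 : ∃ x ∈ Γ, latDet z x ≠ 0 := by
    by_contra! h
    have : (Γ.image (latDet z)).card ≤ ({0} : Finset ℤ).card := by
      refine Finset.card_le_card fun c hc => ?_
      obtain ⟨x, hx, rfl⟩ := Finset.mem_image.mp hc
      rw [Finset.mem_singleton]
      exact h x hx
    rw [Finset.card_singleton] at this
    omega
  obtain ⟨x, hx, hdx⟩ := hx0
  set d : ℝ := (latDet z x : ℝ) with hd
  have hd0 : d ≠ 0 := Int.cast_ne_zero.mpr hdx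
  have hdval : d = z.1.1 * x.1.2 - z.1.2 * x.1.1 := by
    rw [hd, latDet]; push_cast; ring
  have hiso : ∀ w ∈ Γ, ∀ w' ∈ Γ, latErr₁ t a w * w'.1.1 + latErr₂ t a w * w'.1.2 =
      latErr₁ t a w' * w.1.1 + latErr₂ t a w' * w.1.2 := by
    intro w hw w' hw'
    refine latErr_isotropic hL0 ?_
    calc _ ≤ (1 / 4 : ℝ) * (1 / 4) := by
          gcongr
          · exact hΓ w hw
          · exact hΓ w' hw'
      _ ≤ 1 / 8 := by norm_num
  have hisoz : ∀ w ∈ Γ, latErr₁ t a z * w.1.1 + latErr₂ t a z * w.1.2 =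
      latErr₁ t a w * z.1.1 + latErr₂ t a w * z.1.2 := by
    intro w hw
    refine latErr_isotropic hL0 ?_
    calc _ ≤ (1 / 2 : ℝ) * (1 / 4) := by
          gcongr
          exact hΓ w hw
      _ = 1 / 8 := by norm_num
  -- Cramer's rule on the basis `z`, `x`; isotropy makes the two formulas for the off-diagonal entry
  -- agree.
  set B₁ : ℝ := (latErr₁ t a z * x.1.2 - latErr₁ t a x * z.1.2) / d with hB₁
  set B₂ : ℝ := (latErr₁ t a x * z.1.1 - latErr₁ t a z * x.1.1) / d with hB₂
  set B₃ : ℝ := (latErr₂ t a x * z.1.1 - latErr₂ t a z * x.1.1) / d with hB₃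
  have hB₁' : B₁ * d = latErr₁ t a z * x.1.2 - latErr₁ t a x * z.1.2 := div_mul_cancel₀ _ hd0
  have hB₂' : B₂ * d = latErr₁ t a x * z.1.1 - latErr₁ t a z * x.1.1 := div_mul_cancel₀ _ hd0
  have hB₃' : B₃ * d = latErr₂ t a x * z.1.1 - latErr₂ t a z * x.1.1 := div_mul_cancel₀ _ hd0
  have hBz1 : latErr₁ t a z = B₁ * z.1.1 + B₂ * z.1.2 := by
    apply mul_right_cancel₀ hd0
    linear_combination (-(z.1.1 : ℝ)) * hB₁' - (z.1.2 : ℝ) * hB₂' + latErr₁ t a z * hdval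
  have hBz2 : latErr₂ t a z = B₂ * z.1.1 + B₃ * z.1.2 := by
    apply mul_right_cancel₀ hd0
    linear_combination (-(z.1.1 : ℝ)) * hB₂' - (z.1.2 : ℝ) * hB₃' + latErr₂ t a z * hdval +
      (z.1.1 : ℝ) * hisoz x hx
  have hBx1 : latErr₁ t a x = B₁ * x.1.1 + B₂ * x.1.2 := by
    apply mul_right_cancel₀ hd0
    linear_combination (-(x.1.1 : ℝ)) * hB₁' - (x.1.2 : ℝ) * hB₂' + latErr₁ t a x * hdval
  have hBx2 : latErr₂ t a x = B₂ * x.1.1 + B₃ * x.1.2 := by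
    apply mul_right_cancel₀ hd0
    linear_combination (-(x.1.1 : ℝ)) * hB₂' - (x.1.2 : ℝ) * hB₃' + latErr₂ t a x * hdval +
      (x.1.1 : ℝ) * hisoz x hx
  have hB : ∀ w ∈ Γ, latErr₁ t a w = B₁ * w.1.1 + B₂ * w.1.2 ∧
      latErr₂ t a w = B₂ * w.1.1 + B₃ * w.1.2 := by
    intro w hw
    have i1 := hisoz w hw
    have i2 := hiso x hx w hw
    rw [hBz1, hBz2] at i1
    rw [hBx1, hBx2] at i2
    constructor
    · apply mul_right_cancel₀ hd0
      rw [hdval]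
      linear_combination (-(x.1.2 : ℝ)) * i1 + (z.1.2 : ℝ) * i2
    · apply mul_right_cancel₀ hd0
      rw [hdval]
      linear_combination (x.1.1 : ℝ) * i1 - (z.1.1 : ℝ) * i2
  have hdet : ∀ w ∈ Γ, B₁ * latDet z w = latErr₁ t a z * w.1.2 - latErr₁ t a w * z.1.2 ∧
      B₂ * latDet z w = latErr₁ t a w * z.1.1 - latErr₁ t a z * w.1.1 ∧
      B₃ * latDet z w = latErr₂ t a w * z.1.1 - latErr₂ t a z * w.1.1 := by
    intro w hw
    obtain ⟨w1, w2⟩ := hB w hw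
    rw [w1, w2, hBz1, hBz2, latDet]
    push_cast
    exact ⟨by ring, by ring, by ring⟩
  -- Bounding `D κ` controls everything at once: the term `1/L²` bounds `D` itself, and the entries
  -- of `B` bound the approximation errors `D B`.
  set κ : ℝ := max (1 / L ^ 2) (max |B₁| (max |B₂| |B₃|)) with hκ
  have hκ0 : 0 < κ := lt_max_of_lt_left (by positivity)
  have hbd : ∀ w ∈ Γ, |(latDet z w : ℝ)| ≤ lam / (2 * κ) := by
    intro w hw
    obtain ⟨⟨z1, z2⟩, z3, z4⟩ := latEmb_bounds hL0 t a z
    obtain ⟨⟨w1, w2⟩, w3, w4⟩ := (norm_latEmb_le_iff hL0 t a w (1 / 4)).mp (hΓ w hw)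
    obtain ⟨d1, d2, d3⟩ := hdet w hw
    rw [le_div_iff₀ (by positivity)]
    have c1 : |(latDet z w : ℝ)| * |B₁| ≤ lam / 2 := by
      rw [← abs_mul, mul_comm, d1]
      exact (abs_mul_sub_mul_le hL0 z3 w2 w3 z2).trans (le_of_eq (by ring))
    have c2 : |(latDet z w : ℝ)| * |B₂| ≤ lam / 2 := by
      rw [← abs_mul, mul_comm, d2]
      exact (abs_mul_sub_mul_le hL0 w3 z1 z3 w1).trans (le_of_eq (by ring))
    have c3 : |(latDet z w : ℝ)| * |B₃| ≤ lam / 2 := by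
      rw [← abs_mul, mul_comm, d3]
      exact (abs_mul_sub_mul_le hL0 w4 z1 z4 w1).trans (le_of_eq (by ring))
    have c4 : |(latDet z w : ℝ)| * (1 / L ^ 2) ≤ lam / 2 := by
      rw [mul_one_div, div_le_iff₀ (by positivity), latDet]
      push_cast
      calc _ ≤ _ := abs_sub _ _
        _ ≤ (L * lam) * (L * (1 / 4)) + (L * lam) * (L * (1 / 4)) := by
          rw [abs_mul, abs_mul]
          gcongr
        _ = _ := by ring
    have : |(latDet z w : ℝ)| * κ ≤ lam / 2 := by
      rw [hκ, mul_max_of_nonneg _ _ (abs_nonneg _), mul_max_of_nonneg _ _ (abs_nonneg _),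
        mul_max_of_nonneg _ _ (abs_nonneg _)]
      exact max_le c4 (max_le c1 (max_le c2 c3))
    linarith
  obtain ⟨c, hc, c', hc', hne, hle⟩ := exists_ne_abs_sub_le hq (fun k : ℤ => (k : ℝ))
    (W := lam / (2 * κ)) (by positivity) (by
      intro k hk
      obtain ⟨w, hw, rfl⟩ := Finset.mem_image.mp hk
      exact hbd w hw)
  have hq2 : (2 : ℝ) ≤ q := by exact_mod_cast hq
  have key : ∃ y ∈ Γ, ∃ y' ∈ Γ, latDet z y' < latDet z y ∧
      ((latDet z y - latDet z y' : ℤ) : ℝ) * κ ≤ 4 * lam / q := by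
    have hfin : |(c : ℝ) - c'| * κ ≤ 4 * lam / q := by
      calc _ ≤ 4 * (lam / (2 * κ)) / ((Γ.image (latDet z)).card - 1) * κ := by gcongr
        _ = 2 * lam / (q - 1) := by rw [hqdef]; field_simp; norm_num
        _ ≤ _ := by
          rw [div_le_div_iff₀ (by linarith) (by linarith)]
          nlinarith
    obtain ⟨y, hy, rfl⟩ := Finset.mem_image.mp hc
    obtain ⟨y', hy', rfl⟩ := Finset.mem_image.mp hc'
    rcases lt_or_gt_of_ne hne with h | h
    · refine ⟨y', hy', y, hy, h, ?_⟩
      have h' : (latDet z y : ℝ) < latDet z y' := by exact_mod_cast h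
      rw [abs_of_neg (by linarith)] at hfin
      push_cast
      linarith
    · refine ⟨y, hy, y', hy', h, ?_⟩
      have h' : (latDet z y' : ℝ) < latDet z y := by exact_mod_cast h
      rw [abs_of_pos (by linarith)] at hfin
      push_cast
      linarith
  obtain ⟨y, hy, y', hy', hlt, hfin⟩ := key
  set D : ℤ := latDet z y - latDet z y' with hD
  have hD1 : 1 ≤ D := by omega
  have hD0 : (0 : ℝ) < D := by exact_mod_cast hD1
  have hbound : ∀ b : ℝ, |b| ≤ κ → |b * D| ≤ 4 * lam / q := by
    intro b hb
    rw [abs_mul, abs_of_pos hD0, mul_comm]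
    exact (mul_le_mul_of_nonneg_left hb hD0.le).trans hfin
  obtain ⟨d1, d2, d3⟩ := hdet y hy
  obtain ⟨d1', d2', d3'⟩ := hdet y' hy'
  refine ⟨D, z.2.1 * (y - y').1.2 - (y - y').2.1 * z.1.2, (y - y').2.1 * z.1.1 - z.2.1 * (y - y').1.1,
    (y - y').2.2 * z.1.1 - z.2.2 * (y - y').1.1, hD1, ?_, ?_, ?_, ?_⟩
  · have h1 : (D : ℝ) * (1 / L ^ 2) ≤ 4 * lam / q :=
      (mul_le_mul_of_nonneg_left (le_max_left _ _) hD0.le).trans hfin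
    rwa [mul_one_div, div_le_iff₀ (by positivity)] at h1
  · convert hbound B₁ ((le_max_left _ _).trans (le_max_right _ _)) using 2
    rw [hD, Int.cast_sub, mul_sub B₁, d1, d1']
    simp only [latErr₁, latDet, Prod.fst_sub, Prod.snd_sub]
    push_cast
    ring
  · convert hbound B₂ (((le_max_left _ _).trans (le_max_right _ _)).trans (le_max_right _ _)) using 2
    rw [hD, Int.cast_sub, mul_sub B₂, d2, d2']
    simp only [latErr₁, latDet, Prod.fst_sub, Prod.snd_sub]
    push_cast
    ring
  · convert hbound B₃ (((le_max_right _ _).trans (le_max_right _ _)).trans (le_max_right _ _)) using 2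
    rw [hD, Int.cast_sub, mul_sub B₃, d3, d3']
    simp only [latErr₂, latDet, Prod.fst_sub, Prod.snd_sub]
    push_cast
    ring

/-- Split `Γ` into `q` lines parallel to a difference `g` of two of its points. The fullest line
gives `z` parallel to `g` with `‖z‖ ≤ 4q/|Γ|`. If `q = 1` this is already short. Otherwise `q`
determinant values give an error `4‖z‖/q`, and the factor `q` cancels. -/
theorem short_vector_or_rational_approx {L : ℝ} (hL : 1 ≤ L) {t : ℝ} {a : ℝ × ℝ × ℝ}
    {Γ : Finset ((ℤ × ℤ) × (ℤ × ℤ))} (hΓ : ∀ x ∈ Γ, ‖latEmb L t a x‖ ≤ 1 / 4) (hcard : 2 ≤ Γ.card) :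
    (∃ z : (ℤ × ℤ) × (ℤ × ℤ), z.1 ≠ 0 ∧ ‖latEmb L t a z‖ ≤ 4 / Γ.card) ∨
    ∃ D p₁₁ p₁₂ p₂₂ : ℤ, 1 ≤ D ∧ D ≤ 16 / Γ.card * L ^ 2 ∧
      |2 * t * D * a.1 - p₁₁| ≤ 16 / Γ.card ∧ |2 * t * D * a.2.1 - p₁₂| ≤ 16 / Γ.card ∧
      |2 * t * D * a.2.2 - p₂₂| ≤ 16 / Γ.card := by
  obtain ⟨x, hx, y, hy, hxy⟩ := Finset.one_lt_card.mp (by omega : 1 < Γ.card)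
  have hM0 : (0 : ℝ) < Γ.card := by exact_mod_cast (by omega : 0 < Γ.card)
  set g := x - y with hg
  have hg2 : ‖latEmb L t a g‖ ≤ 1 / 2 := by
    rw [hg, latEmb_sub]
    refine (norm_sub_le _ _).trans ?_
    linarith [hΓ x hx, hΓ y hy]
  have hg1 : g.1 ≠ 0 :=
    fst_ne_zero_of_norm_latEmb_lt hL (sub_ne_zero.mpr hxy) (by linarith)
  set q := (Γ.image (latDet g)).card with hq
  have hq1 : 1 ≤ q := Finset.card_pos.mpr (Finset.Nonempty.image ⟨x, hx⟩ _)
  have hq0 : (0 : ℝ) < q := by exact_mod_cast hq1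
  obtain ⟨c, hc, hfib⟩ := Finset.exists_le_card_fiber_of_nsmul_le_card_of_maps_to
    (s := Γ) (t := Γ.image (latDet g)) (f := latDet g) (b := (Γ.card : ℝ) / q)
    (fun w hw => Finset.mem_image_of_mem _ hw) ⟨_, Finset.mem_image_of_mem _ hx⟩
    (by rw [nsmul_eq_mul, ← hq, mul_div_cancel₀ _ hq0.ne'])
  set Φ := Γ.filter (fun w => latDet g w = c) with hΦ
  have hΦ0 : (0 : ℝ) < Φ.card := lt_of_lt_of_le (by positivity) hfib
  obtain ⟨z, hz1, hzdet, hz2, hz3⟩ := exists_short_vector hL hg1 hg2 (Φ := Φ)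
    (fun w hw => hΓ w (Finset.mem_filter.mp hw).1) (by exact_mod_cast hΦ0)
    (fun w hw w' hw' => (Finset.mem_filter.mp hw).2.trans (Finset.mem_filter.mp hw').2.symm)
  have hz4 : ‖latEmb L t a z‖ ≤ 4 * q / Γ.card := by
    refine hz3.trans ?_
    rw [div_le_div_iff₀ hΦ0 hM0]
    rw [div_le_iff₀ hq0] at hfib
    linarith
  by_cases hq2 : q = 1
  · left
    refine ⟨z, hz1, ?_⟩
    rw [hq2] at hz4
    simpa using hz4
  right
  have hinj : ∀ w w', latDet z w = latDet z w' → latDet g w = latDet g w' := by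
    intro w w' h
    have h1 : latDet z (w - w') = 0 := by rw [latDet_sub, h, sub_self]
    have h2 : latDet g (w - w') = 0 := by
      simp only [latDet] at h1 hzdet ⊢
      by_cases h3 : z.1.1 = 0
      · have h4 : z.1.2 ≠ 0 := fun h4 => hz1 (Prod.ext h3 h4)
        apply (mul_eq_zero.mp _).resolve_left h4
        linear_combination (w - w').1.2 * hzdet + g.1.2 * h1
      · apply (mul_eq_zero.mp _).resolve_left h3
        linear_combination (w - w').1.1 * hzdet + g.1.1 * h1
    rw [latDet_sub] at h2
    exact sub_eq_zero.mp h2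
  -- Being parallel to `g`, the vector `z` separates the points of `Γ` into at least as many
  -- classes.
  have hcardz : q ≤ (Γ.image (latDet z)).card := by
    choose! φ hφ using (fun k (hk : k ∈ Γ.image (latDet g)) => Finset.mem_image.mp hk)
    refine Finset.card_le_card_of_injOn (fun k => latDet z (φ k)) ?_ ?_
    · intro k hk
      exact Finset.mem_image_of_mem _ (hφ k hk).1
    · intro k hk k' hk' he
      have := hinj _ _ he
      rwa [(hφ k hk).2, (hφ k' hk').2] at this
  obtain ⟨D, p₁₁, p₁₂, p₂₂, h0, h1, h2, h3, h4⟩ :=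
    exists_rational_approx hL hz1 hz2 hΓ (by omega)
  have hle : 4 * ‖latEmb L t a z‖ / (Γ.image (latDet z)).card ≤ 16 / Γ.card := by
    have hcz : (q : ℝ) ≤ (Γ.image (latDet z)).card := by exact_mod_cast hcardz
    calc _ ≤ 4 * (4 * (q : ℝ) / (Γ.card : ℝ)) / (q : ℝ) := by gcongr
      _ = _ := by field_simp; norm_num
  exact ⟨D, p₁₁, p₁₂, p₂₂, h0, h1.trans (by gcongr), h2.trans hle, h3.trans hle, h4.trans hle⟩

/-! ### Counting lattice points near the graph -/

theorem IsAdmissible.mem_cube {a : ℝ × ℝ × ℝ} (h : IsAdmissible (symMatrix a)) : a ∈ cube 2 := by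
  have h1 := h.entries_le 0 0
  have h2 := h.entries_le 0 1
  have h3 := h.entries_le 1 1
  simp only [symMatrix, Matrix.of_apply, Matrix.cons_val', Matrix.cons_val_zero, Matrix.cons_val_one,
    Matrix.cons_val_fin_one] at h1 h2 h3
  exact ⟨abs_le.mp h1, abs_le.mp h2, abs_le.mp h3⟩

theorem hasEigenvalue_symMatrix {a : ℝ × ℝ × ℝ} {μ : ℝ}
    (h : (μ - a.1) * (μ - a.2.2) = a.2.1 ^ 2) :
    Module.End.HasEigenvalue (Matrix.toLin' (symMatrix a)) μ := by
  by_cases h0 : a.2.1 = 0 ∧ μ = a.1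
  · refine Module.End.hasEigenvalue_of_hasEigenvector (x := ![1, 0])
      ⟨Module.End.mem_eigenspace_iff.mpr ?_, fun h => by simpa using congrFun h 0⟩
    ext i
    fin_cases i <;> simp [symMatrix, Matrix.toLin'_apply, h0.1, h0.2]
  · refine Module.End.hasEigenvalue_of_hasEigenvector (x := ![a.2.1, μ - a.1])
      ⟨Module.End.mem_eigenspace_iff.mpr ?_, fun h => ?_⟩
    · ext i
      fin_cases i
      · simp [symMatrix, Matrix.toLin'_apply]
        ring
      · simp [symMatrix, Matrix.toLin'_apply]
        linarith
    · have e1 := congrFun h 0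
      have e2 := congrFun h 1
      simp only [Matrix.cons_val_zero, Matrix.cons_val_one, Pi.zero_apply] at e1 e2
      exact h0 ⟨e1, by linarith⟩

/-- The smaller root of the characteristic polynomial exceeds 1; this says that `α - 1` is positive
definite. -/
theorem IsAdmissible.lower_bounds {a : ℝ × ℝ × ℝ} (h : IsAdmissible (symMatrix a)) :
    1 < a.1 ∧ a.2.1 ^ 2 < (a.1 - 1) * (a.2.2 - 1) := by
  set s := Real.sqrt ((a.1 - a.2.2) ^ 2 + 4 * a.2.1 ^ 2) with hs
  have hs2 : s ^ 2 = (a.1 - a.2.2) ^ 2 + 4 * a.2.1 ^ 2 := Real.sq_sqrt (by positivity)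
  have hs0 : 0 ≤ s := Real.sqrt_nonneg _
  have h1 := h.one_lt_eigenvalue ((a.1 + a.2.2 - s) / 2)
    (hasEigenvalue_symMatrix (by linear_combination hs2 / 4))
  have h2 : a.2.1 ^ 2 < (a.1 - 1) * (a.2.2 - 1) := by nlinarith
  refine ⟨?_, h2⟩
  by_contra! h3
  have h4 : 0 < a.2.2 - 1 := by linarith
  nlinarith [sq_nonneg a.2.1]

/-- With `κ` the maximum, `|k|² ≤ k·αk ≤ (|k₁| + |k₂|) κ ≤ |k|² κ`, the last step because `|n| ≤ n²`
for integers. -/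
theorem IsAdmissible.one_le_max {a : ℝ × ℝ × ℝ} (h : IsAdmissible (symMatrix a)) {k : ℤ × ℤ}
    (hk : k ≠ 0) :
    1 ≤ max |k.1 * a.1 + k.2 * a.2.1| |k.1 * a.2.1 + k.2 * a.2.2| := by
  obtain ⟨h1, h2⟩ := h.lower_bounds
  set κ := max |k.1 * a.1 + k.2 * a.2.1| |k.1 * a.2.1 + k.2 * a.2.2| with hκ
  have hκ0 : 0 ≤ κ := le_max_of_le_left (abs_nonneg _)
  have hsq : ∀ n : ℤ, |(n : ℝ)| ≤ (n : ℝ) ^ 2 := by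
    intro n
    rw [← sq_abs]
    rcases eq_or_ne n 0 with rfl | hn
    · simp
    · have : (1 : ℝ) ≤ |(n : ℝ)| := by exact_mod_cast Int.one_le_abs hn
      nlinarith
  have hpos : 0 < (k.1 : ℝ) ^ 2 + (k.2 : ℝ) ^ 2 := by
    by_contra! hle
    have e1 : (k.1 : ℝ) ^ 2 = 0 := by nlinarith [sq_nonneg (k.1 : ℝ), sq_nonneg (k.2 : ℝ)]
    have e2 : (k.2 : ℝ) ^ 2 = 0 := by nlinarith [sq_nonneg (k.1 : ℝ), sq_nonneg (k.2 : ℝ)]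
    exact hk (Prod.ext (by exact_mod_cast pow_eq_zero_iff two_ne_zero |>.mp e1)
      (by exact_mod_cast pow_eq_zero_iff two_ne_zero |>.mp e2))
  have hquad : (k.1 : ℝ) ^ 2 + (k.2 : ℝ) ^ 2 ≤
      k.1 * (k.1 * a.1 + k.2 * a.2.1) + k.2 * (k.1 * a.2.1 + k.2 * a.2.2) := by
    have h3 : 0 < a.1 - 1 := by linarith
    have h4 : 0 ≤ (a.1 - 1) * ((k.1 * (k.1 * a.1 + k.2 * a.2.1) + k.2 * (k.1 * a.2.1 + k.2 * a.2.2)) -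
        ((k.1 : ℝ) ^ 2 + (k.2 : ℝ) ^ 2)) := by
      have e : (a.1 - 1) * ((k.1 * (k.1 * a.1 + k.2 * a.2.1) + k.2 * (k.1 * a.2.1 + k.2 * a.2.2)) -
        ((k.1 : ℝ) ^ 2 + (k.2 : ℝ) ^ 2)) = ((a.1 - 1) * k.1 + a.2.1 * k.2) ^ 2 +
          ((a.1 - 1) * (a.2.2 - 1) - a.2.1 ^ 2) * (k.2 : ℝ) ^ 2 := by ring
      rw [e]
      have : 0 ≤ (a.1 - 1) * (a.2.2 - 1) - a.2.1 ^ 2 := by linarith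
      positivity
    have := nonneg_of_mul_nonneg_right h4 h3
    linarith
  have hup : k.1 * (k.1 * a.1 + k.2 * a.2.1) + k.2 * (k.1 * a.2.1 + k.2 * a.2.2) ≤
      ((k.1 : ℝ) ^ 2 + (k.2 : ℝ) ^ 2) * κ := by
    calc _ ≤ |(k.1 : ℝ)| * |k.1 * a.1 + k.2 * a.2.1| + |(k.2 : ℝ)| * |k.1 * a.2.1 + k.2 * a.2.2| := by
          rw [← abs_mul, ← abs_mul]
          exact add_le_add (le_abs_self _) (le_abs_self _)
      _ ≤ (k.1 : ℝ) ^ 2 * κ + (k.2 : ℝ) ^ 2 * κ := by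
        gcongr
        · exact hsq _
        · exact le_max_left _ _
        · exact hsq _
        · exact le_max_right _ _
      _ = _ := by ring
  nlinarith

theorem rpow_bound_of_rpow_le {M X K p s θ : ℝ} (hM : 0 ≤ M) (hX : 1 ≤ X) (hK : 0 ≤ K) (hp : 0 < p)
    (h : M ^ p ≤ K * X ^ s) (hθ : s / p ≤ θ) : M ≤ K ^ (1 / p) * X ^ θ := by
  have hX0 : 0 ≤ X := by linarith
  calc M = (M ^ p) ^ (1 / p) := by
        rw [← Real.rpow_mul hM, mul_one_div_cancel hp.ne', Real.rpow_one]
    _ ≤ (K * X ^ s) ^ (1 / p) := by gcongr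
    _ = K ^ (1 / p) * X ^ (s / p) := by
      rw [Real.mul_rpow hK (by positivity), ← Real.rpow_mul hX0, mul_one_div]
    _ ≤ _ := by gcongr

theorem abs_apply_le {a : ℝ × ℝ × ℝ} (ha : a ∈ cube 2) {k : ℤ × ℤ} {W : ℝ} (h1 : |(k.1 : ℝ)| ≤ W)
    (h2 : |(k.2 : ℝ)| ≤ W) :
    |k.1 * a.1 + k.2 * a.2.1| ≤ 4 * W ∧ |k.1 * a.2.1 + k.2 * a.2.2| ≤ 4 * W := by
  obtain ⟨a1, a2, a3⟩ := ha
  rw [Set.mem_Icc, ← abs_le] at a1 a2 a3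
  have hW : 0 ≤ W := (abs_nonneg _).trans h1
  constructor
  · calc _ ≤ _ := abs_add_le _ _
      _ ≤ W * 2 + W * 2 := by rw [abs_mul, abs_mul]; gcongr
      _ = _ := by ring
  · calc _ ≤ _ := abs_add_le _ _
      _ ≤ W * 2 + W * 2 := by rw [abs_mul, abs_mul]; gcongr
      _ = _ := by ring

theorem abs_snd_le {a : ℝ × ℝ × ℝ} (ha : a ∈ cube 2) {L t ρ : ℝ} (hL : 1 ≤ L) (ht : 1 / L < t)
    {z : (ℤ × ℤ) × (ℤ × ℤ)} (hz : ‖latEmb L t a z‖ ≤ ρ) :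
    |(z.2.1 : ℝ)| ≤ 9 * (t * ρ * L) ∧ |(z.2.2 : ℝ)| ≤ 9 * (t * ρ * L) := by
  have hL0 : 0 < L := by linarith
  have ht0 : 0 < t := lt_trans (by positivity) ht
  have hρ0 : 0 ≤ ρ := (norm_nonneg _).trans hz
  obtain ⟨⟨h1, h2⟩, h3, h4⟩ := (norm_latEmb_le_iff hL0 t a z ρ).mp hz
  obtain ⟨b1, b2⟩ := abs_apply_le ha h1 h2
  have hsmall : ρ / L ≤ t * ρ * L := by
    calc ρ / L = 1 / L * ρ * 1 := by ring
      _ ≤ t * ρ * L := by gcongr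
  constructor
  · have e : (z.2.1 : ℝ) = 2 * t * (z.1.1 * a.1 + z.1.2 * a.2.1) - latErr₁ t a z := by
      simp only [latErr₁]; ring
    rw [e]
    calc _ ≤ _ := abs_sub _ _
      _ ≤ 2 * t * (4 * (L * ρ)) + t * ρ * L := by
        rw [abs_mul, abs_of_pos (by positivity : 0 < 2 * t)]
        gcongr
        exact h3.trans hsmall
      _ = _ := by ring
  · have e : (z.2.2 : ℝ) = 2 * t * (z.1.1 * a.2.1 + z.1.2 * a.2.2) - latErr₂ t a z := by
      simp only [latErr₂]; ring
    rw [e]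
    calc _ ≤ _ := abs_sub _ _
      _ ≤ 2 * t * (4 * (L * ρ)) + t * ρ * L := by
        rw [abs_mul, abs_of_pos (by positivity : 0 < 2 * t)]
        gcongr
        exact h4.trans hsmall
      _ = _ := by ring

/-- If `m = 0` then `2t|αh| ≤ 1/L < t`, contradicting `|αh| ≥ 1`. This is where `t > 1/L` is
essential. -/
theorem IsAdmissible.snd_ne_zero {a : ℝ × ℝ × ℝ} (h : IsAdmissible (symMatrix a)) {L t : ℝ}
    (hL : 1 ≤ L) (ht : 1 / L < t) {z : (ℤ × ℤ) × (ℤ × ℤ)} (hz : ‖latEmb L t a z‖ ≤ 1)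
    (hz1 : z.1 ≠ 0) : z.2 ≠ 0 := by
  intro h0
  have hL0 : 0 < L := by linarith
  have ht0 : 0 < t := lt_trans (by positivity) ht
  obtain ⟨-, h3, h4⟩ := (norm_latEmb_le_iff hL0 t a z 1).mp hz
  simp only [latErr₁, latErr₂, h0, Prod.fst_zero, Prod.snd_zero, Int.cast_zero, sub_zero, abs_mul,
    abs_of_pos ht0, abs_two] at h3 h4
  have key : ∀ r : ℝ, 2 * t * r ≤ 1 / L → r < 1 := by
    intro r hr
    by_contra! h1
    nlinarith
  have := max_lt (key _ h3) (key _ h4)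
  linarith [h.one_le_max hz1]

/-- With `ρ = 4/M`, a short vector gives an integer form `v` of norm `O(tL²ρ²)` and value `O(ρ²)`.
The Diophantine condition then forces `M^(6+2η) ≲ (tL²)^(2+η)`. -/
theorem IsAdmissible.card_bound_of_short {η : ℝ} (hη : 0 < η) {a : ℝ × ℝ × ℝ}
    (h : IsAdmissible (symMatrix a)) (hD : IsDiophantine η a) :
    ∃ C : ℝ, 0 < C ∧ ∀ L t M : ℝ, 1 ≤ L → 1 / L < t → 4 ≤ M →
      (∃ z : (ℤ × ℤ) × (ℤ × ℤ), z.1 ≠ 0 ∧ ‖latEmb L t a z‖ ≤ 4 / M) →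
      M ≤ C * (t * L ^ 2) ^ (1 / 3 + η) := by
  obtain ⟨c, hc, hdio⟩ := hD
  refine ⟨(9 * 18 ^ (2 + η) * 4 ^ (6 + 2 * η) / c) ^ (1 / (6 + 2 * η)), by positivity, ?_⟩
  rintro L t M hL ht hM ⟨z, hz1, hz⟩
  have hL0 : 0 < L := by linarith
  have ht0 : 0 < t := lt_trans (by positivity) ht
  have hM0 : 0 < M := by linarith
  have htL : 1 < t * L := by rwa [div_lt_iff₀ hL0] at ht
  have hX : 1 ≤ t * L ^ 2 := by nlinarith
  set ρ := 4 / M with hρ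
  have hρ0 : 0 < ρ := by positivity
  have hρ1 : ρ ≤ 1 := by rw [hρ, div_le_one hM0]; exact hM
  have hm := h.snd_ne_zero hL ht (hz.trans hρ1) hz1
  obtain ⟨⟨h1, h2⟩, h3, h4⟩ := (norm_latEmb_le_iff hL0 t a z ρ).mp hz
  obtain ⟨m1, m2⟩ := abs_snd_le h.mem_cube hL ht hz
  -- This encodes `m₂ (αh)₁ - m₁ (αh)₂` as a linear form in the entries of `α`; it is small because
  -- `2tαh` is close to `m`.
  set v := formMul (z.1, (z.2.2, -z.2.1)) with hv
  have hv0 : v ≠ 0 := by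
    rw [hv, Ne, formMul_eq_zero_iff]
    rintro (h' | h')
    · exact hz1 h'
    · simp only [Prod.mk_eq_zero, neg_eq_zero] at h'
      exact hm (Prod.ext h'.2 h'.1)
  have hvn : ‖v‖ ≤ 18 * (t * L ^ 2 * ρ ^ 2) := by
    have hp : ∀ x y : ℤ, |(x : ℝ)| ≤ L * ρ → |(y : ℝ)| ≤ 9 * (t * ρ * L) →
        |(x : ℝ) * y| ≤ 9 * (t * L ^ 2 * ρ ^ 2) := by
      intro x y hx hy
      rw [abs_mul]
      calc _ ≤ (L * ρ) * (9 * (t * ρ * L)) := by gcongr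
        _ = _ := by ring
    have hpos : 0 ≤ t * L ^ 2 * ρ ^ 2 := by positivity
    simp only [hv, formMul, Prod.norm_def, Int.norm_eq_abs, max_le_iff]
    push_cast
    refine ⟨(hp _ _ h1 m2).trans (by linarith), ?_, ?_⟩
    · refine (abs_add_le _ _).trans ?_
      have e1 := hp _ _ h1 m1
      have e2 := hp _ _ h2 m2
      rw [mul_neg, abs_neg]
      linarith
    · rw [mul_neg, abs_neg]
      exact (hp _ _ h2 m1).trans (by linarith)
  have hfreq : |freq v a| ≤ 9 * ρ ^ 2 := by
    have e : 2 * t * freq v a = z.2.2 * latErr₁ t a z - z.2.1 * latErr₂ t a z := by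
      simp only [hv, freq, formMul, latErr₁, latErr₂]
      push_cast
      ring
    have h5 : |2 * t * freq v a| ≤ 2 * t * (9 * ρ ^ 2) := by
      rw [e]
      calc _ ≤ _ := abs_sub _ _
        _ ≤ 9 * (t * ρ * L) * (ρ / L) + 9 * (t * ρ * L) * (ρ / L) := by
          rw [abs_mul, abs_mul]
          gcongr
        _ = _ := by field_simp; ring
    rw [abs_mul, abs_of_pos (by positivity : 0 < 2 * t)] at h5
    exact le_of_mul_le_mul_left h5 (by positivity)
  have hmain : c ≤ 9 * ρ ^ 2 * (18 * (t * L ^ 2 * ρ ^ 2)) ^ (2 + η) := by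
    refine (hdio v hv0).trans ?_
    gcongr
  have e1 : 9 * ρ ^ 2 * (18 * (t * L ^ 2 * ρ ^ 2)) ^ (2 + η) =
      9 * 18 ^ (2 + η) * 4 ^ (6 + 2 * η) * (t * L ^ 2) ^ (2 + η) / M ^ (6 + 2 * η) := by
    rw [Real.mul_rpow (by norm_num) (by positivity), Real.mul_rpow (by positivity) (by positivity)]
    have e2 : ρ ^ 2 * (ρ ^ 2) ^ (2 + η) = 4 ^ (6 + 2 * η) / M ^ (6 + 2 * η) := by
      rw [← Real.div_rpow (by norm_num) hM0.le, ← hρ, ← Real.rpow_natCast, ← Real.rpow_mul hρ0.le,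
        ← Real.rpow_add hρ0]
      congr 1
      push_cast
      ring
    calc _ = 9 * 18 ^ (2 + η) * (t * L ^ 2) ^ (2 + η) * (ρ ^ 2 * (ρ ^ 2) ^ (2 + η)) := by ring
      _ = _ := by rw [e2]; ring
  rw [e1, le_div_iff₀ (by positivity)] at hmain
  refine rpow_bound_of_rpow_le hM0.le hX (by positivity) (p := 6 + 2 * η) (s := 2 + η) (by positivity)
    ?_ ?_
  · rw [div_mul_eq_mul_div, le_div_iff₀ hc]
    linarith
  · rw [div_le_iff₀ (by positivity)]
    nlinarith

/-- Eliminating `2tD` between the three approximations leaves approximations of size `O(1/M)` to the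
ratios of entries, with denominator `p₁₁ = O(tL²/M)`. Hence `M^(3/2+η) ≲ (tL²)^(1/2+η)`. -/
theorem IsAdmissible.card_bound_of_approx {η : ℝ} (hη : 0 < η) {a : ℝ × ℝ × ℝ}
    (h : IsAdmissible (symMatrix a)) (hS : IsSimDiophantine η a) :
    ∃ C : ℝ, 0 < C ∧ ∀ L t M : ℝ, 1 ≤ L → 1 / L < t → 64 ≤ M →
      (∃ D p₁₁ p₁₂ p₂₂ : ℤ, 1 ≤ D ∧ D ≤ 16 / M * L ^ 2 ∧
      |2 * t * D * a.1 - p₁₁| ≤ 16 / M ∧ |2 * t * D * a.2.1 - p₁₂| ≤ 16 / M ∧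
      |2 * t * D * a.2.2 - p₂₂| ≤ 16 / M) →
      M ≤ C * (t * L ^ 2) ^ (1 / 3 + η) ∨ M ≤ 8 / t := by
  obtain ⟨c, hc, hdio⟩ := hS
  refine ⟨(64 * 96 ^ (1 / 2 + η) / c) ^ (1 / (3 / 2 + η)), by positivity, ?_⟩
  rintro L t M hL ht hM ⟨D, p, q, s, hD, hDle, e1, e2, e3⟩
  have hL0 : 0 < L := by linarith
  have ht0 : 0 < t := lt_trans (by positivity) ht
  have hM0 : 0 < M := by linarith
  have htL : 1 < t * L := by rwa [div_lt_iff₀ hL0] at ht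
  have hX : 1 ≤ t * L ^ 2 := by nlinarith
  have hD1 : (1 : ℝ) ≤ D := by exact_mod_cast hD
  obtain ⟨c1, c2, c3⟩ := h.mem_cube
  rw [Set.mem_Icc, ← abs_le] at c1 c2 c3
  have ha1 := h.lower_bounds.1
  have ha2 : a.1 ≤ 2 := (abs_le.mp c1).2
  set δ := 16 / M with hδ
  have hδ0 : 0 < δ := by positivity
  have hδ1 : δ ≤ 1 / 4 := by rw [hδ, div_le_iff₀ hM0]; linarith
  set u := 2 * t * D with hu
  have hu0 : 0 < u := by positivity
  -- If `p ≤ 0` the approximation is trivial: `2tD` itself is at most `16/M`, so `M ≤ 8/t`.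
  rcases le_or_gt p 0 with hp | hp
  · right
    have hpR : (p : ℝ) ≤ 0 := by exact_mod_cast hp
    have h1 : u ≤ δ := by
      have := (abs_le.mp e1).2
      nlinarith
    have h2 : 2 * t ≤ 16 / M := by
      refine le_trans ?_ h1
      rw [hu]
      nlinarith
    rw [le_div_iff₀ hM0] at h2
    rw [le_div_iff₀ ht0]
    linarith
  · left
    have hp1 : (1 : ℝ) ≤ p := by exact_mod_cast hp
    have hcross : ∀ (b : ℝ) (q : ℤ), |b| ≤ 2 → |u * b - q| ≤ δ → |p * b - q * a.1| ≤ 4 * δ := by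
      intro b q hb hq
      have e : p * b - q * a.1 = a.1 * (u * b - q) - (u * a.1 - p) * b := by ring
      rw [e]
      calc _ ≤ _ := abs_sub _ _
        _ ≤ 2 * δ + δ * 2 := by rw [abs_mul, abs_mul]; gcongr
        _ = _ := by ring
    have hple : (p : ℝ) ≤ 96 * (t * L ^ 2) / M := by
      have h1 := (abs_le.mp e1).1
      have h2 : (p : ℝ) ≤ 3 * u := by nlinarith
      calc (p : ℝ) ≤ 3 * u := h2
        _ ≤ 3 * (2 * t * (16 / M * L ^ 2)) := by rw [hu]; gcongr
        _ = _ := by ring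
    have hmain : c ≤ 64 / M * (96 * (t * L ^ 2) / M) ^ (1 / 2 + η) := by
      refine (hdio p q s hp).trans ?_
      have h1 : max |p * a.2.1 - q * a.1| |p * a.2.2 - s * a.1| ≤ 64 / M := by
        have : 64 / M = 4 * δ := by rw [hδ]; ring
        rw [this]
        exact max_le (hcross _ _ c2 e2) (hcross _ _ c3 e3)
      gcongr
    have e4 : 64 / M * (96 * (t * L ^ 2) / M) ^ (1 / 2 + η) =
        64 * 96 ^ (1 / 2 + η) * (t * L ^ 2) ^ (1 / 2 + η) / M ^ (3 / 2 + η) := by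
      have e5 : M ^ (3 / 2 + η) = M * M ^ (1 / 2 + η) := by
        rw [← Real.rpow_one_add' hM0.le (by positivity)]
        congr 1
        ring
      rw [Real.div_rpow (by positivity) hM0.le, Real.mul_rpow (by norm_num) (by positivity), e5]
      field_simp
    rw [e4, le_div_iff₀ (by positivity)] at hmain
    refine rpow_bound_of_rpow_le hM0.le hX (by positivity) (p := 3 / 2 + η) (s := 1 / 2 + η)
      (by positivity) ?_ ?_
    · rw [div_mul_eq_mul_div, le_div_iff₀ hc]
      linarith
    · rw [div_le_iff₀ (by positivity)]
      nlinarith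

/-- By `snd_ne_zero` applied to differences, a point is determined by `m`, which ranges over a box
of side `O(tL)`. -/
theorem IsAdmissible.card_le_sq {a : ℝ × ℝ × ℝ} (h : IsAdmissible (symMatrix a)) {L t : ℝ}
    (hL : 1 ≤ L) (ht : 1 / L < t) {Γ : Finset ((ℤ × ℤ) × (ℤ × ℤ))}
    (hΓ : ∀ x ∈ Γ, ‖latEmb L t a x‖ ≤ 1 / 4) : (Γ.card : ℝ) ≤ 49 * (t * L) ^ 2 := by
  have hL0 : 0 < L := by linarith
  have ht0 : 0 < t := lt_trans (by positivity) ht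
  have htL : 1 < t * L := by rwa [div_lt_iff₀ hL0] at ht
  set K : ℕ := ⌊3 * (t * L)⌋₊ with hK
  have hKle : (K : ℝ) ≤ 3 * (t * L) := Nat.floor_le (by positivity)
  have hmem : ∀ m : ℤ, |(m : ℝ)| ≤ 9 * (t * (1 / 4) * L) → m ∈ Finset.Icc (-K : ℤ) K := by
    intro m hm
    rw [Finset.mem_Icc, ← abs_le]
    have h1 : m.natAbs ≤ K := by
      apply Nat.le_floor
      rw [Nat.cast_natAbs, Int.cast_abs]
      nlinarith
    rw [Int.abs_eq_natAbs]
    exact_mod_cast h1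
  have hcard : Γ.card ≤ (Finset.Icc (-K : ℤ) K ×ˢ Finset.Icc (-K : ℤ) K).card := by
    refine Finset.card_le_card_of_injOn Prod.snd ?_ ?_
    · intro x hx
      obtain ⟨m1, m2⟩ := abs_snd_le h.mem_cube hL ht (hΓ x hx)
      rw [Finset.mem_coe, Finset.mem_product]
      exact ⟨hmem _ m1, hmem _ m2⟩
    · intro x hx y hy hxy
      have hsub : ‖latEmb L t a (x - y)‖ ≤ 1 := by
        rw [latEmb_sub]
        refine (norm_sub_le _ _).trans ?_
        linarith [hΓ x hx, hΓ y hy]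
      by_contra hne
      have h2 : (x - y).2 = 0 := by rw [Prod.snd_sub, hxy, sub_self]
      have h1 : (x - y).1 ≠ 0 := fun h1 => sub_ne_zero.mpr hne (Prod.ext h1 h2)
      exact h.snd_ne_zero hL ht hsub h1 h2
  have hI : ((K : ℤ) + 1 - (-K)).toNat = 2 * K + 1 := by omega
  rw [Finset.card_product, Int.card_Icc, hI] at hcard
  calc (Γ.card : ℝ) ≤ ((2 * K + 1) * (2 * K + 1) : ℕ) := by exact_mod_cast hcard
    _ = (2 * (K : ℝ) + 1) ^ 2 := by push_cast; ring
    _ ≤ (2 * (3 * (t * L)) + t * L) ^ 2 := by gcongr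
    _ = _ := by ring

theorem IsAdmissible.exists_card_le {η : ℝ} (hη : 0 < η) {a : ℝ × ℝ × ℝ}
    (h : IsAdmissible (symMatrix a)) (hD : IsDiophantine η a) (hS : IsSimDiophantine η a) :
    ∃ C : ℝ, 0 < C ∧ ∀ L t : ℝ, 1 ≤ L → 1 / L < t → ∀ Γ : Finset ((ℤ × ℤ) × (ℤ × ℤ)),
      (∀ x ∈ Γ, ‖latEmb L t a x‖ ≤ 1 / 4) →
      (Γ.card : ℝ) ≤ C * ((t * L ^ 2) ^ (1 / 3 + η) + L ^ (2 / 3 : ℝ)) := by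
  obtain ⟨C₁, hC₁, h1⟩ := h.card_bound_of_short hη hD
  obtain ⟨C₂, hC₂, h2⟩ := h.card_bound_of_approx hη hS
  refine ⟨C₁ + C₂ + 64, by positivity, fun L t hL ht Γ hΓ => ?_⟩
  have hL0 : 0 < L := by linarith
  have ht0 : 0 < t := lt_trans (by positivity) ht
  have hA : 0 ≤ (t * L ^ 2) ^ (1 / 3 + η) := by positivity
  have hB : 1 ≤ L ^ (2 / 3 : ℝ) := Real.one_le_rpow hL (by norm_num)
  set A := (t * L ^ 2) ^ (1 / 3 + η) with hAdef
  set B := L ^ (2 / 3 : ℝ) with hBdef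
  by_cases hM : (64 : ℝ) ≤ Γ.card
  · have hcard : 2 ≤ Γ.card := by
      have : (2 : ℝ) ≤ Γ.card := by linarith
      exact_mod_cast this
    rcases short_vector_or_rational_approx hL hΓ hcard with hs | hs
    · have := h1 L t Γ.card hL ht (by linarith) hs
      nlinarith [mul_nonneg hC₂.le hA, mul_nonneg hC₁.le (zero_le_one.trans hB),
        mul_nonneg hC₂.le (zero_le_one.trans hB)]
    · rcases h2 L t Γ.card hL ht hM hs with h3 | h3
      · nlinarith [mul_nonneg hC₁.le hA, mul_nonneg hC₁.le (zero_le_one.trans hB),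
          mul_nonneg hC₂.le (zero_le_one.trans hB)]
      · have hle : (Γ.card : ℝ) ≤ 49 * B := by
          -- The bounds `8/t` and `49(tL)²` balance at `t = L^(-2/3)`, where both are of order
          -- `L^(2/3)`.
          rcases le_or_gt (L ^ (-(2 / 3) : ℝ)) t with h4 | h4
          · have h5 : 8 / t ≤ 8 * B := by
              rw [div_le_iff₀ ht0]
              have e : B * L ^ (-(2 / 3) : ℝ) = 1 := by
                rw [hBdef, ← Real.rpow_add hL0, add_neg_cancel, Real.rpow_zero]
              nlinarith
            linarith
          · have h5 := h.card_le_sq hL ht hΓ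
            have h6 : (t * L) ^ 2 ≤ B := by
              have e : (L ^ (-(2 / 3) : ℝ) * L) ^ 2 = B := by
                rw [← Real.rpow_add_one hL0.ne', ← Real.rpow_natCast, ← Real.rpow_mul hL0.le, hBdef]
                norm_num
              rw [← e]
              gcongr
            linarith
        nlinarith [mul_nonneg hC₁.le hA, mul_nonneg hC₂.le hA, mul_nonneg hC₁.le (zero_le_one.trans hB),
          mul_nonneg hC₂.le (zero_le_one.trans hB)]
  · nlinarith [mul_nonneg hC₁.le hA, mul_nonneg hC₂.le hA, mul_nonneg hC₁.le (zero_le_one.trans hB),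
      mul_nonneg hC₂.le (zero_le_one.trans hB)]

/-! ### From lattice points to the Weyl sum -/

theorem gridKernel_le (L : ℕ) (x : ℝ) : gridKernel L x ≤ L := by
  rcases Nat.eq_zero_or_pos L with rfl | hL
  · simp [gridKernel]
  have hL0 : (0 : ℝ) < L := by exact_mod_cast hL
  have h1 : ‖∑ j ∈ Finset.range L, (geomRatio L : ℂ) ^ j * expi (j * x)‖ ≤ L := by
    calc _ ≤ ∑ j ∈ Finset.range L, (1 : ℝ) := by
          refine norm_sum_le_of_le _ fun j _ => ?_
          rw [norm_mul, norm_expi, mul_one, norm_pow, Complex.norm_real, Real.norm_eq_abs,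
            abs_of_pos (geomRatio_pos L)]
          exact pow_le_one₀ (geomRatio_pos L).le (geomRatio_le_one L)
      _ = L := by simp
  rw [gridKernel, div_le_iff₀ hL0, ← sq]
  gcongr

theorem norm_one_sub_mul_expi_sq (r x : ℝ) :
    ‖1 - (r : ℂ) * expi x‖ ^ 2 = (1 - r) ^ 2 + 4 * r * Real.sin (Real.pi * x) ^ 2 := by
  have e : expi x = (Real.cos (2 * (Real.pi * x)) : ℂ) + (Real.sin (2 * (Real.pi * x)) : ℂ) *
      Complex.I := by
    have : 2 * Real.pi * Complex.I * (x : ℂ) = ((2 * (Real.pi * x) : ℝ) : ℂ) * Complex.I := by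
      push_cast; ring
    rw [expi, this, Complex.exp_mul_I, Complex.ofReal_cos, Complex.ofReal_sin]
  have e2 : 1 - (r : ℂ) * expi x = ((1 - r * Real.cos (2 * (Real.pi * x)) : ℝ) : ℂ) +
      ((-(r * Real.sin (2 * (Real.pi * x))) : ℝ) : ℂ) * Complex.I := by
    rw [e]; push_cast; ring
  rw [← Complex.normSq_eq_norm_sq, e2, Complex.normSq_add_mul_I, Real.cos_two_mul, Real.sin_two_mul]
  have h := Real.sin_sq_add_cos_sq (Real.pi * x)
  have h2 : Real.cos (Real.pi * x) ^ 2 = 1 - Real.sin (Real.pi * x) ^ 2 := by linarith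
  ring_nf
  have h4 : Real.cos (Real.pi * x) ^ 4 = (1 - Real.sin (Real.pi * x) ^ 2) ^ 2 := by
    rw [← h2]; ring
  rw [h4, h2]
  ring

theorem sq_le_norm_one_sub_mul_expi_sq {r x : ℝ} (hr : 1 / 2 ≤ r) (hx : |x| ≤ 1 / 2) :
    8 * x ^ 2 ≤ ‖1 - (r : ℂ) * expi x‖ ^ 2 := by
  rw [norm_one_sub_mul_expi_sq]
  have h1 : 2 * |x| ≤ |Real.sin (Real.pi * x)| := by
    have h2 := Real.mul_le_sin (x := Real.pi * |x|) (by positivity) (by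
      nlinarith [Real.pi_pos])
    have e : 2 / Real.pi * (Real.pi * |x|) = 2 * |x| := by
      field_simp
    rw [e] at h2
    refine h2.trans ?_
    rcases abs_choice x with h | h
    · rw [h]; exact le_abs_self _
    · rw [h, mul_neg, Real.sin_neg]; exact neg_le_abs _
  have h3 : 4 * x ^ 2 ≤ Real.sin (Real.pi * x) ^ 2 := by
    rw [← sq_abs x, ← sq_abs (Real.sin _)]
    nlinarith [abs_nonneg x]
  nlinarith [sq_nonneg (1 - r), sq_nonneg x]

/-- For `|j| ≤ 1` the trivial bound `L` suffices. For `|j| ≥ 2` one has `|j| ≤ 8L|x - m|`, and the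
decay of the kernel applies. -/
theorem gridKernel_le_of_floor {L : ℕ} (hL : L ≠ 0) {x : ℝ} (m : ℤ) (hx : |x - m| ≤ 1 / 2) {j : ℤ}
    (hj : ⌊4 * L * (x - m)⌋ = j) : gridKernel L x ≤ 36 * L * (1 / (1 + (j : ℝ) ^ 2)) := by
  have hL0 : (0 : ℝ) < L := by exact_mod_cast Nat.pos_of_ne_zero hL
  set e := x - m with he
  have hexp : expi x = expi e := by rw [he, expi_sub_intCast]
  rw [mul_one_div, le_div_iff₀ (by positivity)]
  rcases le_or_gt |j| 1 with hj1 | hj1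
  · have hjR : |(j : ℝ)| ≤ 1 := by exact_mod_cast hj1
    have hj2 : (j : ℝ) ^ 2 ≤ 1 := by rw [← sq_abs]; nlinarith [abs_nonneg (j : ℝ)]
    nlinarith [gridKernel_le L x, gridKernel_nonneg L x]
  · have hj2 : (2 : ℝ) ≤ |(j : ℝ)| := by exact_mod_cast hj1
    have hfl := Int.floor_eq_iff.mp hj
    have hbig : |(j : ℝ)| - 1 ≤ 4 * L * |e| := by
      have e1 : 4 * L * |e| = |4 * L * e| := by
        rw [abs_mul, abs_of_pos (by positivity : (0 : ℝ) < 4 * L)]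
      rw [e1]
      rcases le_or_gt 0 j with h0 | h0
      · have h0R : (0 : ℝ) ≤ j := by exact_mod_cast h0
        rw [abs_of_nonneg h0R]
        linarith [le_abs_self (4 * L * e)]
      · have h0R : (j : ℝ) < 0 := by exact_mod_cast h0
        rw [abs_of_neg h0R]
        linarith [neg_le_abs (4 * L * e)]
    have hj3 : |(j : ℝ)| ≤ 8 * L * |e| := by linarith
    have hj4 : (j : ℝ) ^ 2 ≤ 64 * (L : ℝ) ^ 2 * e ^ 2 := by
      rw [← sq_abs, ← sq_abs e]
      calc |(j : ℝ)| ^ 2 ≤ (8 * L * |e|) ^ 2 := by gcongr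
        _ = _ := by ring
    have h1 := gridKernel_mul_le hL x
    rw [hexp] at h1
    have h2 := sq_le_norm_one_sub_mul_expi_sq (half_le_geomRatio hL) hx
    have hV := gridKernel_nonneg L x
    have h3 : gridKernel L x * (L * (8 * e ^ 2)) ≤ 9 / 4 := by
      refine le_trans ?_ h1
      gcongr
    have h4 : gridKernel L x * (j : ℝ) ^ 2 ≤ 18 * L := by
      calc gridKernel L x * (j : ℝ) ^ 2 ≤ gridKernel L x * (64 * (L : ℝ) ^ 2 * e ^ 2) := by gcongr
        _ = 8 * L * (gridKernel L x * (L * (8 * e ^ 2))) := by ring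
        _ ≤ 8 * L * (9 / 4) := by gcongr
        _ = 18 * L := by ring
    nlinarith [gridKernel_le L x]

theorem summable_one_div_one_add_sq : Summable fun j : ℤ => 1 / (1 + (j : ℝ) ^ 2) := by
  have h1 : Summable fun j : ℤ => 1 / (j : ℝ) ^ 2 := Real.summable_one_div_int_pow.mpr one_lt_two
  rw [← summable_congr_cofinite (f := fun j : ℤ => if j = 0 then 1 else 1 / (1 + (j : ℝ) ^ 2))]
  · refine Summable.of_norm_bounded_eventually h1 ?_
    have : ({0} : Set ℤ)ᶜ ∈ Filter.cofinite := (Set.finite_singleton 0).compl_mem_cofinite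
    filter_upwards [this] with j hj
    have hj0 : j ≠ 0 := hj
    have hjR : (0 : ℝ) < (j : ℝ) ^ 2 := by positivity
    rw [if_neg hj0, Real.norm_eq_abs, abs_of_nonneg (by positivity)]
    gcongr
    linarith
  · refine Filter.Eventually.of_forall fun j => ?_
    by_cases hj : j = 0 <;> simp [hj]

/-- Sort the `h` into cells by their position at scale `L/4` and their errors at scale `1/(4L)`.
Differences within a cell lie in the counted box, so each cell holds at most `M` points, and the
kernel decay makes the cell weights sum to `O(L²)`. -/
theorem weylSum_le_of_card_le :
    ∃ C : ℝ, 0 < C ∧ ∀ (a : ℝ × ℝ × ℝ) (L : ℕ) (t M : ℝ), L ≠ 0 →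
      (∀ Γ : Finset ((ℤ × ℤ) × (ℤ × ℤ)), (∀ x ∈ Γ, ‖latEmb L t a x‖ ≤ 1 / 4) → (Γ.card : ℝ) ≤ M) →
      weylSum L (t • a) ≤ C * (L : ℝ) ^ 2 * M := by
  set W : ℝ := ∑' j : ℤ, 1 / (1 + (j : ℝ) ^ 2) with hW
  have hW0 : 0 ≤ W := tsum_nonneg fun j => by positivity
  refine ⟨17 ^ 2 * (36 ^ 2 * W ^ 2) + 1, by positivity, fun a L t M hL hM => ?_⟩
  have hL0 : (0 : ℝ) < L := by exact_mod_cast Nat.pos_of_ne_zero hL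
  have hM0 : 0 ≤ M := by simpa using hM ∅ (by simp)
  set y₁ : ℤ × ℤ → ℝ := fun h => 2 * (h.1 * (t * a.1) + h.2 * (t * a.2.1)) with hy₁
  set y₂ : ℤ × ℤ → ℝ := fun h => 2 * (h.1 * (t * a.2.1) + h.2 * (t * a.2.2)) with hy₂
  set lift : ℤ × ℤ → (ℤ × ℤ) × (ℤ × ℤ) := fun h => (h, (round (y₁ h), round (y₂ h))) with hlift
  set key : ℤ × ℤ → (ℤ × ℤ) × (ℤ × ℤ) := fun h =>
    ((⌊4 * (h.1 : ℝ) / L⌋, ⌊4 * (h.2 : ℝ) / L⌋),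
      (⌊4 * L * (y₁ h - round (y₁ h))⌋, ⌊4 * L * (y₂ h - round (y₂ h))⌋)) with hkey
  set I := Finset.Icc (-(2 * L : ℤ)) (2 * L) ×ˢ Finset.Icc (-(2 * L : ℤ)) (2 * L) with hI
  set J := Finset.Icc (-(2 * L : ℤ)) (2 * L) with hJ
  set K := Finset.Icc (-8 : ℤ) 8 with hK
  set w : (ℤ × ℤ) × (ℤ × ℤ) → ℝ := fun k =>
    (36 * L * (1 / (1 + (k.2.1 : ℝ) ^ 2))) * (36 * L * (1 / (1 + (k.2.2 : ℝ) ^ 2))) with hw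
  have hmaps : ∀ h ∈ I, key h ∈ (K ×ˢ K) ×ˢ (J ×ˢ J) := by
    intro h hh
    rw [hI, Finset.mem_product, Finset.mem_Icc, Finset.mem_Icc] at hh
    have c1 : ∀ n : ℤ, -(2 * L : ℤ) ≤ n → n ≤ 2 * L → ⌊4 * (n : ℝ) / L⌋ ∈ K := by
      intro n h1 h2
      have h1R : -(2 * L : ℝ) ≤ n := by exact_mod_cast h1
      have h2R : (n : ℝ) ≤ 2 * L := by exact_mod_cast h2
      rw [hK, Finset.mem_Icc, Int.le_floor, Int.floor_le_iff, le_div_iff₀ hL0, div_lt_iff₀ hL0]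
      push_cast
      constructor <;> linarith
    have c2 : ∀ x : ℝ, ⌊4 * L * (x - round x)⌋ ∈ J := by
      intro x
      have := abs_le.mp (abs_sub_round x)
      rw [hJ, Finset.mem_Icc, Int.le_floor, Int.floor_le_iff]
      push_cast
      constructor <;> nlinarith
    simp only [hkey, Finset.mem_product]
    exact ⟨⟨c1 _ hh.1.1 hh.1.2, c1 _ hh.2.1 hh.2.2⟩, c2 _, c2 _⟩
  have hfiber : ∀ k, ((I.filter fun h => key h = k).card : ℝ) ≤ M := by
    intro k
    rcases (I.filter fun h => key h = k).eq_empty_or_nonempty with he | ⟨h₀, hh₀⟩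
    · rw [he]; simpa using hM0
    have hinj : Function.Injective fun h => lift h - lift h₀ := by
      intro h h' he
      have := sub_left_injective he
      exact congrArg Prod.fst this
    rw [← Finset.card_image_of_injective _ hinj]
    apply hM
    intro x hx
    obtain ⟨h, hh, rfl⟩ := Finset.mem_image.mp hx
    have hkk : key h = key h₀ := (Finset.mem_filter.mp hh).2.trans (Finset.mem_filter.mp hh₀).2.symm
    simp only [hkey, Prod.mk.injEq] at hkk
    obtain ⟨⟨k1, k2⟩, k3, k4⟩ := hkk
    rw [norm_latEmb_le_iff hL0]
    have d1 : ∀ n n' : ℤ, ⌊4 * (n : ℝ) / L⌋ = ⌊4 * (n' : ℝ) / L⌋ → |((n - n' : ℤ) : ℝ)| ≤ L * (1 / 4) := by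
      intro n n' he
      have := Int.abs_sub_lt_one_of_floor_eq_floor he
      rw [← sub_div, abs_div, abs_of_pos hL0, div_lt_one hL0, ← mul_sub, abs_mul] at this
      norm_num at this
      push_cast
      linarith
    have d2 : ∀ x x' : ℝ, ⌊4 * L * x⌋ = ⌊4 * L * x'⌋ → |x - x'| ≤ 1 / 4 / L := by
      intro x x' he
      have := Int.abs_sub_lt_one_of_floor_eq_floor he
      rw [← mul_sub, abs_mul, abs_of_pos (by positivity : (0 : ℝ) < 4 * L)] at this
      rw [le_div_iff₀ hL0]
      linarith
    refine ⟨⟨d1 _ _ k1, d1 _ _ k2⟩, ?_, ?_⟩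
    · convert d2 _ _ k3 using 2
      simp only [latErr₁, hlift, hy₁, Prod.fst_sub, Prod.snd_sub]
      push_cast
      ring
    · convert d2 _ _ k4 using 2
      simp only [latErr₂, hlift, hy₂, Prod.fst_sub, Prod.snd_sub]
      push_cast
      ring
  have hterm : ∀ h, gridKernel L (y₁ h) * gridKernel L (y₂ h) ≤ w (key h) := by
    intro h
    exact mul_le_mul (gridKernel_le_of_floor hL _ (abs_sub_round _) rfl)
      (gridKernel_le_of_floor hL _ (abs_sub_round _) rfl) (gridKernel_nonneg _ _) (by positivity)
  have hw0 : ∀ k, 0 ≤ w k := fun k => by positivity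
  have hsumJ : ∑ j ∈ J, 36 * L * (1 / (1 + (j : ℝ) ^ 2)) ≤ 36 * L * W := by
    rw [← Finset.mul_sum]
    gcongr
    exact summable_one_div_one_add_sq.sum_le_tsum _ fun j _ => by positivity
  calc weylSum L (t • a) = ∑ h ∈ I, gridKernel L (y₁ h) * gridKernel L (y₂ h) := rfl
    _ ≤ ∑ h ∈ I, w (key h) := Finset.sum_le_sum fun h _ => hterm h
    _ = ∑ k ∈ (K ×ˢ K) ×ˢ (J ×ˢ J), ∑ h ∈ I.filter (fun h => key h = k), w (key h) :=
      (Finset.sum_fiberwise_of_maps_to hmaps _).symm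
    _ ≤ ∑ k ∈ (K ×ˢ K) ×ˢ (J ×ˢ J), M * w k := by
      refine Finset.sum_le_sum fun k _ => ?_
      rw [Finset.sum_congr rfl fun h hh => by rw [(Finset.mem_filter.mp hh).2], Finset.sum_const,
        nsmul_eq_mul]
      exact mul_le_mul_of_nonneg_right (hfiber k) (hw0 k)
    _ = M * (17 ^ 2 * ((∑ j ∈ J, 36 * L * (1 / (1 + (j : ℝ) ^ 2))) *
        ∑ j ∈ J, 36 * L * (1 / (1 + (j : ℝ) ^ 2)))) := by
      rw [← Finset.mul_sum, Finset.sum_product]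
      simp only [hw]
      rw [Finset.sum_const, Finset.card_product,
        Finset.sum_mul_sum, ← Finset.sum_product', nsmul_eq_mul]
      have : K.card = 17 := by rw [hK, Int.card_Icc]; rfl
      rw [this]
      norm_num
    _ ≤ M * (17 ^ 2 * ((36 * L * W) * (36 * L * W))) := by
      gcongr
    _ = 17 ^ 2 * (36 ^ 2 * W ^ 2) * (L : ℝ) ^ 2 * M := by ring
    _ ≤ _ := by
      gcongr
      linarith

/-! ### Bounds for the Weyl sum and for the kernel -/

theorem one_le_bracket (t : ℝ) : 1 ≤ bracket t :=
  Real.one_le_sqrt.mpr (by nlinarith [sq_nonneg t])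

theorem le_bracket (t : ℝ) : t ≤ bracket t :=
  Real.le_sqrt_of_sq_le (by linarith)

theorem weylSum_le {L : ℕ} (hL : L ≠ 0) (θ : ℝ × ℝ × ℝ) : weylSum L θ ≤ 25 * (L : ℝ) ^ 4 := by
  have h1 : (2 * (L : ℤ) + 1 - (-(2 * L : ℤ))).toNat = 4 * L + 1 := by omega
  have h2 : ((4 * L + 1 : ℕ) : ℝ) ≤ 5 * L := by
    exact_mod_cast (by omega : 4 * L + 1 ≤ 5 * L)
  calc weylSum L θ ≤ ∑ h ∈ Finset.Icc (-(2 * L : ℤ)) (2 * L) ×ˢ Finset.Icc (-(2 * L : ℤ)) (2 * L),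
        (L : ℝ) * L := Finset.sum_le_sum fun h _ =>
          mul_le_mul (gridKernel_le _ _) (gridKernel_le _ _) (gridKernel_nonneg _ _) (by positivity)
    _ = ((4 * L + 1 : ℕ) : ℝ) * ((4 * L + 1 : ℕ) : ℝ) * (L * L) := by
      rw [Finset.sum_const, Finset.card_product, Int.card_Icc, h1, nsmul_eq_mul, Nat.cast_mul]
    _ ≤ (5 * L) * (5 * L) * (L * L) := by gcongr
    _ = _ := by ring

/-- For `t ≤ L⁴` the loss `(tL²)^η` is at most `L^(6η)`. For `t ≥ L⁴` the trivial bound `25 L⁴`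
already suffices, because `L^(4/3) ≤ ⟨t⟩^(1/3)`. -/
theorem IsAdmissible.exists_weylSum_le {η : ℝ} (hη : 0 < η) {a : ℝ × ℝ × ℝ}
    (h : IsAdmissible (symMatrix a)) (hD : IsDiophantine η a) (hS : IsSimDiophantine η a) :
    ∃ C : ℝ, 0 < C ∧ ∀ (L : ℕ) (t : ℝ), L ≠ 0 → 1 / (L : ℝ) < t →
      weylSum L (t • a) ≤ C * ((L : ℝ) ^ (8 / 3 + 6 * η) * bracket t ^ (1 / 3 : ℝ)) := by
  obtain ⟨C₁, hC₁, h1⟩ := weylSum_le_of_card_le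
  obtain ⟨C₂, hC₂, h2⟩ := h.exists_card_le hη hD hS
  refine ⟨C₁ * (2 * C₂) + 25, by positivity, fun L t hL ht => ?_⟩
  have hL1 : (1 : ℝ) ≤ L := by exact_mod_cast Nat.one_le_iff_ne_zero.mpr hL
  have hL0 : (0 : ℝ) < L := by linarith
  have ht0 : 0 < t := lt_trans (by positivity) ht
  have hb := one_le_bracket t
  have hbt := le_bracket t
  have hb0 : 0 < bracket t := by linarith
  rcases le_total t ((L : ℝ) ^ 4) with hle | hge
  · have hLe : (1 : ℝ) ≤ (L : ℝ) ^ (6 * η) := Real.one_le_rpow hL1 (by positivity)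
    have hb3 : 1 ≤ bracket t ^ (1 / 3 : ℝ) := Real.one_le_rpow hb (by norm_num)
    have e1 : (t * (L : ℝ) ^ 2) ^ (1 / 3 + η) ≤
        (L : ℝ) ^ (2 / 3 : ℝ) * ((L : ℝ) ^ (6 * η) * bracket t ^ (1 / 3 : ℝ)) := by
      rw [Real.rpow_add (by positivity)]
      have i1 : (t * (L : ℝ) ^ 2) ^ (1 / 3 : ℝ) ≤ bracket t ^ (1 / 3 : ℝ) * (L : ℝ) ^ (2 / 3 : ℝ) := by
        rw [Real.mul_rpow ht0.le (by positivity), ← Real.rpow_natCast_mul hL0.le]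
        norm_num
        gcongr
      have i2 : (t * (L : ℝ) ^ 2) ^ η ≤ (L : ℝ) ^ (6 * η) := by
        calc (t * (L : ℝ) ^ 2) ^ η ≤ ((L : ℝ) ^ 4 * (L : ℝ) ^ 2) ^ η := by gcongr
          _ = (L : ℝ) ^ (6 * η) := by
            rw [← pow_add, ← Real.rpow_natCast_mul hL0.le]
            norm_num
      calc _ ≤ (bracket t ^ (1 / 3 : ℝ) * (L : ℝ) ^ (2 / 3 : ℝ)) * (L : ℝ) ^ (6 * η) := by gcongr
        _ = _ := by ring
    have e2 : (L : ℝ) ^ (2 / 3 : ℝ) ≤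
        (L : ℝ) ^ (2 / 3 : ℝ) * ((L : ℝ) ^ (6 * η) * bracket t ^ (1 / 3 : ℝ)) :=
      le_mul_of_one_le_right (by positivity) (one_le_mul_of_one_le_of_one_le hLe hb3)
    have e3 : (L : ℝ) ^ (8 / 3 + 6 * η) = (L : ℝ) ^ 2 * (L : ℝ) ^ (2 / 3 : ℝ) * (L : ℝ) ^ (6 * η) := by
      rw [← Real.rpow_natCast, ← Real.rpow_add hL0, ← Real.rpow_add hL0]
      norm_num
    calc weylSum L (t • a) ≤ C₁ * (L : ℝ) ^ 2 *
          (C₂ * ((t * (L : ℝ) ^ 2) ^ (1 / 3 + η) + (L : ℝ) ^ (2 / 3 : ℝ))) :=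
            h1 a L t _ hL (h2 L t hL1 ht)
      _ ≤ C₁ * (L : ℝ) ^ 2 *
          (C₂ * ((L : ℝ) ^ (2 / 3 : ℝ) * ((L : ℝ) ^ (6 * η) * bracket t ^ (1 / 3 : ℝ)) +
            (L : ℝ) ^ (2 / 3 : ℝ) * ((L : ℝ) ^ (6 * η) * bracket t ^ (1 / 3 : ℝ)))) := by gcongr
      _ = C₁ * (2 * C₂) * ((L : ℝ) ^ (8 / 3 + 6 * η) * bracket t ^ (1 / 3 : ℝ)) := by
        rw [e3]; ring
      _ ≤ _ := by gcongr; linarith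
  · have e1 : (L : ℝ) ^ (4 / 3 : ℝ) ≤ bracket t ^ (1 / 3 : ℝ) := by
      calc (L : ℝ) ^ (4 / 3 : ℝ) = ((L : ℝ) ^ 4) ^ (1 / 3 : ℝ) := by
            rw [← Real.rpow_natCast_mul hL0.le]; norm_num
        _ ≤ _ := by gcongr; linarith
    have e2 : (L : ℝ) ^ 4 = (L : ℝ) ^ (8 / 3 : ℝ) * (L : ℝ) ^ (4 / 3 : ℝ) := by
      rw [← Real.rpow_natCast, ← Real.rpow_add hL0]
      norm_num
    calc weylSum L (t • a) ≤ 25 * (L : ℝ) ^ 4 := weylSum_le hL _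
      _ = 25 * ((L : ℝ) ^ (8 / 3 : ℝ) * (L : ℝ) ^ (4 / 3 : ℝ)) := by rw [e2]
      _ ≤ 25 * ((L : ℝ) ^ (8 / 3 + 6 * η) * bracket t ^ (1 / 3 : ℝ)) := by
        gcongr
        linarith
      _ ≤ _ := by
        gcongr
        have : 0 < C₁ * (2 * C₂) := by positivity
        linarith

/-! ### The almost sure second moment bound -/

theorem norm_formMul_sub_le {L : ℕ} {p p' : (ℤ × ℤ) × (ℤ × ℤ)} (hp : p ∈ weylIndex L)
    (hp' : p' ∈ weylIndex L) : ‖formMul p - formMul p'‖ ≤ 8 * (L : ℝ) ^ 2 := by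
  obtain ⟨a1, a2, a3⟩ := formMul_bound hp
  obtain ⟨b1, b2, b3⟩ := formMul_bound hp'
  have hL : (0 : ℤ) ≤ (L : ℤ) ^ 2 := by positivity
  have key : ∀ x y : ℤ, |x| ≤ 4 * (L : ℤ) ^ 2 → |y| ≤ 4 * (L : ℤ) ^ 2 →
      ‖x - y‖ ≤ 8 * (L : ℝ) ^ 2 := by
    intro x y hx hy
    rw [Int.norm_eq_abs]
    have : |x - y| ≤ 8 * (L : ℤ) ^ 2 := (abs_sub _ _).trans (by linarith)
    exact_mod_cast this
  refine norm_prod_le_iff.mpr ⟨key _ _ (by linarith) (by linarith),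
    norm_prod_le_iff.mpr ⟨key _ _ a2 b2, key _ _ (by linarith) (by linarith)⟩⟩

/-- Frequency differences have norm `O(L²)`, so exponent 3 separates them by a multiple of `L⁻⁶`.
The `O(L⁸)` pairs then contribute `O(L^14)`, absorbed by `L⁴ T` once `T ≥ L^10`. -/
theorem IsDiophantine.exists_integral_weylSum_sq_le {a : ℝ × ℝ × ℝ} (hD : IsDiophantine 1 a) {σ : ℝ}
    (hσ : 0 < σ) :
    ∃ C : ℝ, 0 < C ∧ ∀ (L : ℕ) (T : ℝ), L ≠ 0 → (L : ℝ) ^ 10 ≤ T → 1 ≤ T →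
      ∫ t in (1 : ℝ)..T, weylSum L (t • a) ^ 2 ≤ C * ((L : ℝ) ^ (4 + σ) * T) := by
  obtain ⟨c, hc, hfreq⟩ := hD
  obtain ⟨C, hC, hcount⟩ := exists_card_formMul_eq_le hσ
  refine ⟨C + 225 ^ 2 * (8 ^ 3 / c), by positivity, fun L T hL hLT hT => ?_⟩
  have hL1 : (1 : ℝ) ≤ L := by exact_mod_cast Nat.one_le_iff_ne_zero.mpr hL
  have hL0 : (0 : ℝ) < L := by linarith
  have hκ : 0 < c / (8 * (L : ℝ) ^ 2) ^ 3 := by positivity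
  have hcard : ((weylIndex L).card : ℝ) ≤ 225 * (L : ℝ) ^ 4 := by exact_mod_cast card_weylIndex_le hL
  refine (integral_weylSum_sq_le_of_lower L a hκ ?_ hT).trans ?_
  · intro q hq hne
    have hv : formMul q.1 - formMul q.2 ≠ 0 := sub_ne_zero.mpr hne
    have hn := norm_formMul_sub_le (Finset.mem_product.mp hq).1 (Finset.mem_product.mp hq).2
    rw [div_le_iff₀ (by positivity)]
    refine (hfreq _ hv).trans ?_
    have : ((2 : ℝ) + 1) = (3 : ℕ) := by norm_num
    rw [this, Real.rpow_natCast]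
    gcongr
  · have hd : (diagCount L : ℝ) ≤ C * (L : ℝ) ^ (4 + σ) := hcount L hL
    have hLσ : (L : ℝ) ^ 4 ≤ (L : ℝ) ^ (4 + σ) := by
      rw [← Real.rpow_natCast]
      exact Real.rpow_le_rpow_of_exponent_le hL1 (by norm_num; linarith)
    calc _ ≤ C * (L : ℝ) ^ (4 + σ) * T +
          (225 * (L : ℝ) ^ 4) ^ 2 * (1 / (c / (8 * (L : ℝ) ^ 2) ^ 3)) := by gcongr
      _ = C * ((L : ℝ) ^ (4 + σ) * T) + 225 ^ 2 * (8 ^ 3 / c) * ((L : ℝ) ^ 4 * (L : ℝ) ^ 10) := by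
        field_simp
      _ ≤ C * ((L : ℝ) ^ (4 + σ) * T) + 225 ^ 2 * (8 ^ 3 / c) * ((L : ℝ) ^ (4 + σ) * T) := by gcongr
      _ = _ := by ring

/-- The uniform second moment bound for dyadic Weyl sums. -/
def HasMomentBound (σ : ℝ) (a : ℝ × ℝ × ℝ) : Prop :=
  ∃ C : ℝ, 0 < C ∧ ∀ (j : ℕ) (T : ℝ), 1 ≤ T →
    ∫ t in (1 : ℝ)..T, weylSum (2 ^ j) (t • a) ^ 2 ≤ C * (((2 : ℝ) ^ j) ^ (4 + 11 * σ) * T)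

theorem ae_hasMomentBound {σ : ℝ} (hσ : 0 < σ) :
    ∀ᵐ a : ℝ × ℝ × ℝ, a ∈ cube 2 → HasMomentBound σ a := by
  have hae := (ae_restrict_iff' (measurableSet_cube 2)).mp (ae_exists_integral_weylSum_sq_le hσ hσ)
  filter_upwards [hae, ae_isDiophantine zero_lt_one] with a h1 h2 ha
  obtain ⟨C₁, hC₁, h1⟩ := h1 ha
  obtain ⟨C₂, hC₂, h2⟩ := (h2 ha).exists_integral_weylSum_sq_le hσ
  refine ⟨C₁ + C₂, by positivity, fun j T hT => ?_⟩
  have hL1 : (1 : ℝ) ≤ 2 ^ j := one_le_pow₀ one_le_two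
  have hL0 : (0 : ℝ) < 2 ^ j := by positivity
  have hT0 : 0 < T := by linarith
  -- Up to `L^10` the loss `T^σ` is at most `L^(10σ)`, which accounts for the total exponent `4 +
  -- 11σ`.
  rcases le_total T (((2 : ℝ) ^ j) ^ 10) with hle | hge
  · have e : T ^ σ ≤ ((2 : ℝ) ^ j) ^ (10 * σ) := by
      calc T ^ σ ≤ (((2 : ℝ) ^ j) ^ 10) ^ σ := by gcongr
        _ = _ := by rw [← Real.rpow_natCast_mul hL0.le]; norm_num
    calc _ ≤ C₁ * ((2 : ℝ) ^ j) ^ (4 + σ) * T ^ (1 + σ) := h1 j T hT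
      _ = C₁ * ((2 : ℝ) ^ j) ^ (4 + σ) * (T * T ^ σ) := by
        rw [Real.rpow_add hT0, Real.rpow_one]
      _ ≤ C₁ * ((2 : ℝ) ^ j) ^ (4 + σ) * (T * ((2 : ℝ) ^ j) ^ (10 * σ)) := by gcongr
      _ = C₁ * (((2 : ℝ) ^ j) ^ (4 + 11 * σ) * T) := by
        rw [show 4 + 11 * σ = (4 + σ) + 10 * σ by ring, Real.rpow_add hL0 (4 + σ)]; ring
      _ ≤ _ := by gcongr; linarith
  · have := h2 (2 ^ j) T (by positivity) (by exact_mod_cast hge) hT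
    push_cast at this
    calc _ ≤ C₂ * (((2 : ℝ) ^ j) ^ (4 + σ) * T) := this
      _ ≤ C₂ * (((2 : ℝ) ^ j) ^ (4 + 11 * σ) * T) := by
        gcongr
        linarith
      _ ≤ _ := by gcongr; linarith

theorem exists_two_pow_between {N : ℝ} (hN : 1 ≤ N) : ∃ j : ℕ, N ≤ (2 : ℝ) ^ j ∧ (2 : ℝ) ^ j ≤ 2 * N := by
  obtain ⟨n, h1, h2⟩ := exists_nat_pow_near hN one_lt_two
  exact ⟨n + 1, h2.le, by rw [pow_succ]; linarith⟩

/-! ### Passage from the Weyl sum to the kernel -/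

theorem IsCutoff.exists_supK_sq_le {χ : ℝ → ℝ} (hχ : IsCutoff χ) :
    ∃ C : ℝ, 0 < C ∧ ∀ (a : ℝ × ℝ × ℝ) (N : ℝ) (L : ℕ), 1 ≤ N → N ≤ L → (L : ℝ) ≤ 2 * N → ∀ t : ℝ,
      BddAbove (Set.range fun x => ‖kernelK χ (symMatrix a) N t x‖) ∧
      supK χ (symMatrix a) N t ^ 2 ≤ C * weylSum L (t • a) := by
  obtain ⟨C, hC, h⟩ := hχ.exists_norm_kernelK_sq_le
  refine ⟨C, hC, fun a N L hN h1 h2 t => ?_⟩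
  have hle : ∀ x, ‖kernelK χ (symMatrix a) N t x‖ ≤ Real.sqrt (C * weylSum L (t • a)) :=
    fun x => Real.le_sqrt_of_sq_le (h a N L hN h1 h2 t x)
  refine ⟨⟨_, Set.forall_mem_range.mpr hle⟩, ?_⟩
  have h0 : 0 ≤ supK χ (symMatrix a) N t := Real.iSup_nonneg fun x => norm_nonneg _
  have hW := mul_nonneg hC.le (weylSum_nonneg L (t • a))
  calc supK χ (symMatrix a) N t ^ 2 ≤ Real.sqrt (C * weylSum L (t • a)) ^ 2 := by
        gcongr
        exact ciSup_le hle
    _ = _ := Real.sq_sqrt hW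

/-- The kernel is jointly continuous and the torus is compact. This supplies integrability of the
fourth power. -/
theorem IsCutoff.continuous_supK {χ : ℝ → ℝ} (hχ : IsCutoff χ) (α : Matrix (Fin 2) (Fin 2) ℝ) {N : ℝ}
    (hN : 0 < N) : Continuous (supK χ α N) := by
  obtain ⟨L, hL⟩ := exists_nat_ge N
  have hcont : Continuous fun p : ℝ × UnitAddTorus (Fin 2) => ‖kernelK χ α N p.1 p.2‖ := by
    simp_rw [kernelK_eq_sum hχ α hN hL, kernelPhase]
    have := continuous_expi
    fun_prop
  have := isCompact_univ.continuous_sSup (f := fun t x => ‖kernelK χ α N t x‖) hcont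
  simp only [Set.image_univ] at this
  exact this

theorem IsCutoff.supK_le {χ : ℝ → ℝ} (hχ : IsCutoff χ) {a : ℝ × ℝ × ℝ} {η ε : ℝ} (hη : 0 < η)
    (hηε : η ≤ ε) (h : IsAdmissible (symMatrix a)) (hD : IsDiophantine (η / 3) a)
    (hS : IsSimDiophantine (η / 3) a) :
    ∃ C : ℝ, 0 < C ∧ ∀ N : ℝ, 1 ≤ N → ∀ t : ℝ, 1 / N < t →
        BddAbove (Set.range fun x => ‖kernelK χ (symMatrix a) N t x‖) ∧
        supK χ (symMatrix a) N t
          ≤ C * N ^ ε * (N ^ (4 / 3 : ℝ) * bracket t ^ (1 / 6 : ℝ)) := by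
  obtain ⟨C₁, hC₁, h1⟩ := hχ.exists_supK_sq_le
  -- Parameter `η/3`: the Weyl sum then loses `L^(2η)`, and its square root loses `N^η ≤ N^ε`.
  obtain ⟨C₂, hC₂, h2⟩ := h.exists_weylSum_le (by positivity) hD hS
  set B : ℝ := C₁ * (C₂ * 2 ^ (8 / 3 + 2 * η)) with hB
  refine ⟨Real.sqrt B, by positivity, fun N hN t ht => ?_⟩
  have hN0 : 0 < N := by linarith
  have hb0 : 0 < bracket t := by linarith [one_le_bracket t]
  obtain ⟨j, hj1, hj2⟩ := exists_two_pow_between hN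
  obtain ⟨hbdd, hK⟩ := h1 a N (2 ^ j) hN (by exact_mod_cast hj1) (by exact_mod_cast hj2) t
  refine ⟨hbdd, ?_⟩
  have htj : 1 / (((2 ^ j : ℕ) : ℝ)) < t :=
    lt_of_le_of_lt (one_div_le_one_div_of_le hN0 (by exact_mod_cast hj1)) ht
  refine (le_abs_self _).trans (abs_le_of_sq_le_sq ?_ (by positivity))
  have e1 : N ^ (8 / 3 + 2 * ε) = (N ^ ε) ^ 2 * (N ^ (4 / 3 : ℝ)) ^ 2 := by
    rw [← Real.rpow_mul_natCast hN0.le, ← Real.rpow_mul_natCast hN0.le, ← Real.rpow_add hN0]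
    congr 1; push_cast; ring
  have e2 : bracket t ^ (1 / 3 : ℝ) = (bracket t ^ (1 / 6 : ℝ)) ^ 2 := by
    rw [← Real.rpow_mul_natCast hb0.le]
    norm_num
  calc supK χ (symMatrix a) N t ^ 2 ≤ C₁ * weylSum (2 ^ j) (t • a) := hK
    _ ≤ C₁ * (C₂ * (((2 ^ j : ℕ) : ℝ) ^ (8 / 3 + 6 * (η / 3)) * bracket t ^ (1 / 3 : ℝ))) := by
      gcongr
      exact h2 _ t (by positivity) htj
    _ ≤ C₁ * (C₂ * ((2 * N) ^ (8 / 3 + 2 * η) * bracket t ^ (1 / 3 : ℝ))) := by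
      rw [show 6 * (η / 3) = 2 * η by ring]
      gcongr
      exact_mod_cast hj2
    _ = B * (N ^ (8 / 3 + 2 * η) * bracket t ^ (1 / 3 : ℝ)) := by
      rw [Real.mul_rpow zero_le_two hN0.le, hB]; ring
    _ ≤ B * (N ^ (8 / 3 + 2 * ε) * bracket t ^ (1 / 3 : ℝ)) := by
      gcongr
    _ = (Real.sqrt B * N ^ ε * (N ^ (4 / 3 : ℝ) * bracket t ^ (1 / 6 : ℝ))) ^ 2 := by
      rw [e1, e2, mul_pow, mul_pow, mul_pow, Real.sq_sqrt (by positivity)]; ring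

theorem IsCutoff.integral_supK_pow_le {χ : ℝ → ℝ} (hχ : IsCutoff χ) {a : ℝ × ℝ × ℝ} {σ ε : ℝ}
    (hσ : 0 < σ) (hσε : 11 * σ ≤ ε) (hM : HasMomentBound σ a) :
    ∃ C : ℝ, 0 < C ∧ ∀ N : ℝ, 1 ≤ N → ∀ T : ℝ, 1 ≤ T →
        IntervalIntegrable (fun t => supK χ (symMatrix a) N t ^ 4) volume 1 T ∧
        ∫ t in (1 : ℝ)..T, supK χ (symMatrix a) N t ^ 4
          ≤ C * N ^ ε * (N ^ 4 * T) := by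
  obtain ⟨C₁, hC₁, h1⟩ := hχ.exists_supK_sq_le
  obtain ⟨C₂, hC₂, h2⟩ := hM
  refine ⟨C₁ ^ 2 * (C₂ * 2 ^ (4 + 11 * σ)), by positivity, fun N hN T hT => ?_⟩
  have hN0 : 0 < N := by linarith
  have hint : IntervalIntegrable (fun t => supK χ (symMatrix a) N t ^ 4) volume 1 T :=
    ((hχ.continuous_supK (symMatrix a) hN0).pow 4).intervalIntegrable _ _
  refine ⟨hint, ?_⟩
  obtain ⟨j, hj1, hj2⟩ := exists_two_pow_between hN
  have hcont : Continuous fun t : ℝ => C₁ ^ 2 * weylSum (2 ^ j) (t • a) ^ 2 := by fun_prop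
  have e : N ^ (4 + ε) = N ^ ε * N ^ 4 := by
    rw [Real.rpow_add hN0, mul_comm]
    norm_cast
  calc ∫ t in (1 : ℝ)..T, supK χ (symMatrix a) N t ^ 4
      ≤ ∫ t in (1 : ℝ)..T, C₁ ^ 2 * weylSum (2 ^ j) (t • a) ^ 2 := by
        refine intervalIntegral.integral_mono_on hT hint (hcont.intervalIntegrable _ _) fun t _ => ?_
        have hK := (h1 a N (2 ^ j) hN (by exact_mod_cast hj1) (by exact_mod_cast hj2) t).2
        calc supK χ (symMatrix a) N t ^ 4 = (supK χ (symMatrix a) N t ^ 2) ^ 2 := by ring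
          _ ≤ (C₁ * weylSum (2 ^ j) (t • a)) ^ 2 := by gcongr
          _ = _ := by ring
    _ = C₁ ^ 2 * ∫ t in (1 : ℝ)..T, weylSum (2 ^ j) (t • a) ^ 2 :=
      intervalIntegral.integral_const_mul _ _
    _ ≤ C₁ ^ 2 * (C₂ * (((2 : ℝ) ^ j) ^ (4 + 11 * σ) * T)) := by
      gcongr
      exact h2 j T hT
    _ ≤ C₁ ^ 2 * (C₂ * ((2 * N) ^ (4 + 11 * σ) * T)) := by gcongr
    _ = C₁ ^ 2 * (C₂ * 2 ^ (4 + 11 * σ)) * (N ^ (4 + 11 * σ) * T) := by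
      rw [Real.mul_rpow zero_le_two hN0.le]; ring
    _ ≤ C₁ ^ 2 * (C₂ * 2 ^ (4 + 11 * σ)) * (N ^ (4 + ε) * T) := by
      gcongr
    _ = _ := by rw [e]; ring

theorem mainTheorem3 (χ : ℝ → ℝ) (hχ : IsCutoff χ) :
    ∀ᵐ a : ℝ × ℝ × ℝ ∂volume, IsAdmissible (symMatrix a) →
      (∀ ε : ℝ, 0 < ε → ∃ C : ℝ, 0 < C ∧ ∀ N : ℝ, 1 ≤ N → ∀ t : ℝ, 1 / N < t →
        BddAbove (Set.range fun x => ‖kernelK χ (symMatrix a) N t x‖) ∧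
        supK χ (symMatrix a) N t
          ≤ C * N ^ ε * (N ^ (4 / 3 : ℝ) * bracket t ^ (1 / 6 : ℝ))) ∧
      (∀ ε : ℝ, 0 < ε → ∃ C : ℝ, 0 < C ∧ ∀ N : ℝ, 1 ≤ N → ∀ T : ℝ, 1 ≤ T →
        IntervalIntegrable (fun t => supK χ (symMatrix a) N t ^ 4) volume 1 T ∧
        ∫ t in (1 : ℝ)..T, supK χ (symMatrix a) N t ^ 4
          ≤ C * N ^ ε * (N ^ 4 * T)) := by
  have hpos : ∀ n : ℕ, (0 : ℝ) < 1 / (n + 1) := fun n => Nat.one_div_pos_of_nat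
  -- Restricting the small parameters to `1/(n+1)` keeps the exceptional set a countable union of
  -- null sets, so it does not depend on `ε`.
  have hD := ae_all_iff.mpr fun n : ℕ => ae_isDiophantine (η := 1 / (n + 1 : ℝ) / 3)
    (div_pos (hpos n) (by norm_num))
  have hS := ae_all_iff.mpr fun n : ℕ => ae_isSimDiophantine (η := 1 / (n + 1 : ℝ) / 3)
    (div_pos (hpos n) (by norm_num))
  have hM := ae_all_iff.mpr fun n : ℕ => ae_hasMomentBound (hpos n)
  filter_upwards [hD, hS, hM] with a hD hS hM h
  refine ⟨fun ε hε => ?_, fun ε hε => ?_⟩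
  · obtain ⟨n, hn⟩ := exists_nat_one_div_lt hε
    exact hχ.supK_le (hpos n) hn.le h (hD n h.mem_cube) (hS n h.mem_cube h.lower_bounds.1.le)
  · obtain ⟨n, hn⟩ := exists_nat_one_div_lt (div_pos hε (by norm_num : (0 : ℝ) < 11))
    refine hχ.integral_supK_pow_le (hpos n) ?_ (hM n h.mem_cube)
    linarith [(lt_div_iff₀ (by norm_num : (0 : ℝ) < 11)).mp hn]
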